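/- Let $\sigma\in(\tfrac12,1)$ be fixed and let $N\ge 0$ be an integer. For real $y>0$ and $s\in\mathbb C$ put $$\zeta(s;y):=\prod_{p\le y}\Big(1-\frac1{p^{s}}\Big)^{-1},$$ the product being over primes $p\le y$. Let $I_0(t):=\int_0^1 e^{t\cos(2\pi\theta)}\,d\theta$ be the modified Bessel function of order $0$, and for integers $n\ge0$ let $$C_n:=\int_0^\infty\frac{(\log t)^n}{t^{1/\sigma+1}}\,\log I_0(t)\,dt .$$ These integrals converge absolutely, $C_0>0$, and $$\frac1T\int_T^{2T}|\zeta(\sigma+it;y)|^k\,dt=\exp\bigg(\frac{k^{1/\sigma}}{\log k}\bigg\{\sum_{n=0}^N\frac{C_n}{(\log k)^n}+O\bigg(\frac1{(\log k)^{N+1}}+\Big(\frac{k^{1/\sigma}}{y}\Big)^{2\sigma-1}\bigg)\bigg\}\bigg)$$ uniformly for all real $T\ge3$, $y>0$ and $k>1$ (not necessarily an integer) with $$k\,y^{1-\sigma}\le\tfrac18(1-\sigma)\log T .$$ The implied constant depends only on $\sigma$ and $N$. -/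

import Mathlib

/-- The modified Bessel function of order `0`: `I₀(t) = ∫₀¹ exp(t cos(2πθ)) dθ`. -/
noncomputable def besselIZero (t : ℝ) : ℝ :=
  ∫ θ in (0 : ℝ)..1, Real.exp (t * Real.cos (2 * Real.pi * θ))

/-- The short Euler product `ζ(s; y) = ∏_{p ≤ y} (1 - 1 / p ^ s)⁻¹`, over the primes `p ≤ y`. -/
noncomputable def shortEulerProduct (s : ℂ) (y : ℝ) : ℂ :=
  ∏ p ∈ (Finset.Icc 1 ⌊y⌋₊).filter Nat.Prime, (1 - 1 / (p : ℂ) ^ s)⁻¹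

/-- The moment `(1/T) ∫_T^{2T} |ζ(σ + it; y)| ^ k dt`, for a real exponent `k`. -/
noncomputable def shortEulerMoment (σ T y k : ℝ) : ℝ :=
  (1 / T) * ∫ t in T..(2 * T), ‖shortEulerProduct ((σ : ℂ) + Complex.I * (t : ℂ)) y‖ ^ k

/-- The integrand `(log t) ^ n / t ^ (1/σ + 1) * log I₀(t)`. -/
noncomputable def momentCoeffIntegrand (σ : ℝ) (n : ℕ) (t : ℝ) : ℝ :=
  Real.log t ^ n / t ^ (1 / σ + 1) * Real.log (besselIZero t)

/-- The coefficient `C_n = ∫₀^∞ (log t) ^ n / t ^ (1/σ + 1) * log I₀(t) dt`. -/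
noncomputable def momentCoeff (σ : ℝ) (n : ℕ) : ℝ :=
  ∫ t in Set.Ioi (0 : ℝ), momentCoeffIntegrand σ n t

/-! Write `x = k^{1/σ}` and `ζ(s; y)^{k/2} = ∑ d(n) n^{-s}`, the sum over the integers `n` all of whose
prime factors are `≤ y`. It converges absolutely for `Re s > 0`, with `d ≥ 0` multiplicative, so the
moment is the mean square of a sum of exponentials with the frequencies `log n`. Its diagonal is
`∏_{p ≤ y} ∫₀¹ ‖1 - p^{-σ} e(θ)‖^{-k} dθ` (`hasSum_mulCoeff_negBinomCoeff_sq`), and the condition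
`k y^{1-σ} ≤ (1 - σ) log T / 8` makes the remaining terms at most half of it for large `y`
(`abs_shortEulerMoment_sub_prod_le`, `exists_abs_log_shortEulerMoment_sub_le`). As
`‖1 - z‖^{-k} = exp(k Re z + O(k ‖z‖²))`, the factor at `p` is `I₀(k p^{-σ}) exp(O(k p^{-2σ}))`, and
`σ > 1/2` gives
`log(moment) = ∑_{p ≤ y} log I₀(k p^{-σ}) + O(k)`.

The sum over primes is evaluated with the prime number theorem in the form
`θ(x) = x + O(x / (log x)^m)` for every `m` (`exists_abs_theta_sub_le`), which is proved from
polynomial bounds for `ζ` and `1/ζ` near the line `Re s = 1`, through Perron's formula for the sums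
of `(Λ(n) - 1) (log n)^{2m}` with the weight `log⁺(x/n)`. As `log I₀(t) ≤ min(t, t²)` for `t ≥ 0`, the
sum is concentrated around `p` of size `x`. It equals `∫_2^y log I₀(k u^{-σ}) / log u du` up to
`O(x / (log k)^{N+2})`, and the part of the integral beyond `y` is `O((x / log k) (x/y)^{2σ-1})`. The
substitution `t = k u^{-σ}` and the expansion of `1 / (log k - log t)` in powers of `log t / log k`
turn the full integral into `(x / log k) ∑ C_n / (log k)^n` (`exists_abs_sum_logBessel_sub_le`). The
error `O(k)` is smaller than this because `σ < 1`.

Two ranges are elementary. For bounded `k` the moment is bounded from above and from below; and for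
`y < x` the pointwise bound for `ζ(σ + it; y)` is absorbed by the error term `(x/y)^{2σ-1}`. -/

/-! ### Partial sums of the zeta function -/

open Complex in
/-- The Euler–Maclaurin difference `(n+1)^{-s} - ∫_n^{n+1} u^{-s} du`, in closed form. -/
noncomputable def zetaDiff (s : ℂ) (n : ℕ) : ℂ :=
  ((n : ℂ) + 1) ^ (-s) - (((n : ℂ) + 1) ^ (1 - s) - (n : ℂ) ^ (1 - s)) / (1 - s)

/-- By the mean value theorem, applied to `u^{1-s}/(1-s) - u (n+1)^{-s}` and to its derivative. -/
lemma norm_zetaDiff_le {s : ℂ} (hs : 0 < s.re) (hs1 : s ≠ 1) {n : ℕ} (hn : 1 ≤ n) :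
    ‖zetaDiff s n‖ ≤ ‖s‖ * (n : ℝ) ^ (-s.re - 1) := by
  have hn0 : (0 : ℝ) < n := by exact_mod_cast hn
  have h1s : 1 - s ≠ 0 := sub_ne_zero.2 hs1.symm
  have hder : ∀ u ∈ Set.Icc (n : ℝ) (n + 1), ∀ c : ℂ, HasDerivWithinAt
      (fun u : ℝ => (u : ℂ) ^ (1 - s) / (1 - s) - (u : ℂ) * c) ((u : ℂ) ^ (-s) - c)
      (Set.Icc (n : ℝ) (n + 1)) u := by
    intro u hu c
    have hu0 : 0 < u := lt_of_lt_of_le hn0 hu.1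
    have h := (hasDerivAt_ofReal_cpow_const' (x := u) (r := -s) hu0.ne'
      (by rwa [Ne, neg_inj])).sub ((hasDerivAt_id u).ofReal_comp.mul_const c)
    rw [show -s + 1 = 1 - s by ring] at h
    have e : (u : ℂ) ^ (-s) - c = (u : ℂ) ^ (-s) - ((1 : ℝ) : ℂ) * c := by simp
    rw [e]
    exact h.hasDerivWithinAt
  have hder2 : ∀ u ∈ Set.Icc (n : ℝ) (n + 1), HasDerivWithinAt
      (fun u : ℝ => (u : ℂ) ^ (-s)) (-s * (u : ℂ) ^ (-s - 1))
      (Set.Icc (n : ℝ) (n + 1)) u := by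
    intro u hu
    have hu0 : 0 < u := lt_of_lt_of_le hn0 hu.1
    have hs0 : -s ≠ 0 := by
      intro h
      have := congrArg Complex.re h
      simp at this
      linarith
    exact (hasDerivAt_ofReal_cpow_const (x := u) hu0.ne' hs0).hasDerivWithinAt
  have hconv : Convex ℝ (Set.Icc (n : ℝ) (n + 1)) := convex_Icc _ _
  have hmemn : (n : ℝ) ∈ Set.Icc (n : ℝ) (n + 1) := ⟨le_rfl, by linarith⟩
  have hmemn1 : (n : ℝ) + 1 ∈ Set.Icc (n : ℝ) (n + 1) := ⟨by linarith, le_rfl⟩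
  set c : ℂ := ((n : ℂ) + 1) ^ (-s) with hc
  have hbd : ∀ u ∈ Set.Icc (n : ℝ) (n + 1), ‖(u : ℂ) ^ (-s) - c‖ ≤
      ‖s‖ * (n : ℝ) ^ (-s.re - 1) := by
    intro u hu
    have hb : ∀ v ∈ Set.Icc (n : ℝ) (n + 1), ‖-s * (v : ℂ) ^ (-s - 1)‖ ≤
        ‖s‖ * (n : ℝ) ^ (-s.re - 1) := by
      intro v hv
      have hv0 : 0 < v := lt_of_lt_of_le hn0 hv.1
      rw [norm_mul, norm_neg, Complex.norm_cpow_eq_rpow_re_of_pos hv0]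
      simp only [Complex.sub_re, Complex.neg_re, Complex.one_re]
      gcongr ?_ * ?_
      exact Real.rpow_le_rpow_of_nonpos hn0 hv.1 (by linarith)
    have := hconv.norm_image_sub_le_of_norm_hasDerivWithin_le hder2 hb hmemn1 hu
    have e : (((n : ℝ) + 1 : ℝ) : ℂ) = (n : ℂ) + 1 := by push_cast; rfl
    rw [e, ← hc] at this
    refine this.trans ?_
    have : ‖u - ((n : ℝ) + 1)‖ ≤ 1 := by
      rw [Real.norm_eq_abs, abs_le]; constructor <;> linarith [hu.1, hu.2]
    exact mul_le_of_le_one_right (by positivity) this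
  have := hconv.norm_image_sub_le_of_norm_hasDerivWithin_le (fun u hu => hder u hu c) hbd
    hmemn hmemn1
  have e : zetaDiff s n = -(((((n : ℝ) + 1 : ℝ) : ℂ) ^ (1 - s) / (1 - s) -
      (((n : ℝ) + 1 : ℝ) : ℂ) * c) - (((n : ℝ) : ℂ) ^ (1 - s) / (1 - s) - ((n : ℝ) : ℂ) * c)) := by
    rw [zetaDiff, ← hc]
    push_cast
    ring
  rw [e, norm_neg]
  simpa using this

/-- The differences telescope, up to the partial sum of `∑ n^{-s}`. -/
lemma sum_zetaDiff (s : ℂ) (M N : ℕ) (h : M ≤ N) :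
    ∑ n ∈ Finset.Ico M N, zetaDiff s n =
      ∑ n ∈ Finset.Ico M N, ((n : ℂ) + 1) ^ (-s) -
        ((N : ℂ) ^ (1 - s) - (M : ℂ) ^ (1 - s)) / (1 - s) := by
  induction N, h using Nat.le_induction with
  | base => simp
  | succ N h ih =>
    rw [Finset.sum_Ico_succ_top h, Finset.sum_Ico_succ_top h, ih, zetaDiff]
    push_cast
    ring

lemma summable_zetaDiff {s : ℂ} (hs : 0 < s.re) (hs1 : s ≠ 1) :
    Summable (fun n : ℕ => zetaDiff s (n + 1)) := by
  have h : Summable (fun n : ℕ => ‖s‖ * ((n + 1 : ℕ) : ℝ) ^ (-s.re - 1)) :=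
    ((summable_nat_add_iff 1).2 (Real.summable_nat_rpow.2 (by linarith))).mul_left _
  exact h.of_norm_bounded (fun n => norm_zetaDiff_le hs hs1 (by omega))

lemma tsum_zetaDiff_of_one_lt {s : ℂ} (hs : 1 < s.re) :
    ∑' n : ℕ, zetaDiff s (n + 1) = riemannZeta s - 1 - 1 / (s - 1) := by
  have hs1 : s ≠ 1 := by rintro rfl; simp at hs
  have h1s : 1 - s ≠ 0 := sub_ne_zero.2 hs1.symm
  have hsum := summable_zetaDiff (by linarith) hs1
  refine tendsto_nhds_unique hsum.hasSum.tendsto_sum_nat ?_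
  have hz : HasSum (fun n : ℕ => 1 / ((n : ℂ) + 1) ^ s) (riemannZeta s) := by
    rw [zeta_eq_tsum_one_div_nat_add_one_cpow hs]
    refine Summable.hasSum ?_
    have := (summable_nat_add_iff 1).2 (Complex.summable_one_div_nat_cpow.2 hs)
    simpa using this
  have h1 := hz.tendsto_sum_nat.comp (Filter.tendsto_add_atTop_nat 1)
  have h2 : Filter.Tendsto (fun N : ℕ => ((N + 1 : ℕ) : ℂ) ^ (1 - s)) Filter.atTop (nhds 0) := by
    rw [tendsto_zero_iff_norm_tendsto_zero]
    have : Filter.Tendsto (fun N : ℕ => ((N + 1 : ℕ) : ℝ) ^ (-(s.re - 1))) Filter.atTop (nhds 0) :=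
      ((tendsto_rpow_neg_atTop (by linarith)).comp tendsto_natCast_atTop_atTop).comp
        (Filter.tendsto_add_atTop_nat 1)
    refine this.congr (fun N => ?_)
    rw [Complex.norm_natCast_cpow_of_pos (by omega)]
    simp
  have h3 := (h1.sub_const 1).sub ((h2.sub_const 1).div_const (1 - s))
  have e : riemannZeta s - 1 - 1 / (s - 1) = riemannZeta s - 1 - (0 - 1) / (1 - s) := by
    have : s - 1 ≠ 0 := sub_ne_zero.2 hs1
    field_simp
    ring
  rw [e]
  refine h3.congr (fun N => ?_)
  have := sum_zetaDiff s 1 (N + 1) (by omega)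
  rw [Finset.sum_Ico_eq_sum_range, Finset.sum_Ico_eq_sum_range] at this
  simp only [Nat.add_sub_cancel] at this
  simp only [add_comm 1] at this
  rw [this]
  simp only [Function.comp]
  rw [Finset.sum_range_succ']
  push_cast
  simp [Complex.cpow_neg]

lemma tsum_zetaDiff_of_im_pos {s : ℂ} (hs : 0 < s.re) (hi : 0 < s.im) :
    ∑' n : ℕ, zetaDiff s (n + 1) = riemannZeta s - 1 - 1 / (s - 1) := by
  set δ := min (s.re / 2) 1 with hδ
  have hδ0 : 0 < δ := lt_min (by linarith) one_pos
  have hδs : δ ≤ s.re / 2 := min_le_left _ _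
  have hδ1 : δ ≤ 1 := min_le_right _ _
  set R := ‖s‖ + 4 with hR
  set V : Set ℂ := {z | δ < z.re} ∩ ({z | 0 < z.im} ∩ Metric.ball 0 R) with hV
  have hVo : IsOpen V := (isOpen_lt continuous_const Complex.continuous_re).inter
    ((isOpen_lt continuous_const Complex.continuous_im).inter Metric.isOpen_ball)
  have hVc : Convex ℝ V := (convex_halfSpace_re_gt _).inter
    ((convex_halfSpace_im_gt _).inter (convex_ball _ _))
  have hV1 : ∀ z ∈ V, z ≠ 1 := by
    rintro z ⟨_, h, _⟩ rfl
    simp at h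
  have hsV : s ∈ V := ⟨show δ < s.re by linarith, hi, by simp [hR]⟩
  have hf : DifferentiableOn ℂ (fun z => ∑' n : ℕ, zetaDiff z (n + 1)) V := by
    have hsumm : Summable (fun n : ℕ => R * ((n + 1 : ℕ) : ℝ) ^ (-δ - 1)) :=
      ((summable_nat_add_iff 1).2 (Real.summable_nat_rpow.2 (by linarith))).mul_left _
    refine Complex.differentiableOn_tsum_of_summable_norm hsumm (fun n => ?_) hVo ?_
    · intro z hz
      have hz1 : 1 - z ≠ 0 := sub_ne_zero.2 (hV1 z hz).symm
      have h0 : ((n + 1 : ℕ) : ℂ) ≠ 0 := by exact_mod_cast Nat.succ_ne_zero n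
      have h1 : ((n + 1 : ℕ) : ℂ) + 1 ≠ 0 := by exact_mod_cast Nat.succ_ne_zero (n + 1)
      apply DifferentiableAt.differentiableWithinAt
      unfold zetaDiff
      have d1 : DifferentiableAt ℂ (fun z : ℂ => 1 - z) z := by fun_prop
      exact (differentiableAt_id.neg.const_cpow (Or.inl h1)).sub
        (((d1.const_cpow (Or.inl h1)).sub (d1.const_cpow (Or.inl h0))).div d1 hz1)
    · intro n z hz
      have hzr : δ < z.re := hz.1
      refine (norm_zetaDiff_le (by linarith) (hV1 z hz) (by omega)).trans ?_
      have hzn : ‖z‖ < R := by simpa using hz.2.2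
      gcongr
      exact_mod_cast Nat.succ_le_succ (Nat.zero_le n)
  have hg : DifferentiableOn ℂ (fun z => riemannZeta z - 1 - 1 / (z - 1)) V := by
    intro z hz
    have hz1 := hV1 z hz
    have : z - 1 ≠ 0 := sub_ne_zero.2 hz1
    apply DifferentiableAt.differentiableWithinAt
    have := differentiableAt_riemannZeta hz1
    fun_prop (disch := assumption)
  have hfa := hf.analyticOnNhd hVo
  have hga := hg.analyticOnNhd hVo
  set w : ℂ := 2 + (min s.im 1 : ℝ) * Complex.I with hw
  have hwi : 0 < min s.im 1 := lt_min hi one_pos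
  have hre : w.re = 2 := by simp [hw]
  have him : w.im = min s.im 1 := by simp [hw]
  have hwV : w ∈ V := by
    refine ⟨show δ < w.re by rw [hre]; linarith, show 0 < w.im by rw [him]; exact hwi, ?_⟩
    rw [mem_ball_zero_iff]
    have := Complex.norm_le_abs_re_add_abs_im w
    rw [hre, him, abs_of_pos hwi, abs_of_pos two_pos] at this
    have := min_le_right s.im 1
    have := norm_nonneg s
    linarith
  refine hfa.eqOn_of_preconnected_of_eventuallyEq hga hVc.isPreconnected hwV ?_ hsV
  filter_upwards [(isOpen_lt continuous_const Complex.continuous_re).mem_nhds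
    (show (1 : ℝ) < w.re by rw [hre]; norm_num)] with z hz
  exact tsum_zetaDiff_of_one_lt hz

/-- Euler–Maclaurin summation from `N` on. The upper half plane suffices, as `ζ` commutes with complex
conjugation. -/
lemma riemannZeta_eq_sum_add_tsum {s : ℂ} (hs : 0 < s.re) (hi : 0 < s.im) {N : ℕ} (hN : 1 ≤ N) :
    riemannZeta s = ∑ n ∈ Finset.range N, ((n + 1 : ℕ) : ℂ) ^ (-s) + (N : ℂ) ^ (1 - s) / (s - 1)
      + ∑' n : ℕ, zetaDiff s (n + N) := by
  have hs1 : s ≠ 1 := by rintro rfl; simp at hi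
  have h1s : 1 - s ≠ 0 := sub_ne_zero.2 hs1.symm
  have h1s' : s - 1 ≠ 0 := sub_ne_zero.2 hs1
  obtain ⟨M, rfl⟩ := Nat.exists_eq_add_of_le' hN
  have h1 := tsum_zetaDiff_of_im_pos hs hi
  rw [← (summable_zetaDiff hs hs1).sum_add_tsum_nat_add M] at h1
  have h2 := sum_zetaDiff s 1 (M + 1) (by omega)
  rw [Finset.sum_Ico_eq_sum_range, Finset.sum_Ico_eq_sum_range] at h2
  simp only [Nat.add_sub_cancel] at h2
  simp only [add_comm 1] at h2
  rw [h2] at h1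
  rw [Finset.sum_range_succ']
  have e : ∀ n, zetaDiff s (n + M + 1) = zetaDiff s (n + (M + 1)) := fun n => by rw [add_assoc]
  simp only [e] at h1
  have h3 : riemannZeta s = 1 + 1 / (s - 1) + (∑ x ∈ Finset.range M, (((x + 1 : ℕ) : ℂ) + 1) ^ (-s) -
      (((M + 1 : ℕ) : ℂ) ^ (1 - s) - ((1 : ℕ) : ℂ) ^ (1 - s)) / (1 - s) +
      ∑' (i : ℕ), zetaDiff s (i + (M + 1))) := by rw [h1]; ring
  rw [h3]
  push_cast
  simp only [Complex.one_cpow]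
  field_simp
  ring

/-! ### Growth of the zeta function near the line `Re s = 1` -/

/-- Subpolynomial growth of `ζ` just to the left of the line `Re s = 1`. -/
lemma exists_norm_riemannZeta_le {ε : ℝ} (hε : 0 < ε) (hε' : ε ≤ 1 / 4) :
    ∃ C : ℝ, 0 < C ∧ ∀ s : ℂ, 1 - ε ≤ s.re → s.re ≤ 3 → 1 ≤ |s.im| →
      ‖riemannZeta s‖ ≤ C * |s.im| ^ (4 * ε) := by
  set S₁ := ∑' n : ℕ, ((n + 1 : ℕ) : ℝ) ^ (-1 - ε) with hS₁
  set S₂ := ∑' n : ℕ, ((n + 1 : ℕ) : ℝ) ^ (-3 / 2 + ε) with hS₂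
  have hsum₁ : Summable (fun n : ℕ => ((n + 1 : ℕ) : ℝ) ^ (-1 - ε)) :=
    (summable_nat_add_iff 1).2 (Real.summable_nat_rpow.2 (by linarith))
  have hsum₂ : Summable (fun n : ℕ => ((n + 1 : ℕ) : ℝ) ^ (-3 / 2 + ε)) :=
    (summable_nat_add_iff 1).2 (Real.summable_nat_rpow.2 (by linarith))
  have hS₁0 : 0 ≤ S₁ := tsum_nonneg fun n => by positivity
  have hS₂0 : 0 ≤ S₂ := tsum_nonneg fun n => by positivity
  suffices H : ∀ s : ℂ, 1 - ε ≤ s.re → s.re ≤ 3 → 1 ≤ s.im →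
      ‖riemannZeta s‖ ≤ (4 * S₁ + 4 + 4 * S₂) * |s.im| ^ (4 * ε) by
    refine ⟨4 * S₁ + 4 + 4 * S₂, by positivity, fun s h1 h2 h3 => ?_⟩
    rcases le_abs.1 h3 with h | h
    · exact H s h1 h2 h
    · have := H (starRingEnd ℂ s) (by simpa using h1) (by simpa using h2) (by simpa using h)
      rw [riemannZeta_conj, RCLike.norm_conj] at this
      simpa using this
  intro s hre hre3 him
  set t := s.im with ht
  have ht0 : 0 < t := by linarith
  -- the sum is cut at `N = m ^ 2`, of size `t ^ 2`, so that the factor `‖s‖` in the tail is absorbed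
  set m := ⌈t⌉₊ with hm
  have htm : t ≤ m := Nat.le_ceil t
  have hm2 : (m : ℝ) ≤ 2 * t := by
    have := Nat.ceil_lt_add_one ht0.le
    linarith
  have hm1 : 1 ≤ m := Nat.one_le_ceil_iff.2 ht0
  have hm0 : (0 : ℝ) < m := by exact_mod_cast hm1
  have hN1 : 1 ≤ m ^ 2 := Nat.one_le_pow _ _ hm1
  have hNr : ((m ^ 2 : ℕ) : ℝ) = (m : ℝ) ^ (2 : ℝ) := by norm_num
  have hNr1 : (1 : ℝ) ≤ ((m ^ 2 : ℕ) : ℝ) := by exact_mod_cast hN1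
  have hNb : ((m ^ 2 : ℕ) : ℝ) ^ (2 * ε) ≤ 4 * t ^ (4 * ε) := by
    rw [hNr, ← Real.rpow_mul hm0.le]
    calc (m : ℝ) ^ (2 * (2 * ε)) ≤ (2 * t) ^ (2 * (2 * ε)) := by gcongr
      _ = 2 ^ (4 * ε) * t ^ (4 * ε) := by
        rw [Real.mul_rpow (by norm_num) ht0.le, show 2 * (2 * ε) = 4 * ε by ring]
      _ ≤ 4 * t ^ (4 * ε) := by
        gcongr
        calc (2 : ℝ) ^ (4 * ε) ≤ 2 ^ (1 : ℝ) := by gcongr <;> linarith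
          _ ≤ 4 := by norm_num
  have ht4 : 1 ≤ t ^ (4 * ε) := Real.one_le_rpow him (by linarith)
  have hs0 : 0 < s.re := by linarith
  have hs1 : s ≠ 1 := by rintro rfl; simp at ht; linarith
  rw [riemannZeta_eq_sum_add_tsum hs0 ht0 hN1]
  have b1 : ‖∑ n ∈ Finset.range (m ^ 2), ((n + 1 : ℕ) : ℂ) ^ (-s)‖ ≤ S₁ * (4 * t ^ (4 * ε)) := by
    refine (norm_sum_le _ _).trans ?_
    have : ∀ n ∈ Finset.range (m ^ 2), ‖((n + 1 : ℕ) : ℂ) ^ (-s)‖ ≤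
        ((n + 1 : ℕ) : ℝ) ^ (-1 - ε) * (4 * t ^ (4 * ε)) := by
      intro n hn
      rw [Complex.norm_natCast_cpow_of_pos (by omega), Complex.neg_re]
      have hn1 : (1 : ℝ) ≤ ((n + 1 : ℕ) : ℝ) := by exact_mod_cast Nat.succ_le_succ (Nat.zero_le n)
      have hnN : ((n + 1 : ℕ) : ℝ) ≤ ((m ^ 2 : ℕ) : ℝ) := by
        exact_mod_cast Nat.succ_le_of_lt (Finset.mem_range.1 hn)
      calc ((n + 1 : ℕ) : ℝ) ^ (-s.re) ≤ ((n + 1 : ℕ) : ℝ) ^ ((-1 - ε) + 2 * ε) :=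
            Real.rpow_le_rpow_of_exponent_le hn1 (by linarith)
        _ = ((n + 1 : ℕ) : ℝ) ^ (-1 - ε) * ((n + 1 : ℕ) : ℝ) ^ (2 * ε) :=
            Real.rpow_add (by linarith) _ _
        _ ≤ ((n + 1 : ℕ) : ℝ) ^ (-1 - ε) * ((m ^ 2 : ℕ) : ℝ) ^ (2 * ε) := by gcongr
        _ ≤ _ := by gcongr
    refine (Finset.sum_le_sum this).trans ?_
    rw [← Finset.sum_mul]
    gcongr
    exact hsum₁.sum_le_tsum _ (fun n _ => by positivity)
  have b2 : ‖((m ^ 2 : ℕ) : ℂ) ^ (1 - s) / (s - 1)‖ ≤ 4 * t ^ (4 * ε) := by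
    rw [norm_div, Complex.norm_natCast_cpow_of_pos hN1]
    have h1 : 1 ≤ ‖s - 1‖ := by
      have := Complex.abs_im_le_norm (s - 1)
      simp only [Complex.sub_im, Complex.one_im, sub_zero] at this
      exact him.trans ((le_abs_self _).trans this)
    refine (div_le_self (by positivity) h1).trans (le_trans ?_ hNb)
    apply Real.rpow_le_rpow_of_exponent_le hNr1
    simp; linarith
  have b3 : ‖∑' n : ℕ, zetaDiff s (n + m ^ 2)‖ ≤ 4 * S₂ := by
    have hk : ∀ n : ℕ, ‖zetaDiff s (n + m ^ 2)‖ ≤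
        4 * ((n + 1 : ℕ) : ℝ) ^ (-3 / 2 + ε) := by
      intro n
      refine (norm_zetaDiff_le hs0 hs1 (by omega)).trans ?_
      have hs4 : ‖s‖ ≤ 4 * m := by
        have := Complex.norm_le_abs_re_add_abs_im s
        rw [abs_of_pos hs0, ← ht, abs_of_pos ht0] at this
        have : (1 : ℝ) ≤ m := by exact_mod_cast hm1
        linarith
      have hb1 : (1 : ℝ) ≤ ((n + m ^ 2 : ℕ) : ℝ) := by exact_mod_cast (by omega)
      have hb2 : ((m ^ 2 : ℕ) : ℝ) ≤ ((n + m ^ 2 : ℕ) : ℝ) := by exact_mod_cast (by omega)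
      have hb3 : ((n + 1 : ℕ) : ℝ) ≤ ((n + m ^ 2 : ℕ) : ℝ) := by exact_mod_cast (by omega)
      have hb4 : (m : ℝ) * ((n + m ^ 2 : ℕ) : ℝ) ^ (-(1 / 2) : ℝ) ≤ 1 := by
        calc (m : ℝ) * ((n + m ^ 2 : ℕ) : ℝ) ^ (-(1 / 2) : ℝ)
            ≤ m * ((m ^ 2 : ℕ) : ℝ) ^ (-(1 / 2) : ℝ) := by
              gcongr ?_ * ?_
              exact Real.rpow_le_rpow_of_nonpos (by linarith) hb2 (by norm_num)
          _ = 1 := by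
              rw [hNr, ← Real.rpow_mul hm0.le]
              norm_num [Real.rpow_neg_one]
              exact mul_inv_cancel₀ hm0.ne'
      calc ‖s‖ * ((n + m ^ 2 : ℕ) : ℝ) ^ (-s.re - 1)
          ≤ (4 * m) * ((n + m ^ 2 : ℕ) : ℝ) ^ (-(1 / 2) + (-3 / 2 + ε)) := by
            gcongr ?_ * ?_
            exact Real.rpow_le_rpow_of_exponent_le hb1 (by linarith)
        _ = 4 * ((m * ((n + m ^ 2 : ℕ) : ℝ) ^ (-(1 / 2) : ℝ)) *
            ((n + m ^ 2 : ℕ) : ℝ) ^ (-3 / 2 + ε)) := by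
            rw [Real.rpow_add (by linarith)]; ring
        _ ≤ 4 * (1 * ((n + 1 : ℕ) : ℝ) ^ (-3 / 2 + ε)) := by
            gcongr 4 * (?_ * ?_)
            exact Real.rpow_le_rpow_of_nonpos (by positivity) hb3 (by linarith)
        _ = _ := by ring
    exact tsum_of_norm_bounded (hsum₂.hasSum.mul_left 4) hk
  rw [abs_of_pos ht0]
  have h4 : 4 * S₂ ≤ 4 * S₂ * t ^ (4 * ε) := le_mul_of_one_le_right (by positivity) ht4
  calc _ ≤ S₁ * (4 * t ^ (4 * ε)) + 4 * t ^ (4 * ε) + 4 * S₂ :=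
        (norm_add₃_le).trans (add_le_add (add_le_add b1 b2) b3)
    _ ≤ _ := by nlinarith

/-- Cauchy's estimate on discs of radius `ε / 2`. -/
lemma exists_norm_deriv_riemannZeta_le {ε : ℝ} (hε : 0 < ε) (hε' : ε ≤ 1 / 4) :
    ∃ C : ℝ, 0 < C ∧ ∀ s : ℂ, 1 - ε / 2 ≤ s.re → s.re ≤ 5 / 2 → 2 ≤ |s.im| →
      ‖deriv riemannZeta s‖ ≤ C * |s.im| ^ (4 * ε) := by
  obtain ⟨C, hC, h⟩ := exists_norm_riemannZeta_le hε hε'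
  refine ⟨C * 2 / (ε / 2), by positivity, fun s h1 h2 h3 => ?_⟩
  have key : ∀ z ∈ Metric.closedBall s (ε / 2), 1 - ε ≤ z.re ∧ z.re ≤ 3 ∧ 1 ≤ |z.im| ∧
      |z.im| ≤ 2 * |s.im| := by
    intro z hz
    rw [Metric.mem_closedBall, dist_eq_norm] at hz
    have hr := (Complex.abs_re_le_norm (z - s)).trans hz
    have hi := (Complex.abs_im_le_norm (z - s)).trans hz
    rw [Complex.sub_re, abs_le] at hr
    rw [Complex.sub_im] at hi
    have e1 := abs_sub_abs_le_abs_sub z.im s.im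
    have e2 := abs_sub_abs_le_abs_sub s.im z.im
    rw [abs_sub_comm] at e2
    refine ⟨by linarith, by linarith, by linarith, by linarith⟩
  have hd : DiffContOnCl ℂ riemannZeta (Metric.ball s (ε / 2)) := by
    refine DifferentiableOn.diffContOnCl_ball (U := {z | z ≠ 1}) (fun z hz => ?_) (fun z hz => ?_)
    · exact (differentiableAt_riemannZeta hz).differentiableWithinAt
    · rintro rfl
      have := (key _ hz).2.2.1
      norm_num at this
  have := Complex.norm_deriv_le_of_forall_mem_sphere_norm_le (C := C * 2 * |s.im| ^ (4 * ε))
    (half_pos hε) hd ?_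
  · refine this.trans (le_of_eq ?_)
    ring
  · intro z hz
    obtain ⟨k1, k2, k3, k4⟩ := key z (Metric.sphere_subset_closedBall hz)
    refine (h z k1 k2 k3).trans ?_
    calc C * |z.im| ^ (4 * ε) ≤ C * (2 * |s.im|) ^ (4 * ε) := by gcongr
      _ = C * (2 ^ (4 * ε) * |s.im| ^ (4 * ε)) := by
        rw [Real.mul_rpow (by norm_num) (abs_nonneg _)]
      _ ≤ C * (2 * |s.im| ^ (4 * ε)) := by
        gcongr
        calc (2 : ℝ) ^ (4 * ε) ≤ 2 ^ (1 : ℝ) := by gcongr <;> linarith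
          _ = 2 := by norm_num
      _ = _ := by ring

/-! ### Zero-free region and the logarithmic derivative -/

/-- Lower bound for `ζ` to the right of the line `Re s = 1`, from the `3-4-1` inequality. -/
lemma exists_le_norm_riemannZeta_right {ε : ℝ} (hε : 0 < ε) (hε' : ε ≤ 1 / 4) :
    ∃ c : ℝ, 0 < c ∧ ∀ x t : ℝ, 0 < x → x ≤ 3 / 2 → 2 ≤ |t| →
      c * x ^ (3 / 4 : ℝ) * |t| ^ (-ε) ≤ ‖riemannZeta (1 + x + Complex.I * t)‖ := by
  obtain ⟨C, hC, h⟩ := exists_norm_riemannZeta_le hε hε'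
  obtain ⟨K, hK⟩ := (isCompact_Icc (a := (0 : ℝ)) (b := 3 / 2)).exists_bound_of_continuousOn
    (f := fun x : ℝ => riemannZeta₁ (1 + x))
    (differentiable_riemannZeta₁.continuous.comp (by fun_prop)).continuousOn
  have hK1 : 1 ≤ K := by
    have := hK 0 (by norm_num)
    simpa using this
  set c : ℝ := (1 / (K ^ 3 * (2 * C))) ^ (1 / 4 : ℝ) with hc
  have hc0 : 0 < c := by positivity
  have hc4 : c ^ (4 : ℕ) = 1 / (K ^ 3 * (2 * C)) := by
    rw [hc, ← Real.rpow_natCast, ← Real.rpow_mul (by positivity)]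
    norm_num
  refine ⟨c, hc0, fun x t hx hx' ht => ?_⟩
  have ht0 : 0 < |t| := by linarith
  have h341 : 1 ≤ ‖riemannZeta (1 + x) ^ 3 * riemannZeta (1 + x + Complex.I * t) ^ 4 *
      riemannZeta (1 + x + 2 * Complex.I * t)‖ := by
    have := DirichletCharacter.norm_LFunction_product_ge_one (N := 1) 1 hx t
    simpa [DirichletCharacter.LFunction_modOne_eq, DirichletCharacter.LFunctionTrivChar] using this
  rw [norm_mul, norm_mul, norm_pow, norm_pow] at h341
  have b1 : ‖riemannZeta (1 + x)‖ ≤ K / x := by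
    have hne : (1 + x : ℂ) ≠ 1 := by simpa using hx.ne'
    rw [riemannZeta_eq_inv_sub_mul hne, norm_mul, norm_inv]
    have e : ‖(1 + x - 1 : ℂ)‖ = x := by simp [abs_of_pos hx]
    rw [e, div_eq_inv_mul]
    gcongr
    exact hK x ⟨hx.le, hx'⟩
  have b2 : ‖riemannZeta (1 + x + 2 * Complex.I * t)‖ ≤ 2 * C * |t| ^ (4 * ε) := by
    have e : (1 + x + 2 * Complex.I * t : ℂ).im = 2 * t := by simp
    have e' : (1 + x + 2 * Complex.I * t : ℂ).re = 1 + x := by simp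
    refine (h _ (by rw [e']; linarith) (by rw [e']; linarith) ?_).trans ?_
    · rw [e, abs_mul, abs_two]; linarith
    · rw [e, abs_mul, abs_two, Real.mul_rpow (by norm_num) ht0.le]
      have : (2 : ℝ) ^ (4 * ε) ≤ 2 :=
        calc (2 : ℝ) ^ (4 * ε) ≤ 2 ^ (1 : ℝ) := by gcongr <;> linarith
          _ = 2 := by norm_num
      calc C * (2 ^ (4 * ε) * |t| ^ (4 * ε)) ≤ C * (2 * |t| ^ (4 * ε)) := by gcongr
        _ = _ := by ring
  set Z := ‖riemannZeta (1 + x + Complex.I * t)‖ with hZ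
  have h1 : 1 ≤ (K / x) ^ 3 * Z ^ 4 * (2 * C * |t| ^ (4 * ε)) := by
    refine h341.trans ?_
    gcongr
  refine le_of_pow_le_pow_left₀ (n := 4) (by norm_num) (norm_nonneg _) ?_
  have e1 : (x ^ (3 / 4 : ℝ)) ^ 4 = x ^ 3 := by
    rw [← Real.rpow_natCast, ← Real.rpow_mul hx.le, ← Real.rpow_natCast]; norm_num
  have e2 : (|t| ^ (-ε)) ^ 4 = (|t| ^ (4 * ε))⁻¹ := by
    rw [← Real.rpow_natCast, ← Real.rpow_mul ht0.le, ← Real.rpow_neg ht0.le]; congr 1; push_cast; ring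
  rw [mul_pow, mul_pow, hc4, e1, e2]
  have hT : 0 < |t| ^ (4 * ε) := by positivity
  have hKp : 0 < K := by linarith
  rw [div_pow] at h1
  have h2 : x ^ 3 ≤ K ^ 3 * Z ^ 4 * (2 * C * |t| ^ (4 * ε)) := by
    have : (K ^ 3 / x ^ 3) * Z ^ 4 * (2 * C * |t| ^ (4 * ε)) =
      (K ^ 3 * Z ^ 4 * (2 * C * |t| ^ (4 * ε))) / x ^ 3 := by ring
    rw [this, le_div_iff₀ (by positivity), one_mul] at h1
    exact h1
  calc 1 / (K ^ 3 * (2 * C)) * x ^ 3 * (|t| ^ (4 * ε))⁻¹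
      = x ^ 3 / (K ^ 3 * (2 * C) * |t| ^ (4 * ε)) := by field_simp
    _ ≤ Z ^ 4 := by
      rw [div_le_iff₀ (by positivity)]
      linarith

/-- A zero-free region of width `|t|^{-20ε}`, with a lower bound for `ζ` there. Within distance `2r`
of the line `Re s = 1 + r` the bound for `ζ'` cannot undo the lower bound `r^{3/4} |t|^{-ε}` on that
line when `r` is a small multiple of `|t|^{-20ε}`. -/
lemma exists_le_norm_riemannZeta {ε : ℝ} (hε : 0 < ε) (hε' : ε ≤ 1 / 4) :
    ∃ η c : ℝ, 0 < η ∧ η ≤ 1 / 4 ∧ 0 < c ∧ ∀ s : ℂ, 1 - η * |s.im| ^ (-20 * ε) ≤ s.re →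
      s.re ≤ 5 / 2 → 2 ≤ |s.im| → c * |s.im| ^ (-16 * ε) ≤ ‖riemannZeta s‖ := by
  obtain ⟨C, hC, hd⟩ := exists_norm_deriv_riemannZeta_le hε hε'
  obtain ⟨c, hc, hl⟩ := exists_le_norm_riemannZeta_right hε hε'
  set η := min (ε / 2) ((c / (3 * C)) ^ 4) with hη
  have hη0 : 0 < η := lt_min (by positivity) (by positivity)
  have hηε : η ≤ ε / 2 := min_le_left _ _
  have hηc : η ≤ (c / (3 * C)) ^ 4 := min_le_right _ _
  refine ⟨η, C * η, hη0, by linarith, by positivity, fun s h1 h2 h3 => ?_⟩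
  set t := s.im with ht
  have ht0 : 0 < |t| := by linarith
  set r := η * |t| ^ (-20 * ε) with hr
  have hr0 : 0 < r := by positivity
  have hrη : r ≤ η := mul_le_of_le_one_right hη0.le
    (Real.rpow_le_one_of_one_le_of_nonpos (by linarith) (by linarith))
  have hkey : 3 * (r * C * |t| ^ (4 * ε)) ≤ c * r ^ (3 / 4 : ℝ) * |t| ^ (-ε) := by
    have e1 : r = r ^ (3 / 4 : ℝ) * r ^ (1 / 4 : ℝ) := by
      rw [← Real.rpow_add hr0]; norm_num
    have e2 : r ^ (1 / 4 : ℝ) ≤ c / (3 * C) * |t| ^ (-5 * ε) := by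
      rw [hr, Real.mul_rpow hη0.le (by positivity), ← Real.rpow_mul ht0.le,
        show -20 * ε * (1 / 4) = -5 * ε by ring]
      gcongr
      calc η ^ (1 / 4 : ℝ) ≤ ((c / (3 * C)) ^ 4) ^ (1 / 4 : ℝ) := by gcongr
        _ = c / (3 * C) := by
          rw [← Real.rpow_natCast, ← Real.rpow_mul (by positivity)]; norm_num
    have e3 : |t| ^ (-5 * ε) * |t| ^ (4 * ε) = |t| ^ (-ε) := by
      rw [← Real.rpow_add ht0]; congr 1; ring
    calc 3 * (r * C * |t| ^ (4 * ε))
        = 3 * C * r ^ (3 / 4 : ℝ) * |t| ^ (4 * ε) * r ^ (1 / 4 : ℝ) := by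
          nth_rw 1 [e1]; ring
      _ ≤ 3 * C * r ^ (3 / 4 : ℝ) * |t| ^ (4 * ε) * (c / (3 * C) * |t| ^ (-5 * ε)) := by gcongr
      _ = c * r ^ (3 / 4 : ℝ) * (|t| ^ (-5 * ε) * |t| ^ (4 * ε)) := by field_simp
      _ = _ := by rw [e3]
  have hgoal : C * η * |t| ^ (-16 * ε) = r * C * |t| ^ (4 * ε) := by
    have e3 : |t| ^ (-20 * ε) * |t| ^ (4 * ε) = |t| ^ (-16 * ε) := by
      rw [← Real.rpow_add ht0]; congr 1; ring
    rw [hr, ← e3]; ring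
  rw [hgoal]
  have hrC : 0 < r * C * |t| ^ (4 * ε) := by positivity
  have hs : s = 1 + ((s.re - 1 : ℝ) : ℂ) + Complex.I * t := by
    apply Complex.ext <;> simp [ht]
  rcases le_total s.re (1 + r) with hle | hge
  · -- compare with the point on the same horizontal line at distance `r` right of `Re s = 1`
    set w : ℂ := 1 + (r : ℂ) + Complex.I * t with hw
    have hw1 : w.re = 1 + r := by simp [hw]
    have hw2 : w.im = t := by simp [hw]
    have hlw := hl r t hr0 (by linarith) h3
    rw [← hw] at hlw
    have hconv : Convex ℝ {z : ℂ | 1 - ε / 2 ≤ z.re ∧ z.re ≤ 5 / 2 ∧ z.im = t} := by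
      have : {z : ℂ | 1 - ε / 2 ≤ z.re ∧ z.re ≤ 5 / 2 ∧ z.im = t} =
          {z : ℂ | 1 - ε / 2 ≤ z.re} ∩ ({z | z.re ≤ 5 / 2} ∩ ({z | t ≤ z.im} ∩ {z | z.im ≤ t})) := by
        ext z
        simp only [Set.mem_ofPred_eq, Set.mem_inter_iff]
        rw [and_comm (a := t ≤ z.im), ← le_antisymm_iff]
      rw [this]
      exact (convex_halfSpace_re_ge _).inter ((convex_halfSpace_re_le _).inter
        ((convex_halfSpace_im_ge _).inter (convex_halfSpace_im_le _)))
    have hmv := hconv.norm_image_sub_le_of_norm_deriv_le (f := riemannZeta) (x := s) (y := w)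
      (C := C * |t| ^ (4 * ε)) (fun z hz => differentiableAt_riemannZeta ?_)
      (fun z hz => ?_) ⟨by linarith, by linarith, rfl⟩ ⟨by linarith, by linarith, hw2⟩
    · have hd2 : ‖w - s‖ ≤ 2 * r := by
        have e : w - s = ((1 + r - s.re : ℝ) : ℂ) := by
          apply Complex.ext
          · simp [hw]
          · simp [hw, ht]
        rw [e, Complex.norm_real, Real.norm_eq_abs, abs_of_nonneg (by linarith)]
        linarith
      have h5 : ‖riemannZeta w‖ ≤ ‖riemannZeta w - riemannZeta s‖ + ‖riemannZeta s‖ := by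
        simpa using norm_add_le (riemannZeta w - riemannZeta s) (riemannZeta s)
      have h6 : C * |t| ^ (4 * ε) * ‖w - s‖ ≤ C * |t| ^ (4 * ε) * (2 * r) := by gcongr
      linarith
    · rintro rfl
      have := hz.2.2
      simp at this
      rw [← this] at h3
      norm_num at h3
    · have := hd z hz.1 hz.2.1 (by rw [hz.2.2]; exact h3)
      rwa [hz.2.2] at this
  · have hl' := hl (s.re - 1) t (by linarith) (by linarith) h3
    rw [← hs] at hl'
    refine le_trans ?_ hl'
    have : r ^ (3 / 4 : ℝ) ≤ (s.re - 1) ^ (3 / 4 : ℝ) := by gcongr; linarith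
    calc r * C * |t| ^ (4 * ε) ≤ c * r ^ (3 / 4 : ℝ) * |t| ^ (-ε) := by linarith
      _ ≤ _ := by gcongr

/-- The continuation of `∑ (Λ(n) - 1) n^{-s} = -ζ'(s)/ζ(s) - ζ(s)` across the line `Re s = 1`. It is
written with `riemannZeta₁ = (s - 1) ζ` and `riemannZeta₀ = ζ - 1 / (s - 1)`, so that the poles
at `s = 1` cancel. -/
noncomputable def vonMangoldtSubOneL (s : ℂ) : ℂ :=
  -(deriv riemannZeta₁ s / riemannZeta₁ s) - riemannZeta₀ s

lemma riemannZeta₁_ne_zero {s : ℂ} (hs : s = 1 ∨ riemannZeta s ≠ 0) : riemannZeta₁ s ≠ 0 := by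
  by_cases h : s = 1
  · simp [h]
  · have h2 := hs.resolve_left h
    rw [riemannZeta_eq_inv_sub_mul h] at h2
    exact right_ne_zero_of_mul h2

lemma vonMangoldtSubOneL_eq {s : ℂ} (hs : s ≠ 1) (h0 : riemannZeta s ≠ 0) :
    vonMangoldtSubOneL s = -(deriv riemannZeta s / riemannZeta s) - riemannZeta s := by
  have h1 := riemannZeta₁_ne_zero (Or.inr h0)
  have h2 : s - 1 ≠ 0 := sub_ne_zero.2 hs
  rw [deriv_riemannZeta_eq_neg_inv_sub_sq_mul_add hs, vonMangoldtSubOneL]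
  have e : riemannZeta₀ s = riemannZeta s - (s - 1)⁻¹ := by
    rw [riemannZeta_eq_inv_sub_add hs]; ring
  rw [e]
  have e2 : riemannZeta s = (s - 1)⁻¹ * riemannZeta₁ s := riemannZeta_eq_inv_sub_mul hs
  rw [e2]
  field_simp
  ring

lemma analyticAt_vonMangoldtSubOneL {s : ℂ} (hs : s = 1 ∨ riemannZeta s ≠ 0) :
    AnalyticAt ℂ vonMangoldtSubOneL s := by
  have h1 := riemannZeta₁_ne_zero hs
  have a1 : AnalyticAt ℂ riemannZeta₁ s := differentiable_riemannZeta₁.analyticAt s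
  have a0 : AnalyticAt ℂ riemannZeta₀ s := differentiable_riemannZeta₀.analyticAt s
  exact ((a1.deriv.div a1 h1).neg).sub a0

/-- All derivatives of `-ζ'/ζ - ζ` grow slowly on vertical lines up to `Re s = 1`. -/
lemma exists_norm_iteratedDeriv_vonMangoldtSubOneL_le (k : ℕ) :
    ∃ C : ℝ, 0 < C ∧ ∀ s : ℂ, 1 ≤ s.re → s.re ≤ 2 →
      ‖iteratedDeriv k vonMangoldtSubOneL s‖ ≤ C * (1 + |s.im|) ^ (1 / 2 : ℝ) := by
  obtain ⟨C₁, hC₁⟩ : ∃ C : ℝ, ∀ s : ℂ, 1 ≤ s.re → s.re ≤ 2 → |s.im| ≤ 3 →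
      ‖iteratedDeriv k vonMangoldtSubOneL s‖ ≤ C := by
    have hcpt : IsCompact (Set.Icc (1 : ℝ) 2 ×ℂ Set.Icc (-3 : ℝ) 3) :=
      isCompact_Icc.reProdIm isCompact_Icc
    obtain ⟨C, hC⟩ := hcpt.exists_bound_of_continuousOn (f := iteratedDeriv k vonMangoldtSubOneL)
      (fun s hs => by
        have hs1 : 1 ≤ s.re := hs.1.1
        have := (analyticAt_vonMangoldtSubOneL (s := s)
          (Or.inr (riemannZeta_ne_zero_of_one_le_re hs1))).iterated_deriv k
        rw [← iteratedDeriv_eq_iterate] at this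
        exact this.continuousAt.continuousWithinAt)
    exact ⟨C, fun s h1 h2 h3 => hC s ⟨⟨h1, h2⟩, abs_le.1 h3⟩⟩
  -- Cauchy's estimate on discs of radius about `|t|^{-20ε}` costs `|t|^{20εk}`, and with the bound
  -- `|t|^{20ε}` for the function itself the exponent is `20ε(k + 1) = 1 / 2`
  set ε : ℝ := 1 / (40 * (k + 1)) with hε
  have hk1 : (0 : ℝ) < k + 1 := by positivity
  have hε0 : 0 < ε := by positivity
  have hε1 : ε ≤ 1 / 4 := by
    rw [hε]
    apply one_div_le_one_div_of_le (by norm_num)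
    have : (0 : ℝ) ≤ k := by positivity
    linarith
  obtain ⟨A, hA, hz⟩ := exists_norm_riemannZeta_le hε0 hε1
  obtain ⟨B, hB, hz'⟩ := exists_norm_deriv_riemannZeta_le hε0 hε1
  obtain ⟨η, c, hη, hη4, hc, hl⟩ := exists_le_norm_riemannZeta hε0 hε1
  set η' := min η (ε / 2) with hη'
  have hη'0 : 0 < η' := lt_min hη (by positivity)
  have hη'η : η' ≤ η := min_le_left _ _
  have hη'ε : η' ≤ ε / 2 := min_le_right _ _
  have hbd : ∀ s : ℂ, 1 - η' * |s.im| ^ (-20 * ε) ≤ s.re → s.re ≤ 5 / 2 → 2 ≤ |s.im| →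
      riemannZeta s ≠ 0 ∧ ‖vonMangoldtSubOneL s‖ ≤ (B / c + A) * |s.im| ^ (20 * ε) := by
    intro s h1 h2 h3
    have ht0 : 0 < |s.im| := by linarith
    have hp1 : |s.im| ^ (-20 * ε) ≤ 1 :=
      Real.rpow_le_one_of_one_le_of_nonpos (by linarith) (by linarith)
    have hre : 1 - ε / 2 ≤ s.re := by nlinarith
    have hlow := hl s (by
      have : η' * |s.im| ^ (-20 * ε) ≤ η * |s.im| ^ (-20 * ε) := by gcongr
      linarith) h2 h3
    have hne : riemannZeta s ≠ 0 := by
      rw [← norm_pos_iff]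
      exact lt_of_lt_of_le (by positivity) hlow
    have hs1 : s ≠ 1 := by
      rintro rfl
      norm_num at h3
    refine ⟨hne, ?_⟩
    rw [vonMangoldtSubOneL_eq hs1 hne]
    refine (norm_sub_le _ _).trans ?_
    rw [norm_neg, norm_div, add_mul]
    gcongr ?_ + ?_
    · calc ‖deriv riemannZeta s‖ / ‖riemannZeta s‖
          ≤ (B * |s.im| ^ (4 * ε)) / (c * |s.im| ^ (-16 * ε)) := by
            gcongr
            exact hz' s hre h2 h3
        _ = B / c * |s.im| ^ (20 * ε) := by
            rw [show 20 * ε = 4 * ε - (-16 * ε) by ring, Real.rpow_sub ht0]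
            field_simp
    · refine (hz s (by linarith) (by linarith) (by linarith)).trans ?_
      gcongr
      · linarith
      · linarith
  set C₂ : ℝ := k.factorial * (B / c + A) / η' ^ k * 2 with hC₂
  have hC₂0 : 0 < C₂ := by positivity
  refine ⟨|C₁| + C₂, by positivity, fun s h1 h2 => ?_⟩
  have hone : (1 : ℝ) ≤ (1 + |s.im|) ^ (1 / 2 : ℝ) :=
    Real.one_le_rpow (by linarith [abs_nonneg s.im]) (by norm_num)
  rcases le_or_gt |s.im| 3 with h3 | h3
  · calc ‖iteratedDeriv k vonMangoldtSubOneL s‖ ≤ |C₁| := (hC₁ s h1 h2 h3).trans (le_abs_self _)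
      _ ≤ (|C₁| + C₂) * 1 := by linarith
      _ ≤ _ := by gcongr
  · have ht0 : 0 < |s.im| := by linarith
    set R : ℝ := η' * (2 * |s.im|) ^ (-20 * ε) with hR
    have hR0 : 0 < R := by positivity
    have hRη : R ≤ η' := mul_le_of_le_one_right hη'0.le
      (Real.rpow_le_one_of_one_le_of_nonpos (by linarith) (by linarith))
    have hball : ∀ z ∈ Metric.closedBall s R, 1 - η' * |z.im| ^ (-20 * ε) ≤ z.re ∧ z.re ≤ 5 / 2 ∧
        2 ≤ |z.im| ∧ |z.im| ≤ 2 * |s.im| := by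
      intro z hz
      rw [Metric.mem_closedBall, dist_eq_norm] at hz
      have hr := (Complex.abs_re_le_norm (z - s)).trans hz
      have hi := (Complex.abs_im_le_norm (z - s)).trans hz
      rw [Complex.sub_re, abs_le] at hr
      rw [Complex.sub_im] at hi
      have e1 := abs_sub_abs_le_abs_sub z.im s.im
      have e2 := abs_sub_abs_le_abs_sub s.im z.im
      rw [abs_sub_comm] at e2
      have hz2 : 2 ≤ |z.im| := by linarith
      have hz3 : |z.im| ≤ 2 * |s.im| := by linarith
      refine ⟨?_, by linarith, hz2, hz3⟩
      have : R ≤ η' * |z.im| ^ (-20 * ε) := by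
        rw [hR]
        gcongr η' * ?_
        exact Real.rpow_le_rpow_of_nonpos (by linarith) hz3 (by linarith)
      linarith
    have hdiff : DiffContOnCl ℂ vonMangoldtSubOneL (Metric.ball s R) := by
      refine DifferentiableOn.diffContOnCl_ball (U := Metric.closedBall s R) (fun z hz => ?_)
        subset_rfl
      obtain ⟨k1, k2, k3, k4⟩ := hball z hz
      exact (analyticAt_vonMangoldtSubOneL
        (Or.inr (hbd z k1 k2 k3).1)).differentiableAt.differentiableWithinAt
    have hC := Complex.norm_iteratedDeriv_le_of_forall_mem_sphere_norm_le
      (C := (B / c + A) * (2 * |s.im|) ^ (20 * ε)) k hR0 hdiff (fun z hz => by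
        obtain ⟨k1, k2, k3, k4⟩ := hball z (Metric.sphere_subset_closedBall hz)
        refine (hbd z k1 k2 k3).2.trans ?_
        gcongr)
    refine hC.trans ?_
    have hRk : R ^ k = η' ^ k * (2 * |s.im|) ^ (-20 * ε * k) := by
      rw [hR, mul_pow, ← Real.rpow_natCast ((2 * |s.im|) ^ (-20 * ε)), ← Real.rpow_mul (by positivity)]
    have hexp : (2 * |s.im|) ^ (20 * ε) / (2 * |s.im|) ^ (-20 * ε * k)
        = (2 * |s.im|) ^ (1 / 2 : ℝ) := by
      rw [← Real.rpow_sub (by positivity)]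
      congr 1
      rw [hε]; field_simp; ring
    have h2s : (2 * |s.im|) ^ (1 / 2 : ℝ) ≤ 2 * (1 + |s.im|) ^ (1 / 2 : ℝ) := by
      rw [Real.mul_rpow (by norm_num) ht0.le]
      gcongr
      · calc (2 : ℝ) ^ (1 / 2 : ℝ) ≤ 2 ^ (1 : ℝ) := by gcongr <;> norm_num
          _ = 2 := by norm_num
      · linarith
    calc (k.factorial : ℝ) * ((B / c + A) * (2 * |s.im|) ^ (20 * ε)) / R ^ k
        = k.factorial * (B / c + A) / η' ^ k *
          ((2 * |s.im|) ^ (20 * ε) / (2 * |s.im|) ^ (-20 * ε * k)) := by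
          rw [hRk]; field_simp
      _ ≤ k.factorial * (B / c + A) / η' ^ k * (2 * (1 + |s.im|) ^ (1 / 2 : ℝ)) := by
          rw [hexp]; gcongr
      _ = C₂ * (1 + |s.im|) ^ (1 / 2 : ℝ) := by rw [hC₂]; ring
      _ ≤ _ := by gcongr; linarith [abs_nonneg C₁]

/-! ### Perron's formula with a logarithmic weight -/

open Complex in
/-- The Mellin transform of `log⁺(1/u)`. -/
lemma mellin_log_Ioc {s : ℂ} (hs : 0 < s.re) :
    MellinConvergent (fun u : ℝ => ((max (Real.log (1 / u)) 0 : ℝ) : ℂ)) s ∧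
      mellin (fun u : ℝ => ((max (Real.log (1 / u)) 0 : ℝ) : ℂ)) s = 1 / s ^ 2 := by
  set f : ℝ → ℂ := Set.indicator (Set.Ioc 0 1) (fun _ => (1 : ℂ)) with hf
  have hs0 : s ≠ 0 := by rintro rfl; simp at hs
  have hint : MeasureTheory.Integrable f MeasureTheory.volume :=
    (MeasureTheory.integrable_indicator_iff measurableSet_Ioc).2
      (MeasureTheory.integrableOn_const (by simp))
  have hloc : MeasureTheory.LocallyIntegrableOn f (Set.Ioi 0) := hint.locallyIntegrable.locallyIntegrableOn _
  have htop : f =O[Filter.atTop] fun x : ℝ => x ^ (-(s.re + 1)) := by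
    have : f =ᶠ[Filter.atTop] fun _ => (0 : ℂ) := by
      filter_upwards [Filter.eventually_gt_atTop 1] with x hx
      simp [hf, hx]
    exact this.trans_isBigO (Asymptotics.isBigO_zero _ _)
  have hbot : f =O[nhdsWithin 0 (Set.Ioi 0)] fun x : ℝ => x ^ (-(0 : ℝ)) := by
    refine Asymptotics.IsBigO.of_bound 1 (Filter.Eventually.of_forall fun x => ?_)
    simp only [hf, neg_zero, Real.rpow_zero, Set.indicator]
    split_ifs <;> simp
  have hd := mellin_hasDerivAt_of_isBigO_rpow hloc htop (by linarith) hbot hs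
  have hcongr : ∀ u ∈ Set.Ioi (0 : ℝ), ((max (Real.log (1 / u)) 0 : ℝ) : ℂ) = -(Real.log u • f u) := by
    intro u hu
    have hu0 : 0 < u := hu
    rw [one_div, Real.log_inv]
    by_cases h1 : u ≤ 1
    · have : Real.log u ≤ 0 := Real.log_nonpos hu0.le h1
      rw [max_eq_left (by linarith)]
      simp [hf, hu0, h1]
    · have : 0 < Real.log u := Real.log_pos (by linarith)
      rw [max_eq_right (by linarith)]
      simp [hf, h1]
  have hder : HasDerivAt (mellin f) (-1 / s ^ 2) s := by
    have h1 : HasDerivAt (fun z : ℂ => 1 / z) (-1 / s ^ 2) s := by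
      simpa [neg_div] using hasDerivAt_inv hs0
    refine h1.congr_of_eventuallyEq ?_
    filter_upwards [(isOpen_lt continuous_const Complex.continuous_re).mem_nhds hs] with z hz
    exact (hasMellin_one_Ioc hz).2
  have heq := hd.2.unique hder
  constructor
  · refine MeasureTheory.IntegrableOn.congr_fun hd.1.neg (fun u hu => ?_) measurableSet_Ioi
    simp only [hcongr u hu]
    simp
  · have : mellin (fun u : ℝ => ((max (Real.log (1 / u)) 0 : ℝ) : ℂ)) s
        = - mellin (fun t => Real.log t • f t) s := by
      rw [mellin, mellin, ← MeasureTheory.integral_neg]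
      refine MeasureTheory.setIntegral_congr_fun measurableSet_Ioi (fun u hu => ?_)
      simp only [hcongr u hu]
      simp
    rw [this, heq]; ring

lemma norm_sq_vertical (c t : ℝ) : ‖(c + t * Complex.I : ℂ)‖ ^ 2 = c ^ 2 + t ^ 2 := by
  rw [Complex.sq_norm, Complex.normSq_apply]; simp; ring

lemma continuous_inv_sq_vertical {c : ℝ} (hc : 0 < c) :
    Continuous fun t : ℝ => 1 / (c + t * Complex.I : ℂ) ^ 2 := by
  refine continuous_const.div (by fun_prop) (fun t => ?_)
  refine pow_ne_zero _ (fun h => ?_)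
  have := congrArg Complex.re h
  simp at this
  linarith

lemma integrable_inv_add_sq {c : ℝ} (hc : 0 < c) :
    MeasureTheory.Integrable fun t : ℝ => 1 / (c ^ 2 + t ^ 2) := by
  have := ((integrable_inv_one_add_sq).comp_div hc.ne').const_mul (1 / c ^ 2)
  refine this.congr (Filter.Eventually.of_forall fun t => ?_)
  simp only
  field_simp

lemma integrable_inv_sq_vertical {c : ℝ} (hc : 0 < c) :
    MeasureTheory.Integrable fun t : ℝ => 1 / (c + t * Complex.I : ℂ) ^ 2 := by
  refine (integrable_inv_add_sq hc).mono' (continuous_inv_sq_vertical hc).aestronglyMeasurable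
    (Filter.Eventually.of_forall fun t => ?_)
  rw [norm_div, norm_pow, norm_sq_vertical, norm_one]

/-- Mellin inversion for `log⁺(1/u)`. -/
lemma perron_kernel {c u : ℝ} (hc : 0 < c) (hu : 0 < u) :
    ∫ t : ℝ, (u : ℂ) ^ (-(c + t * Complex.I : ℂ)) * (1 / (c + t * Complex.I : ℂ) ^ 2) =
      2 * (Real.pi : ℂ) * ((max (Real.log (1 / u)) 0 : ℝ) : ℂ) := by
  have hre : ∀ t : ℝ, 0 < (c + t * Complex.I : ℂ).re := fun t => by simpa using hc
  have h := mellinInv_mellin_eq c (fun u : ℝ => ((max (Real.log (1 / u)) 0 : ℝ) : ℂ)) hu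
    (mellin_log_Ioc (s := c) (by simpa using hc)).1 ?_ ?_
  · rw [← h, mellinInv]
    have : ∀ t : ℝ, mellin (fun u : ℝ => ((max (Real.log (1 / u)) 0 : ℝ) : ℂ)) (c + t * Complex.I)
        = 1 / (c + t * Complex.I : ℂ) ^ 2 := fun t => (mellin_log_Ioc (hre t)).2
    simp only [this, smul_eq_mul]
    rw [Complex.real_smul]
    push_cast
    have hpi : (Real.pi : ℂ) ≠ 0 := by exact_mod_cast Real.pi_ne_zero
    rw [← mul_assoc, mul_one_div_cancel (mul_ne_zero two_ne_zero hpi), one_mul]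
  · rw [Complex.VerticalIntegrable]
    refine (integrable_inv_sq_vertical hc).congr (Filter.Eventually.of_forall fun t => ?_)
    exact (mellin_log_Ioc (hre t)).2.symm
  · have : ContinuousAt (fun u : ℝ => max (Real.log (1 / u)) 0) u := by
      have h1 : ContinuousAt (fun u : ℝ => Real.log (1 / u)) u :=
        ContinuousAt.log (continuousAt_const.div continuousAt_id hu.ne') (by positivity)
      exact h1.sup continuousAt_const
    exact Complex.continuous_ofReal.continuousAt.comp this

/-- Perron's formula with the absolutely convergent kernel `x ^ s / s ^ 2`. -/
lemma perron_formula {a : ℕ → ℂ} {c x : ℝ} (hc : 0 < c) (hx : 0 < x) (ha : LSeriesSummable a c) :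
    2 * (Real.pi : ℂ) * ∑' n : ℕ, a n * ((max (Real.log (x / n)) 0 : ℝ) : ℂ) =
      ∫ t : ℝ, LSeries a (c + t * Complex.I) * (x : ℂ) ^ (c + t * Complex.I : ℂ) *
        (1 / (c + t * Complex.I : ℂ) ^ 2) := by
  set g : ℕ → ℝ → ℂ := fun n t => LSeries.term a (c + t * Complex.I) n *
    (x : ℂ) ^ (c + t * Complex.I : ℂ) * (1 / (c + t * Complex.I : ℂ) ^ 2) with hg
  have hterm : ∀ (n : ℕ) (t : ℝ), ‖LSeries.term a (c + t * Complex.I) n‖ = ‖LSeries.term a c n‖ := by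
    intro n t
    rw [LSeries.norm_term_eq, LSeries.norm_term_eq]
    simp
  have hxn : ∀ t : ℝ, ‖(x : ℂ) ^ (c + t * Complex.I : ℂ)‖ = x ^ c := by
    intro t
    rw [Complex.norm_cpow_eq_rpow_re_of_pos hx]; simp
  have hgn : ∀ n t, ‖g n t‖ = ‖LSeries.term a c n‖ * x ^ c * (1 / (c ^ 2 + t ^ 2)) := by
    intro n t
    simp only [hg]
    rw [norm_mul, norm_mul, hterm, hxn, norm_div, norm_pow, norm_sq_vertical, norm_one]
  have hgi : ∀ n, MeasureTheory.Integrable (g n) := by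
    intro n
    refine ((integrable_inv_add_sq hc).const_mul (‖LSeries.term a c n‖ * x ^ c)).mono' ?_
      (Filter.Eventually.of_forall fun t => (hgn n t).le)
    refine Continuous.aestronglyMeasurable ?_
    refine (Continuous.mul ?_ ?_).mul (continuous_inv_sq_vertical hc)
    · rcases Nat.eq_zero_or_pos n with rfl | hn
      · simp only [LSeries.term_zero]; exact continuous_const
      · simp only [LSeries.term_of_ne_zero hn.ne']
        have hn0 : (n : ℂ) ≠ 0 := by exact_mod_cast hn.ne'
        refine continuous_const.div ?_ (fun t => by simp [Complex.cpow_eq_zero_iff, hn0])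
        exact Continuous.const_cpow (by fun_prop) (Or.inl hn0)
    · exact Continuous.const_cpow (by fun_prop) (Or.inl (by exact_mod_cast hx.ne'))
  have hsum : Summable fun n => ∫ t, ‖g n t‖ := by
    have : ∀ n, ∫ t, ‖g n t‖ = ‖LSeries.term a c n‖ * (x ^ c * ∫ t : ℝ, (1 / (c ^ 2 + t ^ 2))) := by
      intro n
      simp only [hgn]
      rw [MeasureTheory.integral_const_mul]
      ring
    simp only [this]
    exact (ha.norm).mul_right _
  have h := MeasureTheory.integral_tsum_of_summable_integral_norm hgi hsum
  have e1 : ∀ t : ℝ, ∑' n, g n t = LSeries a (c + t * Complex.I) * (x : ℂ) ^ (c + t * Complex.I : ℂ) *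
        (1 / (c + t * Complex.I : ℂ) ^ 2) := by
    intro t
    simp only [hg]
    rw [tsum_mul_right, tsum_mul_right]
    rfl
  simp only [e1] at h
  rw [← h, ← tsum_mul_left]
  congr 1
  ext n
  simp only [hg]
  rcases Nat.eq_zero_or_pos n with rfl | hn
  · simp
  · have hn0 : (0 : ℝ) < n := by exact_mod_cast hn
    have hk := perron_kernel (c := c) (u := n / x) hc (by positivity)
    have e2 : ∀ t : ℝ, LSeries.term a (c + t * Complex.I) n * (x : ℂ) ^ (c + t * Complex.I : ℂ) *
        (1 / (c + t * Complex.I : ℂ) ^ 2) = a n * (((n / x : ℝ) : ℂ) ^ (-(c + t * Complex.I : ℂ)) *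
          (1 / (c + t * Complex.I : ℂ) ^ 2)) := by
      intro t
      rw [LSeries.term_of_ne_zero hn.ne']
      have e3 : ((n / x : ℝ) : ℂ) ^ (-(c + t * Complex.I : ℂ)) =
          (x : ℂ) ^ (c + t * Complex.I : ℂ) / (n : ℂ) ^ (c + t * Complex.I : ℂ) := by
        rw [Complex.ofReal_div, Complex.div_cpow_ofReal_nonneg hn0.le hx.le, Complex.cpow_neg,
          Complex.cpow_neg, Complex.ofReal_natCast]
        field_simp
      rw [e3]; ring
    simp only [e2]
    rw [MeasureTheory.integral_const_mul, hk, one_div_div]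
    ring

/-- The Dirichlet coefficients `Λ(n) - 1`. -/
noncomputable def vonMangoldtSubOne (n : ℕ) : ℝ := ArithmeticFunction.vonMangoldt n - 1

lemma LSeriesSummable_vonMangoldtSubOne {s : ℂ} (hs : 1 < s.re) :
    LSeriesSummable (fun n => (vonMangoldtSubOne n : ℂ)) s := by
  have h := (ArithmeticFunction.LSeriesSummable_vonMangoldt hs).sub
    (LSeriesSummable_one_iff.2 hs)
  convert h using 1
  ext n
  simp [vonMangoldtSubOne]

lemma abscissaOfAbsConv_vonMangoldtSubOne :
    LSeries.abscissaOfAbsConv (fun n => (vonMangoldtSubOne n : ℂ)) ≤ 1 :=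
  LSeries.abscissaOfAbsConv_le_of_forall_lt_LSeriesSummable' fun y hy =>
    LSeriesSummable_vonMangoldtSubOne (by simpa using (by exact_mod_cast hy : (1 : ℝ) < y))

lemma LSeries_vonMangoldtSubOne {s : ℂ} (hs : 1 < s.re) :
    LSeries (fun n => (vonMangoldtSubOne n : ℂ)) s = vonMangoldtSubOneL s := by
  have hs1 : s ≠ 1 := by rintro rfl; simp at hs
  rw [vonMangoldtSubOneL_eq hs1 (riemannZeta_ne_zero_of_one_lt_re hs), ← neg_div,
    ← ArithmeticFunction.LSeries_vonMangoldt_eq_deriv_riemannZeta_div hs,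
    ← LSeries_one_eq_riemannZeta hs,
    ← LSeries_sub (ArithmeticFunction.LSeriesSummable_vonMangoldt hs) (LSeriesSummable_one_iff.2 hs)]
  congr 1
  ext n
  simp [vonMangoldtSubOne]

lemma logMul_iterate (f : ℕ → ℝ) (k : ℕ) :
    LSeries.logMul^[k] (fun n => (f n : ℂ)) = fun n => ((f n * Real.log n ^ k : ℝ) : ℂ) := by
  induction k with
  | zero => simp
  | succ k ih =>
    rw [Function.iterate_succ_apply', ih]
    ext n
    simp only [LSeries.logMul, ← Complex.natCast_log]
    push_cast
    ring

lemma LSeries_log_pow_vonMangoldtSubOne (k : ℕ) {s : ℂ} (hs : 1 < s.re) :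
    LSeriesSummable (fun n => ((vonMangoldtSubOne n * Real.log n ^ k : ℝ) : ℂ)) s ∧
    ‖LSeries (fun n => ((vonMangoldtSubOne n * Real.log n ^ k : ℝ) : ℂ)) s‖ =
      ‖iteratedDeriv k vonMangoldtSubOneL s‖ := by
  have hab : LSeries.abscissaOfAbsConv (fun n => (vonMangoldtSubOne n : ℂ)) < s.re :=
    lt_of_le_of_lt abscissaOfAbsConv_vonMangoldtSubOne (by exact_mod_cast hs)
  constructor
  · rw [← logMul_iterate]
    apply LSeriesSummable_of_abscissaOfAbsConv_lt_re
    rwa [LSeries.absicssaOfAbsConv_logPowMul]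
  · have h1 : iteratedDeriv k vonMangoldtSubOneL s =
        iteratedDeriv k (LSeries (fun n => (vonMangoldtSubOne n : ℂ))) s := by
      apply Filter.EventuallyEq.iteratedDeriv_eq
      filter_upwards [(isOpen_lt continuous_const Complex.continuous_re).mem_nhds hs] with z hz
      exact (LSeries_vonMangoldtSubOne hz).symm
    rw [h1, LSeries_iteratedDeriv k hab, logMul_iterate, norm_mul]
    simp

lemma integrable_rpow_div_one_add_sq :
    MeasureTheory.Integrable fun t : ℝ => (1 + |t|) ^ (1 / 2 : ℝ) * (1 / (1 + t ^ 2)) := by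
  have h := (integrable_one_add_norm (E := ℝ) (μ := MeasureTheory.volume) (r := 3 / 2)
    (by simp; norm_num)).const_mul 2
  refine h.mono' ?_ (Filter.Eventually.of_forall fun t => ?_)
  · refine Continuous.aestronglyMeasurable ?_
    refine Continuous.mul ?_ (continuous_const.div (by fun_prop) (fun t => by positivity))
    exact Continuous.rpow_const (by fun_prop) (fun t => Or.inr (by norm_num))
  · have h0 : 0 < 1 + |t| := by positivity
    rw [Real.norm_eq_abs, abs_of_nonneg (by positivity), Real.norm_eq_abs]
    have e : (1 + |t|) ^ (1 / 2 : ℝ) = (1 + |t|) ^ (-(3 / 2) : ℝ) * (1 + |t|) ^ 2 := by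
      rw [← Real.rpow_natCast (1 + |t|) 2, ← Real.rpow_add h0]; norm_num
    rw [e, mul_assoc, mul_comm (2 : ℝ)]
    gcongr
    rw [mul_one_div, div_le_iff₀ (by positivity)]
    have := sq_abs t
    nlinarith [sq_nonneg (|t| - 1)]

/-- The logarithmically smoothed sums of `(Λ(n) - 1) (log n)^k` are `O(x)`, for every `k`. On the line
`Re s = 1 + 1 / log x` the factor `x^s` has modulus `e x`, and the `k`-th derivative of the Dirichlet
series is integrable against `1 / |s|²`, uniformly up to `Re s = 1`. The growth in `k` of the weight
`(log n)^k` is what turns into a saving of powers of `log x`. -/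
lemma exists_abs_smoothed_sum_le (k : ℕ) :
    ∃ C : ℝ, 0 < C ∧ ∀ (x : ℝ) (M : ℕ), 3 ≤ x → x ≤ M →
      |∑ n ∈ Finset.range M, vonMangoldtSubOne n * Real.log n ^ k *
        max (Real.log (x / n)) 0| ≤ C * x := by
  obtain ⟨C, hC, h⟩ := exists_norm_iteratedDeriv_vonMangoldtSubOneL_le k
  set I := ∫ t : ℝ, (1 + |t|) ^ (1 / 2 : ℝ) * (1 / (1 + t ^ 2)) with hI
  have hI0 : 0 ≤ I := MeasureTheory.integral_nonneg fun t => by positivity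
  refine ⟨C * Real.exp 1 * (I + 1), by positivity, fun x M hx hM => ?_⟩
  have hx0 : 0 < x := by linarith
  have hlog : 1 < Real.log x := by
    rw [Real.lt_log_iff_exp_lt hx0]
    exact lt_of_lt_of_le Real.exp_one_lt_d9 (by linarith)
  set c : ℝ := 1 + 1 / Real.log x with hc
  have hc1 : 1 < c := by rw [hc]; have : 0 < 1 / Real.log x := by positivity
                         linarith
  have hc2 : c ≤ 2 := by
    have : 1 / Real.log x ≤ 1 := by rw [div_le_one (by linarith)]; exact hlog.le
    linarith
  have hxc : x ^ c = Real.exp 1 * x := by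
    rw [hc, Real.rpow_add hx0, Real.rpow_one, Real.rpow_def_of_pos hx0, mul_one_div_cancel (by linarith)]
    ring
  have hp := perron_formula (a := fun n => ((vonMangoldtSubOne n * Real.log n ^ k : ℝ) : ℂ))
    (c := c) (x := x) (by linarith) hx0 (LSeries_log_pow_vonMangoldtSubOne k (by simpa using hc1)).1
  have hts : ∑' n : ℕ, ((vonMangoldtSubOne n * Real.log n ^ k : ℝ) : ℂ) *
      ((max (Real.log (x / n)) 0 : ℝ) : ℂ) = ((∑ n ∈ Finset.range M,
        vonMangoldtSubOne n * Real.log n ^ k * max (Real.log (x / n)) 0 : ℝ) : ℂ) := by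
    rw [tsum_eq_sum (s := Finset.range M)]
    · push_cast; rfl
    · intro n hn
      have hn' : x ≤ n := hM.trans (by exact_mod_cast not_lt.1 (fun h => hn (Finset.mem_range.2 h)))
      have : max (Real.log (x / n)) 0 = 0 := by
        apply max_eq_right
        apply Real.log_nonpos (by positivity)
        rw [div_le_one (by linarith)]; exact hn'
      rw [this]; simp
  rw [hts] at hp
  set S := ∑ n ∈ Finset.range M, vonMangoldtSubOne n * Real.log n ^ k * max (Real.log (x / n)) 0
  have hbound : ‖2 * (Real.pi : ℂ) * (S : ℂ)‖ ≤ C * (Real.exp 1 * x) * I := by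
    rw [hp, hI, ← MeasureTheory.integral_const_mul]
    refine MeasureTheory.norm_integral_le_of_norm_le
      (integrable_rpow_div_one_add_sq.const_mul _) (Filter.Eventually.of_forall fun t => ?_)
    have hre : (c + t * Complex.I : ℂ).re = c := by simp
    have him : (c + t * Complex.I : ℂ).im = t := by simp
    rw [norm_mul, norm_mul, (LSeries_log_pow_vonMangoldtSubOne k (by rw [hre]; exact hc1)).2,
      Complex.norm_cpow_eq_rpow_re_of_pos hx0, hre, hxc, norm_div, norm_pow, norm_sq_vertical, norm_one]
    have h1 := h (c + t * Complex.I) (by rw [hre]; exact hc1.le) (by rw [hre]; exact hc2)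
    rw [him] at h1
    have h2 : 1 / (c ^ 2 + t ^ 2) ≤ 1 / (1 + t ^ 2) := by
      apply one_div_le_one_div_of_le (by positivity)
      nlinarith
    calc _ ≤ (C * (1 + |t|) ^ (1 / 2 : ℝ)) * (Real.exp 1 * x) * (1 / (1 + t ^ 2)) := by gcongr
      _ = _ := by ring
  have hpi : ‖2 * (Real.pi : ℂ) * (S : ℂ)‖ = 2 * Real.pi * |S| := by
    rw [norm_mul, norm_mul, Complex.norm_real, Complex.norm_real, Real.norm_eq_abs, Real.norm_eq_abs,
      abs_of_pos Real.pi_pos]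
    simp
  rw [hpi] at hbound
  have h3 : |S| ≤ 2 * Real.pi * |S| := by
    have := Real.pi_gt_three
    nlinarith [abs_nonneg S]
  have h4 : C * (Real.exp 1 * x) * I ≤ C * Real.exp 1 * (I + 1) * x := by
    have : 0 ≤ C * Real.exp 1 * x := by positivity
    nlinarith
  linarith

/-! ### Comparison of powers of logarithms -/

lemma exists_log_pow_le (m : ℕ) {δ : ℝ} (hδ : 0 < δ) :
    ∃ C : ℝ, 0 < C ∧ ∀ x : ℝ, 1 ≤ x → Real.log x ^ m ≤ C * x ^ δ := by
  set δ' := δ / (m + 1) with hδ'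
  have h0 : 0 < δ' := by positivity
  refine ⟨(1 / δ') ^ m, by positivity, fun x hx => ?_⟩
  have hx0 : 0 < x := by linarith
  calc Real.log x ^ m ≤ (x ^ δ' / δ') ^ m :=
        pow_le_pow_left₀ (Real.log_nonneg hx) (Real.log_le_rpow_div hx0.le h0) m
    _ = (1 / δ') ^ m * x ^ (δ' * m) := by
        rw [Real.rpow_mul hx0.le, Real.rpow_natCast, ← mul_pow]; ring
    _ ≤ (1 / δ') ^ m * x ^ δ := by
        gcongr
        · rw [hδ', div_mul_eq_mul_div, div_le_iff₀ (by positivity)]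
          nlinarith

/-- Replacing `log u` by `log x` costs only a small power of `x / u`. -/
lemma exists_log_pow_le_mul (m : ℕ) {δ : ℝ} (hδ : 0 < δ) :
    ∃ C : ℝ, 0 < C ∧ ∀ u x : ℝ, 2 ≤ u → u ≤ x →
      Real.log x ^ m ≤ C * (x / u) ^ δ * Real.log u ^ m := by
  set δ' := δ / (m + 1) with hδ'
  have h0 : 0 < δ' := by positivity
  have hl2 : 0 < Real.log 2 := Real.log_pos (by norm_num)
  refine ⟨(1 + 1 / (δ' * Real.log 2)) ^ m, by positivity, fun u x hu hx => ?_⟩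
  have hu0 : 0 < u := by linarith
  have hr : 1 ≤ x / u := by rwa [le_div_iff₀ hu0, one_mul]
  have hr0 : 0 < x / u := by positivity
  have hlu : Real.log 2 ≤ Real.log u := Real.log_le_log (by norm_num) hu
  have hrδ : 1 ≤ (x / u) ^ δ' := Real.one_le_rpow hr h0.le
  have h1 : Real.log x ≤ (1 + 1 / (δ' * Real.log 2)) * (x / u) ^ δ' * Real.log u := by
    have e : Real.log x = Real.log u + Real.log (x / u) := by
      rw [Real.log_div (by linarith) hu0.ne']; ring
    have h2 : Real.log (x / u) ≤ (x / u) ^ δ' / δ' := Real.log_le_rpow_div hr0.le h0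
    have h3 : (x / u) ^ δ' / δ' ≤ (x / u) ^ δ' / δ' * (Real.log u / Real.log 2) :=
      le_mul_of_one_le_right (by positivity) (by rwa [le_div_iff₀ hl2, one_mul])
    have h4 : Real.log u ≤ (x / u) ^ δ' * Real.log u :=
      le_mul_of_one_le_left (by linarith) hrδ
    calc Real.log x ≤ (x / u) ^ δ' * Real.log u + (x / u) ^ δ' / δ' * (Real.log u / Real.log 2) := by
          linarith
      _ = _ := by field_simp
  calc Real.log x ^ m ≤ ((1 + 1 / (δ' * Real.log 2)) * (x / u) ^ δ' * Real.log u) ^ m :=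
        pow_le_pow_left₀ (Real.log_nonneg (by linarith)) h1 m
    _ = (1 + 1 / (δ' * Real.log 2)) ^ m * (x / u) ^ (δ' * m) * Real.log u ^ m := by
        rw [Real.rpow_mul hr0.le, Real.rpow_natCast, mul_pow, mul_pow]
    _ ≤ _ := by
        have : 0 ≤ Real.log u := by linarith
        gcongr
        · rw [hδ', div_mul_eq_mul_div, div_le_iff₀ (by positivity)]
          nlinarith

/-! ### The prime number theorem with error term -/

lemma neg_one_le_vonMangoldtSubOne (n : ℕ) : -1 ≤ vonMangoldtSubOne n := by
  rw [vonMangoldtSubOne]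
  linarith [ArithmeticFunction.vonMangoldt_nonneg (n := n)]

lemma card_filter_Ioc_le {x y : ℝ} (hx : 0 ≤ x) (hxy : x ≤ y) (M : ℕ) :
    (((Finset.range M).filter (fun n : ℕ => x < n ∧ (n : ℝ) ≤ y)).card : ℝ) ≤ y - x + 1 := by
  have h1 : (Finset.range M).filter (fun n : ℕ => x < n ∧ (n : ℝ) ≤ y) ⊆ Finset.Ioc ⌊x⌋₊ ⌊y⌋₊ := by
    intro n hn
    obtain ⟨_, h1, h2⟩ := Finset.mem_filter.1 hn
    exact Finset.mem_Ioc.2 ⟨(Nat.floor_lt hx).2 h1, Nat.le_floor h2⟩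
  have h2 := Finset.card_le_card h1
  rw [Nat.card_Ioc] at h2
  have h3 : ⌊x⌋₊ ≤ ⌊y⌋₊ := Nat.floor_mono hxy
  have h4 := Nat.floor_le (hx.trans hxy)
  have h5 := Nat.lt_floor_add_one x
  have h6 : (((Finset.range M).filter (fun n : ℕ => x < n ∧ (n : ℝ) ≤ y)).card : ℝ) ≤
      ((⌊y⌋₊ - ⌊x⌋₊ : ℕ) : ℝ) := by exact_mod_cast h2
  rw [Nat.cast_sub h3] at h6
  linarith

lemma sum_Icc_floor_eq_sum_range (f : ℕ → ℝ) {x : ℝ} {M : ℕ} (hx : 0 ≤ x) (hM : x < M) :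
    ∑ n ∈ Finset.Icc 0 ⌊x⌋₊, f n = ∑ n ∈ Finset.range M, if (n : ℝ) ≤ x then f n else 0 := by
  rw [← Finset.sum_filter]
  congr 1
  ext n
  simp only [Finset.mem_Icc, Finset.mem_filter, Finset.mem_range, zero_le, true_and]
  rw [Nat.le_floor_iff hx]
  constructor
  · intro h
    exact ⟨by exact_mod_cast h.trans_lt hM, h⟩
  · exact fun h => h.2

/-- Unsmoothing: as `Λ(n) - 1 ≥ -1`, the increments of the logarithmically smoothed sum bound the
sharply cut sum from both sides. -/
lemma unsmooth {k : ℕ} (hk : k ≠ 0) {x y : ℝ} {M : ℕ} (hx : 1 ≤ x) (hxy : x ≤ y) (hM : y < M) :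
    let b := fun n : ℕ => vonMangoldtSubOne n * Real.log n ^ k
    let H := fun z : ℝ => ∑ n ∈ Finset.range M, b n * max (Real.log (z / n)) 0
    let E := Real.log (y / x) * ((y - x + 1) * Real.log y ^ k)
    Real.log (y / x) * ∑ n ∈ Finset.Icc 0 ⌊x⌋₊, b n ≤ H y - H x + E ∧
      H y - H x - E ≤ Real.log (y / x) * ∑ n ∈ Finset.Icc 0 ⌊y⌋₊, b n := by
  intro b H E
  set h := Real.log (y / x) with hh
  have hx0 : 0 < x := by linarith
  have hy0 : 0 < y := by linarith
  have hh0 : 0 ≤ h := Real.log_nonneg (by rwa [le_div_iff₀ hx0, one_mul])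
  have hly : 0 ≤ Real.log y := Real.log_nonneg (by linarith)
  set w : ℕ → ℝ := fun n => max (Real.log (y / n)) 0 - max (Real.log (x / n)) 0 with hw
  have hHw : H y - H x = ∑ n ∈ Finset.range M, b n * w n := by
    simp only [H, hw]
    rw [← Finset.sum_sub_distrib]
    exact Finset.sum_congr rfl fun n _ => by ring
  -- the weight is `h` below `x`, lies in `[0, h]` between `x` and `y`, and vanishes above `y`
  have hw1 : ∀ n : ℕ, n ≠ 0 → (n : ℝ) ≤ x → w n = h := by
    intro n hn hnx
    have hn0 : (0 : ℝ) < n := by exact_mod_cast Nat.pos_of_ne_zero hn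
    have h1 : 0 ≤ Real.log (x / n) := Real.log_nonneg (by rwa [le_div_iff₀ hn0, one_mul])
    have h2 : 0 ≤ Real.log (y / n) :=
      Real.log_nonneg (by rw [le_div_iff₀ hn0, one_mul]; linarith)
    simp only [hw]
    rw [max_eq_left h1, max_eq_left h2, hh, Real.log_div hy0.ne' hn0.ne',
      Real.log_div hx0.ne' hn0.ne', Real.log_div hy0.ne' hx0.ne']
    ring
  have hw2 : ∀ n : ℕ, x < n → (n : ℝ) ≤ y → 0 ≤ w n ∧ w n ≤ h := by
    intro n hnx hny
    have hn0 : (0 : ℝ) < n := by linarith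
    have h1 : Real.log (x / n) ≤ 0 :=
      Real.log_nonpos (by positivity) (by rw [div_le_one hn0]; exact hnx.le)
    have h2 : 0 ≤ Real.log (y / n) := Real.log_nonneg (by rwa [le_div_iff₀ hn0, one_mul])
    have h3 : Real.log (y / n) ≤ h := by
      rw [hh]
      apply Real.log_le_log (by positivity)
      gcongr
    simp only [hw]
    rw [max_eq_right h1, max_eq_left h2]
    constructor <;> linarith
  have hw3 : ∀ n : ℕ, y < n → w n = 0 := by
    intro n hny
    have hn0 : (0 : ℝ) < n := by linarith
    have h1 : Real.log (x / n) ≤ 0 :=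
      Real.log_nonpos (by positivity) (by rw [div_le_one hn0]; linarith)
    have h2 : Real.log (y / n) ≤ 0 :=
      Real.log_nonpos (by positivity) (by rw [div_le_one hn0]; linarith)
    simp only [hw]
    rw [max_eq_right h1, max_eq_right h2, sub_zero]
  have hE : ∑ n ∈ Finset.range M, (if x < (n : ℝ) ∧ (n : ℝ) ≤ y then h * Real.log y ^ k else 0) ≤ E := by
    rw [← Finset.sum_filter, Finset.sum_const, nsmul_eq_mul]
    simp only [E]
    calc _ ≤ (y - x + 1) * (h * Real.log y ^ k) := by
          gcongr
          exact card_filter_Ioc_le hx0.le hxy M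
      _ = _ := by ring
  have hb0 : b 0 = 0 := by simp [b, hk]
  have hlow : ∀ n : ℕ, x < n → (n : ℝ) ≤ y → -(Real.log y ^ k) ≤ b n := by
    intro n h1 h2
    have hl : Real.log n ^ k ≤ Real.log y ^ k :=
      pow_le_pow_left₀ (Real.log_nonneg (by linarith)) (Real.log_le_log (by linarith) h2) k
    have hl0 : 0 ≤ Real.log n ^ k := pow_nonneg (Real.log_nonneg (by linarith)) k
    have := neg_one_le_vonMangoldtSubOne n
    simp only [b]
    nlinarith
  have hyk : 0 ≤ Real.log y ^ k := pow_nonneg hly k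
  rw [hHw]
  constructor
  · rw [sum_Icc_floor_eq_sum_range b hx0.le (hxy.trans_lt hM), Finset.mul_sum]
    refine le_trans ?_ (add_le_add_right hE _)
    rw [← Finset.sum_add_distrib]
    refine Finset.sum_le_sum fun n _ => ?_
    rcases eq_or_ne n 0 with rfl | hn
    · simp only [hb0, ite_self, mul_zero, zero_mul, zero_add]
      split_ifs <;> positivity
    rcases le_or_gt (n : ℝ) x with h1 | h1
    · rw [if_pos h1, if_neg (by intro h; linarith [h.1]), hw1 n hn h1]
      linarith
    · rcases le_or_gt (n : ℝ) y with h2 | h2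
      · rw [if_neg (not_le.2 h1), if_pos ⟨h1, h2⟩]
        obtain ⟨k1, k2⟩ := hw2 n h1 h2
        have := hlow n h1 h2
        nlinarith
      · rw [if_neg (not_le.2 h1), if_neg (by intro h; linarith [h.2]), hw3 n h2]
        simp
  · rw [sum_Icc_floor_eq_sum_range b hy0.le hM, Finset.mul_sum, sub_le_iff_le_add]
    refine le_trans ?_ (add_le_add_right hE _)
    rw [← Finset.sum_add_distrib]
    refine Finset.sum_le_sum fun n _ => ?_
    rcases eq_or_ne n 0 with rfl | hn
    · simp only [hb0, ite_self, mul_zero, zero_mul, zero_add]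
      split_ifs <;> positivity
    rcases le_or_gt (n : ℝ) x with h1 | h1
    · rw [if_pos (h1.trans hxy), if_neg (by intro h; linarith [h.1]), hw1 n hn h1]
      linarith
    · rcases le_or_gt (n : ℝ) y with h2 | h2
      · rw [if_pos h2, if_pos ⟨h1, h2⟩]
        obtain ⟨k1, k2⟩ := hw2 n h1 h2
        have := hlow n h1 h2
        nlinarith
      · rw [if_neg (not_le.2 h2), if_neg (by intro h; linarith [h.2]), hw3 n h2]
        simp

/-- The trivial bound is `x (log x)^{2m}`: half of the logarithms are saved. -/
lemma exists_abs_sum_log_pow_le_of_large {m : ℕ} (hm : m ≠ 0) :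
    ∃ C : ℝ, 0 < C ∧ ∀ x : ℝ, 9 ≤ x →
      |∑ n ∈ Finset.Icc 0 ⌊x⌋₊, vonMangoldtSubOne n * Real.log n ^ (2 * m)| ≤
        C * (x * Real.log x ^ m) := by
  obtain ⟨C, hC, hS⟩ := exists_abs_smoothed_sum_le (2 * m)
  obtain ⟨D, hD, hL⟩ := exists_log_pow_le m one_pos
  refine ⟨4 * C + 2 ^ (2 * m) * (2 + D), by positivity, fun x hx => ?_⟩
  have hx0 : 0 < x := by linarith
  have hlog : 1 ≤ Real.log x := by
    rw [Real.le_log_iff_exp_le hx0]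
    exact Real.exp_one_lt_d9.le.trans (by linarith)
  -- unsmoothing over `[x, x e^h]` and `[x e^{-h}, x]` gives `S ≪ x / h + h x (log x)^{2m}`
  set h : ℝ := 1 / Real.log x ^ m with hh
  have hlm : 1 ≤ Real.log x ^ m := one_le_pow₀ hlog
  have hh0 : 0 < h := by positivity
  have hh1 : h ≤ 1 := by rw [hh, div_le_one (by linarith)]; exact hlm
  have hexp : Real.exp h ≤ 1 + 2 * h := by
    have := Real.abs_exp_sub_one_le (x := h) (by rwa [abs_of_pos hh0])
    rw [abs_of_pos hh0] at this
    linarith [le_abs_self (Real.exp h - 1)]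
  have hexp3 : Real.exp h ≤ 3 :=
    (Real.exp_le_exp.2 hh1).trans (Real.exp_one_lt_d9.le.trans (by norm_num))
  have hexp1 : 1 ≤ Real.exp h := Real.one_le_exp hh0.le
  have hexpn : 1 - h ≤ Real.exp (-h) := by linarith [Real.add_one_le_exp (-h)]
  have hexpn1 : Real.exp (-h) ≤ 1 := Real.exp_le_one_iff.2 (by linarith)
  have hexpn3 : 1 / 3 ≤ Real.exp (-h) := by
    rw [Real.exp_neg, one_div]
    exact inv_anti₀ (by positivity) hexp3
  set M := ⌊3 * x⌋₊ + 1 with hM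
  have hM3 : 3 * x < M := by rw [hM]; push_cast; exact Nat.lt_floor_add_one _
  have hb : ∀ z : ℝ, 3 ≤ z → z ≤ 3 * x → |∑ n ∈ Finset.range M, vonMangoldtSubOne n *
      Real.log n ^ (2 * m) * max (Real.log (z / n)) 0| ≤ C * z := fun z h1 h2 =>
    hS z M h1 (by linarith)
  have hup := (unsmooth (k := 2 * m) (by omega) (x := x) (y := x * Real.exp h) (M := M) (by linarith)
    (by nlinarith) (by nlinarith)).1
  have hlo := (unsmooth (k := 2 * m) (by omega) (x := x * Real.exp (-h)) (y := x) (M := M)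
    (by nlinarith) (by nlinarith) (by linarith)).2
  have e1 : Real.log (x * Real.exp h / x) = h := by
    rw [mul_div_cancel_left₀ _ hx0.ne', Real.log_exp]
  have e2 : Real.log (x / (x * Real.exp (-h))) = h := by
    rw [div_mul_cancel_left₀ hx0.ne', Real.log_inv, Real.log_exp, neg_neg]
  have e3 : Real.log (x * Real.exp h) = Real.log x + h := by
    rw [Real.log_mul hx0.ne' (Real.exp_pos _).ne', Real.log_exp]
  simp only [e1, e2, e3] at hup hlo
  have a1 := abs_le.1 (hb x (by linarith) (by linarith))
  have a2 := abs_le.1 (hb (x * Real.exp h) (by nlinarith) (by nlinarith))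
  have a3 := abs_le.1 (hb (x * Real.exp (-h)) (by nlinarith) (by nlinarith))
  generalize (∑ n ∈ Finset.Icc 0 ⌊x⌋₊, vonMangoldtSubOne n * Real.log n ^ (2 * m)) = S at *
  generalize (∑ n ∈ Finset.range M, vonMangoldtSubOne n * Real.log n ^ (2 * m) *
    max (Real.log (x / n)) 0) = H₁ at *
  generalize (∑ n ∈ Finset.range M, vonMangoldtSubOne n * Real.log n ^ (2 * m) *
    max (Real.log (x * Real.exp h / n)) 0) = H₂ at *
  generalize (∑ n ∈ Finset.range M, vonMangoldtSubOne n * Real.log n ^ (2 * m) *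
    max (Real.log (x * Real.exp (-h) / n)) 0) = H₃ at *
  clear hb hS
  have hCx : 0 < C * x := by positivity
  have hLk : (Real.log x + h) ^ (2 * m) ≤ 2 ^ (2 * m) * Real.log x ^ (2 * m) := by
    rw [← mul_pow]
    exact pow_le_pow_left₀ (by linarith) (by linarith) _
  have hLk2 : Real.log x ^ (2 * m) ≤ 2 ^ (2 * m) * Real.log x ^ (2 * m) :=
    le_mul_of_one_le_left (by positivity) (one_le_pow₀ (by norm_num))
  obtain ⟨Q, hQ⟩ : ∃ Q, Q = 2 ^ (2 * m) * Real.log x ^ (2 * m) := ⟨_, rfl⟩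
  rw [← hQ] at hLk hLk2
  have hQ0 : 0 ≤ Q := by rw [hQ]; positivity
  have hxe : x * Real.exp h ≤ x * (1 + 2 * h) := mul_le_mul_of_nonneg_left hexp hx0.le
  have hxe3 : C * (x * Real.exp h) ≤ C * (x * 3) := by gcongr
  have hxn : x * (1 - h) ≤ x * Real.exp (-h) := mul_le_mul_of_nonneg_left hexpn hx0.le
  have hxn1 : C * (x * Real.exp (-h)) ≤ C * (x * 1) := by gcongr
  have hhx : 0 < h * x := by positivity
  have b1 : h * S ≤ 4 * C * x + h * ((2 * h * x + 1) * Q) := by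
    have h1 : (x * Real.exp h - x + 1) * (Real.log x + h) ^ (2 * m) ≤ (2 * h * x + 1) * Q :=
      mul_le_mul (by linarith) hLk (by positivity) (by positivity)
    have h2 := mul_le_mul_of_nonneg_left h1 hh0.le
    linarith [a1.1, a2.2]
  have b2 : -(4 * C * x + h * ((2 * h * x + 1) * Q)) ≤ h * S := by
    have h1 : (x - x * Real.exp (-h) + 1) * Real.log x ^ (2 * m) ≤ (2 * h * x + 1) * Q :=
      mul_le_mul (by linarith) hLk2 (by positivity) (by positivity)
    have h2 := mul_le_mul_of_nonneg_left h1 hh0.le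
    linarith [a1.1, a3.2]
  have b3 : h * |S| ≤ 4 * C * x + h * ((2 * h * x + 1) * Q) := by
    rw [← abs_of_pos hh0, ← abs_mul, abs_of_pos hh0]
    exact abs_le.2 ⟨b2, b1⟩
  have hhl : h * Real.log x ^ m = 1 := by rw [hh]; field_simp
  clear_value h
  have hLx : Real.log x ^ m ≤ D * x := by simpa using hL x (by linarith)
  have hQe : Q = 2 ^ (2 * m) * (Real.log x ^ m * Real.log x ^ m) := by
    rw [hQ, two_mul m, pow_add (Real.log x)]
  have b4 : |S| = Real.log x ^ m * (h * |S|) := by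
    rw [← mul_assoc, mul_comm (Real.log x ^ m), hhl, one_mul]
  calc |S| ≤ Real.log x ^ m * (4 * C * x + h * ((2 * h * x + 1) * Q)) := by
        rw [b4]; gcongr
    _ = 4 * C * (x * Real.log x ^ m) + (h * Real.log x ^ m) * ((2 * h * x + 1) * Q) := by ring
    _ = 4 * C * (x * Real.log x ^ m) + 2 ^ (2 * m) *
        (2 * x * (h * Real.log x ^ m) * Real.log x ^ m + Real.log x ^ m * Real.log x ^ m) := by
        rw [hQe]
        linear_combination ((2 * h * x + 1) * (2 ^ (2 * m) * (Real.log x ^ m * Real.log x ^ m))) * hhl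
    _ ≤ 4 * C * (x * Real.log x ^ m) + 2 ^ (2 * m) *
        (2 * x * 1 * Real.log x ^ m + D * x * Real.log x ^ m) := by
        rw [hhl]; gcongr
    _ = _ := by ring

lemma norm_setIntegral_le_setIntegral {E : Type*} [NormedAddCommGroup E] [NormedSpace ℝ E]
    {f : ℝ → E} {g : ℝ → ℝ} {s : Set ℝ} (hs : MeasurableSet s)
    (hg : MeasureTheory.IntegrableOn g s) (h : ∀ t ∈ s, ‖f t‖ ≤ g t) :
    ‖∫ t in s, f t‖ ≤ ∫ t in s, g t :=
  MeasureTheory.norm_integral_le_of_norm_le hg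
    ((MeasureTheory.ae_restrict_iff' hs).2 (Filter.Eventually.of_forall h))

lemma exists_abs_sum_log_pow_le {m : ℕ} (hm : m ≠ 0) :
    ∃ C : ℝ, 0 < C ∧ ∀ x : ℝ, 2 ≤ x →
      |∑ n ∈ Finset.Icc 0 ⌊x⌋₊, vonMangoldtSubOne n * Real.log n ^ (2 * m)| ≤
        C * (x * Real.log x ^ m) := by
  obtain ⟨C, hC, h⟩ := exists_abs_sum_log_pow_le_of_large hm
  set K := ∑ n ∈ Finset.Icc 0 9, |vonMangoldtSubOne n * Real.log n ^ (2 * m)| with hK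
  have hK0 : 0 ≤ K := Finset.sum_nonneg fun _ _ => abs_nonneg _
  have hl2 : 0 < Real.log 2 := Real.log_pos (by norm_num)
  refine ⟨C + K / (2 * Real.log 2 ^ m), by positivity, fun x hx => ?_⟩
  have hlx : Real.log 2 ≤ Real.log x := Real.log_le_log (by norm_num) hx
  have hlx0 : 0 < Real.log x := by linarith
  rcases le_total 9 x with h9 | h9
  · refine (h x h9).trans ?_
    gcongr
    have : 0 ≤ K / (2 * Real.log 2 ^ m) := by positivity
    linarith
  · have h1 : |∑ n ∈ Finset.Icc 0 ⌊x⌋₊, vonMangoldtSubOne n * Real.log n ^ (2 * m)| ≤ K := by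
      refine (Finset.abs_sum_le_sum_abs _ _).trans ?_
      refine Finset.sum_le_sum_of_subset_of_nonneg ?_ fun _ _ _ => abs_nonneg _
      refine Finset.Icc_subset_Icc_right ?_
      calc ⌊x⌋₊ ≤ ⌊(9 : ℝ)⌋₊ := Nat.floor_mono h9
        _ = 9 := by simp
    have h2 : 2 * Real.log 2 ^ m ≤ x * Real.log x ^ m := by gcongr
    calc _ ≤ K := h1
      _ = K / (2 * Real.log 2 ^ m) * (2 * Real.log 2 ^ m) := by field_simp
      _ ≤ K / (2 * Real.log 2 ^ m) * (x * Real.log x ^ m) := by gcongr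
      _ ≤ _ := by
        gcongr
        linarith

lemma hasDerivAt_inv_log_pow (j : ℕ) {t : ℝ} (ht : 1 < t) :
    HasDerivAt (fun t => (Real.log t ^ j)⁻¹) (-(j / (t * Real.log t ^ (j + 1)))) t := by
  have hl : 0 < Real.log t := Real.log_pos ht
  have h0 : Real.log t ^ j ≠ 0 := (pow_pos hl j).ne'
  have ht0 : t ≠ 0 := by linarith
  have h := ((Real.hasDerivAt_log ht0).fun_pow j).fun_inv h0
  have e : -((j : ℝ) / (t * Real.log t ^ (j + 1))) =
      -(j * Real.log t ^ (j - 1) * t⁻¹) / (Real.log t ^ j) ^ 2 := by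
    rcases j with _ | j
    · simp
    · simp only [Nat.add_sub_cancel]
      field_simp
      ring
  rw [e]
  exact h

lemma integrableOn_rpow_Ioc {x : ℝ} (p : ℝ) :
    MeasureTheory.IntegrableOn (fun t : ℝ => t ^ p) (Set.Ioc 2 x) := by
  refine ContinuousOn.integrableOn_Icc (a := 2) (b := x) ?_ |>.mono_set Set.Ioc_subset_Icc_self
  exact fun t ht => (Real.continuousAt_rpow_const t p
    (Or.inl (by linarith [ht.1]))).continuousWithinAt

/-- Integrals of `(x / t)^p` over `(2, x]` with `p < 1` are `O(x)`. -/
lemma setIntegral_div_rpow_le {x p : ℝ} (hx : 2 ≤ x) (hp : p < 1) :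
    MeasureTheory.IntegrableOn (fun t : ℝ => (x / t) ^ p) (Set.Ioc 2 x) ∧
    ∫ t in Set.Ioc 2 x, (x / t) ^ p ≤ x / (1 - p) := by
  have hx0 : 0 < x := by linarith
  have e : ∀ t ∈ Set.Ioc 2 x, (x / t) ^ p = x ^ p * t ^ (-p) := by
    intro t ht
    have ht0 : 0 < t := by linarith [ht.1]
    rw [Real.div_rpow hx0.le ht0.le, Real.rpow_neg ht0.le]; rfl
  constructor
  · exact MeasureTheory.IntegrableOn.congr_fun ((integrableOn_rpow_Ioc (x := x) (-p)).const_mul (x ^ p))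
      (fun t ht => (e t ht).symm) measurableSet_Ioc
  · rw [MeasureTheory.setIntegral_congr_fun measurableSet_Ioc e, MeasureTheory.integral_const_mul,
      ← intervalIntegral.integral_of_le hx, integral_rpow (Or.inl (by linarith))]
    have h2 : (0 : ℝ) ≤ 2 ^ (-p + 1) := by positivity
    have e2 : x ^ p * x ^ (-p + 1) = x := by
      rw [← Real.rpow_add hx0]; simp
    have hxp : 0 < x ^ p := by positivity
    have h1p : 0 < 1 - p := by linarith
    rw [show -p + 1 = 1 - p by ring] at *
    rw [← mul_div_assoc]
    gcongr
    nlinarith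

/-- Partial summation removes the weight. It is not cancelled in the statement, as the terms with
`log n = 0` vanish here although `Λ(n) - 1` does not. -/
lemma exists_abs_sum_vonMangoldtSubOne_le {m : ℕ} (hm : m ≠ 0) :
    ∃ C : ℝ, 0 < C ∧ ∀ x : ℝ, 2 ≤ x →
      |∑ n ∈ Finset.Icc 0 ⌊x⌋₊, (Real.log n ^ (2 * m))⁻¹ *
        (vonMangoldtSubOne n * Real.log n ^ (2 * m))| ≤ C * (x / Real.log x ^ m) := by
  obtain ⟨C, hC, h⟩ := exists_abs_sum_log_pow_le hm
  obtain ⟨D, hD, hr⟩ := exists_log_pow_le_mul (m + 1) (δ := 1 / 2) (by norm_num)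
  have hl2 : 0 < Real.log 2 := Real.log_pos (by norm_num)
  refine ⟨C + 2 * m * C * D * 2 / Real.log 2, by positivity, fun x hx => ?_⟩
  have hlx : Real.log 2 ≤ Real.log x := Real.log_le_log (by norm_num) hx
  have hlx0 : 0 < Real.log x := by linarith
  have hx0 : 0 < x := by linarith
  set c : ℕ → ℝ := fun n => vonMangoldtSubOne n * Real.log n ^ (2 * m) with hc
  set f : ℝ → ℝ := fun t => (Real.log t ^ (2 * m))⁻¹ with hf
  have hder : ∀ t ∈ Set.Icc (2 : ℝ) x, HasDerivAt f
      (-((2 * m : ℕ) / (t * Real.log t ^ (2 * m + 1)))) t := fun t ht =>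
    hasDerivAt_inv_log_pow (2 * m) (by linarith [ht.1])
  have hcont : ContinuousOn (fun t : ℝ => -(((2 * m : ℕ) : ℝ) / (t * Real.log t ^ (2 * m + 1))))
      (Set.Icc 2 x) := by
    intro t ht
    have ht0 : t ≠ 0 := by linarith [ht.1]
    have hl : 0 < Real.log t := Real.log_pos (by linarith [ht.1])
    apply ContinuousAt.continuousWithinAt
    have h1 : ContinuousAt Real.log t := Real.continuousAt_log ht0
    exact (continuousAt_const.div (continuousAt_id.mul (h1.pow _))
      (mul_ne_zero ht0 (pow_pos hl _).ne')).neg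
  have habel := sum_mul_eq_sub_integral_mul₁ (𝕜 := ℝ) c (f := f) (by simp [hc, hm])
    (by simp [hc, hm]) x (fun t ht => (hder t ht).differentiableAt)
    (hcont.integrableOn_Icc.congr_fun (fun t ht => (hder t ht).deriv.symm) measurableSet_Icc)
  rw [habel]
  have hint : |∫ t in Set.Ioc 2 x, deriv f t * ∑ k ∈ Finset.Icc 0 ⌊t⌋₊, c k| ≤
      2 * m * C * D * 2 / Real.log 2 * (x / Real.log x ^ m) := by
    have hI := setIntegral_div_rpow_le hx (p := 1 / 2) (by norm_num)
    have hb : ∀ t ∈ Set.Ioc 2 x, ‖deriv f t * ∑ k ∈ Finset.Icc 0 ⌊t⌋₊, c k‖ ≤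
        2 * m * C * D / Real.log x ^ (m + 1) * (x / t) ^ (1 / 2 : ℝ) := by
      intro t ht
      have ht0 : 0 < t := by linarith [ht.1]
      have hl : 0 < Real.log t := Real.log_pos (by linarith [ht.1])
      rw [norm_mul, (hder t ⟨ht.1.le, ht.2⟩).deriv, norm_neg, Real.norm_eq_abs, Real.norm_eq_abs,
        abs_of_nonneg (by positivity)]
      have h1 := h t ht.1.le
      have h2 := hr t x ht.1.le ht.2
      calc _ ≤ (2 * m : ℕ) / (t * Real.log t ^ (2 * m + 1)) * (C * (t * Real.log t ^ m)) := by
            gcongr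
        _ = 2 * m * C * (1 / Real.log t ^ (m + 1)) := by
            push_cast
            field_simp
            ring
        _ ≤ 2 * m * C * (D * (x / t) ^ (1 / 2 : ℝ) / Real.log x ^ (m + 1)) := by
            refine mul_le_mul_of_nonneg_left ?_ (by positivity)
            rw [div_le_div_iff₀ (by positivity) (by positivity)]
            linarith
        _ = _ := by ring
    refine (norm_setIntegral_le_setIntegral measurableSet_Ioc (hI.1.const_mul _) hb).trans ?_
    rw [MeasureTheory.integral_const_mul]
    have hI2 : ∫ t in Set.Ioc 2 x, (x / t) ^ (1 / 2 : ℝ) ≤ 2 * x := hI.2.trans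
      (by rw [div_le_iff₀ (by norm_num)]; linarith)
    calc _ ≤ 2 * m * C * D / Real.log x ^ (m + 1) * (2 * x) := by gcongr
      _ = 2 * m * C * D * 2 / Real.log x * (x / Real.log x ^ m) := by
        rw [pow_succ]; field_simp
      _ ≤ _ := by gcongr
  calc _ ≤ |f x * ∑ k ∈ Finset.Icc 0 ⌊x⌋₊, c k| +
        |∫ t in Set.Ioc 2 x, deriv f t * ∑ k ∈ Finset.Icc 0 ⌊t⌋₊, c k| := abs_sub _ _
    _ ≤ C * (x / Real.log x ^ m) + 2 * m * C * D * 2 / Real.log 2 * (x / Real.log x ^ m) := by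
        gcongr
        rw [abs_mul, abs_of_nonneg (by positivity)]
        calc f x * |∑ k ∈ Finset.Icc 0 ⌊x⌋₊, c k| ≤
            (Real.log x ^ (2 * m))⁻¹ * (C * (x * Real.log x ^ m)) := by
              gcongr
              exact h x hx
          _ = _ := by rw [two_mul, pow_add]; field_simp
    _ = _ := by ring

/-- The **prime number theorem** with an error term saving an arbitrary power of `log x`. -/
theorem exists_abs_theta_sub_le (m : ℕ) :
    ∃ C : ℝ, 0 < C ∧ ∀ x : ℝ, 2 ≤ x → |Chebyshev.theta x - x| ≤ C * (x / Real.log x ^ m) := by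
  obtain ⟨C, hC, h⟩ := exists_abs_sum_vonMangoldtSubOne_le (m := m + 1) (by omega)
  obtain ⟨B, hB⟩ := Chebyshev.psi_sub_theta_le_mul_sqrt
  obtain ⟨D, hD, hl⟩ := exists_log_pow_le m (δ := 1 / 2) (by norm_num)
  have hl2 : 0 < Real.log 2 := Real.log_pos (by norm_num)
  refine ⟨C / Real.log 2 + (2 + |B|) * D, by positivity, fun x hx => ?_⟩
  have hlx : Real.log 2 ≤ Real.log x := Real.log_le_log (by norm_num) hx
  have hlx0 : 0 < Real.log x := by linarith
  have hx0 : 0 < x := by linarith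
  have hsq : Real.sqrt x ≤ D * (x / Real.log x ^ m) := by
    have h1 := hl x (by linarith)
    rw [← Real.sqrt_eq_rpow] at h1
    rw [← mul_div_assoc, le_div_iff₀ (by positivity)]
    have h2 := Real.mul_self_sqrt hx0.le
    nlinarith [Real.sqrt_nonneg x]
  have h1s : 1 ≤ Real.sqrt x := Real.one_le_sqrt.2 (by linarith)
  -- only `n ≥ 2` contributes to the sum, hence the shift by `1`
  have hpsi : |Chebyshev.psi x - ⌊x⌋₊ + 1| ≤ C / Real.log 2 * (x / Real.log x ^ m) := by
    have e : Chebyshev.psi x - ⌊x⌋₊ + 1 = ∑ n ∈ Finset.Icc 0 ⌊x⌋₊, (Real.log n ^ (2 * (m + 1)))⁻¹ *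
        (vonMangoldtSubOne n * Real.log n ^ (2 * (m + 1))) := by
      have e1 : ∀ n ∈ Finset.Icc 0 ⌊x⌋₊, (Real.log n ^ (2 * (m + 1)))⁻¹ *
          (vonMangoldtSubOne n * Real.log n ^ (2 * (m + 1))) =
          ArithmeticFunction.vonMangoldt n - (if 2 ≤ n then 1 else 0) := by
        intro n _
        rcases lt_or_ge n 2 with hn | hn
        · interval_cases n <;> simp
        · have : 0 < Real.log n := Real.log_pos (by exact_mod_cast hn)
          rw [if_pos hn, vonMangoldtSubOne]
          field_simp
      rw [Finset.sum_congr rfl e1, Finset.sum_sub_distrib, ← Chebyshev.psi_eq_sum_Icc,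
        ← Finset.sum_filter, Finset.sum_const, nsmul_one]
      have e2 : (Finset.Icc 0 ⌊x⌋₊).filter (fun n => 2 ≤ n) = Finset.Icc 2 ⌊x⌋₊ := by
        ext n; simp; omega
      have e3 : 1 ≤ ⌊x⌋₊ := Nat.le_floor (by push_cast; linarith)
      rw [e2, Nat.card_Icc, Nat.cast_sub (by omega)]
      push_cast; ring
    rw [e]
    refine (h x hx).trans ?_
    calc C * (x / Real.log x ^ (m + 1)) = C / Real.log x * (x / Real.log x ^ m) := by
          rw [pow_succ]; field_simp
      _ ≤ _ := by gcongr
  have h3 := hB x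
  have h4 := Chebyshev.theta_le_psi x
  have h5 := Nat.floor_le hx0.le
  have h6 := Nat.lt_floor_add_one x
  have h7 : B * Real.sqrt x ≤ |B| * Real.sqrt x := by gcongr; exact le_abs_self B
  have h8 : (2 + |B|) * Real.sqrt x ≤ (2 + |B|) * (D * (x / Real.log x ^ m)) := by gcongr
  have h9 := abs_le.1 hpsi
  have h10 : 0 ≤ |B| * Real.sqrt x := by positivity
  rw [abs_le]
  constructor <;> nlinarith [h9.1, h9.2]

/-! ### Sums over primes -/

/-- The primes `p ≤ y`, as the index set of `shortEulerProduct`. -/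
noncomputable def primesUpTo (y : ℝ) : Finset ℕ := (Finset.Icc 1 ⌊y⌋₊).filter Nat.Prime

lemma mem_primesUpTo {y : ℝ} {p : ℕ} : p ∈ primesUpTo y ↔ p ≤ ⌊y⌋₊ ∧ p.Prime := by
  rw [primesUpTo, Finset.mem_filter, Finset.mem_Icc]
  exact ⟨fun h => ⟨h.1.2, h.2⟩, fun h => ⟨⟨h.2.one_le, h.1⟩, h.2⟩⟩

/-- Partial summation over primes: the sum of `f(p) log p` against the integral of `f`. -/
lemma abs_sum_primesUpTo_sub_le {f f' B : ℝ → ℝ} {y : ℝ} (hy : 2 ≤ y)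
    (hf : ∀ u ∈ Set.Icc 2 y, HasDerivAt f (f' u) u) (hf' : ContinuousOn f' (Set.Icc 2 y))
    (hB : MeasureTheory.IntegrableOn B (Set.Ioc 2 y))
    (hfB : ∀ u ∈ Set.Ioc 2 y, |f' u| * |Chebyshev.theta u - u| ≤ B u) :
    |∑ p ∈ primesUpTo y, f p * Real.log p - ∫ u in Set.Ioc 2 y, f u| ≤
      2 * |f 2| + |f y| * |Chebyshev.theta y - y| + ∫ u in Set.Ioc 2 y, B u := by
  set c : ℕ → ℝ := fun n => if n.Prime then Real.log n else 0 with hc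
  have hθ : ∀ t : ℝ, ∑ n ∈ Finset.Icc 0 ⌊t⌋₊, c n = Chebyshev.theta t := by
    intro t
    rw [Chebyshev.theta_eq_sum_Icc, Finset.sum_filter]
  have hcongr : ∀ t ∈ Set.Icc 2 y, f' t = deriv f t := fun t ht => (hf t ht).deriv.symm
  have hint' : MeasureTheory.IntegrableOn f' (Set.Icc 2 y) := hf'.integrableOn_Icc
  have habel := sum_mul_eq_sub_integral_mul₁ (𝕜 := ℝ) c (f := f) (by simp [hc])
    (by simp [hc]) y (fun t ht => (hf t ht).differentiableAt)
    (hint'.congr_fun hcongr measurableSet_Icc)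
  simp only [hθ] at habel
  have hsum : ∑ p ∈ primesUpTo y, f p * Real.log p = ∑ k ∈ Finset.Icc 0 ⌊y⌋₊, f k * c k := by
    have : ∀ k ∈ Finset.Icc 0 ⌊y⌋₊, f k * c k = if k.Prime then f k * Real.log k else 0 := by
      intro k _
      simp only [hc]
      split_ifs <;> simp
    rw [Finset.sum_congr rfl this, ← Finset.sum_filter]
    refine Finset.sum_congr ?_ fun _ _ => rfl
    ext p
    rw [mem_primesUpTo, Finset.mem_filter, Finset.mem_Icc]
    simp
  have hI1 : ∫ t in Set.Ioc 2 y, deriv f t * Chebyshev.theta t =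
      ∫ t in Set.Ioc 2 y, f' t * Chebyshev.theta t :=
    MeasureTheory.setIntegral_congr_fun measurableSet_Ioc
      fun t ht => by simp only [hcongr t ⟨ht.1.le, ht.2⟩]
  have hθint : MeasureTheory.IntegrableOn (fun t => f' t * Chebyshev.theta t) (Set.Ioc 2 y) := by
    have := integrableOn_mul_sum_Icc (𝕜 := ℝ) c (m := 0) (a := 2) (b := y) (by norm_num) hint'
    simp only [hθ] at this
    exact this.mono_set Set.Ioc_subset_Icc_self
  have hidint : MeasureTheory.IntegrableOn (fun t => f' t * t) (Set.Ioc 2 y) :=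
    (hf'.mul continuousOn_id).integrableOn_Icc.mono_set Set.Ioc_subset_Icc_self
  -- integration by parts of the main term
  have hparts : ∫ t in Set.Ioc 2 y, f' t * t = f y * y - f 2 * 2 - ∫ t in Set.Ioc 2 y, f t := by
    rw [← intervalIntegral.integral_of_le hy, ← intervalIntegral.integral_of_le hy]
    have := intervalIntegral.integral_mul_deriv_eq_deriv_mul (a := 2) (b := y) (u := fun t : ℝ => t)
      (v := f) (u' := fun _ => 1) (v' := f')
      (fun t _ => hasDerivAt_id t) (fun t ht => hf t (by rwa [Set.uIcc_of_le hy] at ht))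
      intervalIntegrable_const (by
        rw [intervalIntegrable_iff_integrableOn_Icc_of_le hy]; exact hint')
    simp only [one_mul] at this
    rw [← mul_comm y, ← mul_comm 2, ← this]
    exact intervalIntegral.integral_congr fun t _ => by ring
  have hkey : ∑ p ∈ primesUpTo y, f p * Real.log p - ∫ u in Set.Ioc 2 y, f u =
      2 * f 2 + f y * (Chebyshev.theta y - y) -
        ∫ t in Set.Ioc 2 y, f' t * (Chebyshev.theta t - t) := by
    have e : ∫ t in Set.Ioc 2 y, f' t * (Chebyshev.theta t - t) =
        (∫ t in Set.Ioc 2 y, f' t * Chebyshev.theta t) - ∫ t in Set.Ioc 2 y, f' t * t := by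
      rw [← MeasureTheory.integral_sub hθint hidint]
      exact MeasureTheory.setIntegral_congr_fun measurableSet_Ioc fun t _ => by ring
    rw [hsum, habel, hI1, e, hparts]
    ring
  have hb := norm_setIntegral_le_setIntegral (f := fun t => f' t * (Chebyshev.theta t - t))
    measurableSet_Ioc hB (fun t ht => by
      rw [Real.norm_eq_abs, abs_mul]; exact hfB t ht)
  rw [hkey]
  rw [Real.norm_eq_abs] at hb
  calc _ ≤ |2 * f 2 + f y * (Chebyshev.theta y - y)| + |∫ t in Set.Ioc 2 y, f' t * (Chebyshev.theta t - t)| :=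
        abs_sub _ _
    _ ≤ |2 * f 2| + |f y * (Chebyshev.theta y - y)| + ∫ u in Set.Ioc 2 y, B u := by
        gcongr
        exact abs_add_le _ _
    _ = _ := by rw [abs_mul, abs_mul, abs_two]

lemma hasDerivAt_rpow_div_log (σ : ℝ) {u : ℝ} (hu : 2 ≤ u) :
    HasDerivAt (fun u => u ^ (-σ) / Real.log u)
      (-σ * u ^ (-σ - 1) / Real.log u - u ^ (-σ - 1) / Real.log u ^ 2) u := by
  have hu0 : 0 < u := by linarith
  have hl : 0 < Real.log u := Real.log_pos (by linarith)
  have h := (Real.hasDerivAt_rpow_const (p := -σ) (Or.inl hu0.ne')).fun_div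
    (Real.hasDerivAt_log hu0.ne') hl.ne'
  have e : u ^ (-σ) = u ^ (-σ - 1) * u := by
    rw [← Real.rpow_add_one hu0.ne']; ring_nf
  have e2 : -σ * u ^ (-σ - 1) / Real.log u - u ^ (-σ - 1) / Real.log u ^ 2 =
      (-σ * u ^ (-σ - 1) * Real.log u - u ^ (-σ) * u⁻¹) / Real.log u ^ 2 := by
    rw [e]
    field_simp
  rw [e2]
  exact h

/-- `∑_{p ≤ y} p^{-σ}` with the main term of the prime number theorem. Its constant matters: it is
compared with the constant `1 / 8` in the range of the parameters. -/
lemma exists_sum_primesUpTo_rpow_le {σ : ℝ} (h0 : 0 < σ) (h1 : σ < 1) :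
    ∃ C : ℝ, 0 < C ∧ ∀ y : ℝ, 2 ≤ y → ∑ p ∈ primesUpTo y, (p : ℝ) ^ (-σ) ≤
      y ^ (1 - σ) / ((1 - σ) * Real.log y) + C * (y ^ (1 - σ) / Real.log y ^ 2) := by
  set δ := (1 - σ) / 4 with hδ
  have hδ0 : 0 < δ := by rw [hδ]; linarith
  obtain ⟨A, hA, hθ⟩ := exists_abs_theta_sub_le 1
  obtain ⟨D, hD, hr⟩ := exists_log_pow_le_mul 2 hδ0
  obtain ⟨D₁, hD₁, hr₁⟩ := exists_log_pow_le_mul 1 hδ0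
  obtain ⟨F, hF, hl⟩ := exists_log_pow_le 2 (δ := 1 - σ) (by linarith)
  have hl2 : 0 < Real.log 2 := Real.log_pos (by norm_num)
  set g : ℝ := (2 : ℝ) ^ (-σ) / Real.log 2 with hg
  have hg0 : 0 < g := by positivity
  set G : ℝ := 1 + 1 / Real.log 2 with hG
  have hG0 : 0 < G := by positivity
  refine ⟨D₁ / δ * (1 / (1 - (σ + 2 * δ))) + 2 * g * F + A +
    G * A * D * (1 / (1 - (σ + δ))), ?_, fun y hy => ?_⟩
  · have : 0 < 1 - (σ + 2 * δ) := by rw [hδ]; linarith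
    have : 0 < 1 - (σ + δ) := by rw [hδ]; linarith
    positivity
  have hy0 : 0 < y := by linarith
  have hly : 0 < Real.log y := Real.log_pos (by linarith)
  have hI1 := setIntegral_div_rpow_le hy (p := σ + δ) (by rw [hδ]; linarith)
  have hI2 := setIntegral_div_rpow_le hy (p := σ + 2 * δ) (by rw [hδ]; linarith)
  have hI0 := setIntegral_div_rpow_le hy (p := σ) h1
  have epow : ∀ u : ℝ, 0 < u → u ^ (-σ) = y ^ (-σ) * (y / u) ^ σ := by
    intro u hu
    rw [Real.div_rpow hy0.le hu.le, Real.rpow_neg hy0.le, Real.rpow_neg hu.le]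
    field_simp
  have ey : y ^ (1 - σ) = y ^ (-σ) * y := by
    rw [← Real.rpow_add_one hy0.ne']; ring_nf
  have hyσ : 0 < y ^ (-σ) := by positivity
  have hmain := abs_sum_primesUpTo_sub_le (f := fun u => u ^ (-σ) / Real.log u)
    (f' := fun u => -σ * u ^ (-σ - 1) / Real.log u - u ^ (-σ - 1) / Real.log u ^ 2)
    (B := fun u => G * A * D * y ^ (-σ) / Real.log y ^ 2 * (y / u) ^ (σ + δ)) hy
    (fun u hu => hasDerivAt_rpow_div_log σ hu.1) ?_ (hI1.1.const_mul _) ?_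
  · have hsum : ∑ p ∈ primesUpTo y, ((p : ℝ) ^ (-σ) / Real.log p) * Real.log p =
        ∑ p ∈ primesUpTo y, (p : ℝ) ^ (-σ) := by
      refine Finset.sum_congr rfl fun p hp => ?_
      have : 0 < Real.log p := Real.log_pos (by exact_mod_cast (mem_primesUpTo.1 hp).2.one_lt)
      field_simp
    rw [hsum, MeasureTheory.integral_const_mul] at hmain
    have hint : ∫ u in Set.Ioc 2 y, u ^ (-σ) / Real.log u ≤ y ^ (-σ) / Real.log y * (y / (1 - σ)) +
        D₁ / δ * y ^ (-σ) / Real.log y ^ 2 * (y / (1 - (σ + 2 * δ))) := by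
      calc ∫ u in Set.Ioc 2 y, u ^ (-σ) / Real.log u ≤ ∫ u in Set.Ioc 2 y,
            (y ^ (-σ) / Real.log y * (y / u) ^ σ +
            D₁ / δ * y ^ (-σ) / Real.log y ^ 2 * (y / u) ^ (σ + 2 * δ)) := by
            refine MeasureTheory.setIntegral_mono_on ?_ ((hI0.1.const_mul _).add (hI2.1.const_mul _))
              measurableSet_Ioc (fun u hu => ?_)
            · refine ContinuousOn.integrableOn_Icc (a := 2) (b := y) ?_ |>.mono_set
                Set.Ioc_subset_Icc_self
              exact fun t ht =>
                (hasDerivAt_rpow_div_log σ ht.1).continuousAt.continuousWithinAt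
            · have hu0 : 0 < u := by linarith [hu.1]
              have hlu : 0 < Real.log u := Real.log_pos (by linarith [hu.1])
              have hyu : 0 < y / u := by positivity
              have h2 : Real.log (y / u) ≤ (y / u) ^ δ / δ := Real.log_le_rpow_div hyu.le hδ0
              have h3 := hr₁ u y hu.1.le hu.2
              rw [pow_one, pow_one] at h3
              have e2 : Real.log y = Real.log u + Real.log (y / u) := by
                rw [Real.log_div hy0.ne' hu0.ne']; ring
              have e3 : (y / u) ^ (σ + 2 * δ) = (y / u) ^ σ * ((y / u) ^ δ * (y / u) ^ δ) := by
                rw [← Real.rpow_add hyu, ← Real.rpow_add hyu]; congr 1; ring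
              rw [epow u hu0, e3]
              have h4 : 1 / Real.log u ≤ 1 / Real.log y +
                  D₁ / δ * ((y / u) ^ δ * (y / u) ^ δ) / Real.log y ^ 2 := by
                have h5 : 1 / Real.log u ≤ D₁ * (y / u) ^ δ / Real.log y := by
                  rw [div_le_div_iff₀ hlu hly]; linarith
                have h6 : 1 / Real.log u = 1 / Real.log y +
                    Real.log (y / u) * (1 / Real.log u) / Real.log y := by
                  field_simp; linarith
                refine h6.le.trans (add_le_add le_rfl ?_)
                calc Real.log (y / u) * (1 / Real.log u) / Real.log y
                    ≤ ((y / u) ^ δ / δ) * (D₁ * (y / u) ^ δ / Real.log y) / Real.log y := by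
                      gcongr
                  _ = _ := by field_simp
              have h7 : 0 ≤ y ^ (-σ) * (y / u) ^ σ := by positivity
              calc y ^ (-σ) * (y / u) ^ σ / Real.log u = y ^ (-σ) * (y / u) ^ σ * (1 / Real.log u) := by ring
                _ ≤ y ^ (-σ) * (y / u) ^ σ * (1 / Real.log y +
                  D₁ / δ * ((y / u) ^ δ * (y / u) ^ δ) / Real.log y ^ 2) := by gcongr
                _ = _ := by field_simp
        _ = y ^ (-σ) / Real.log y * (∫ u in Set.Ioc 2 y, (y / u) ^ σ) +
            D₁ / δ * y ^ (-σ) / Real.log y ^ 2 *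
              ∫ u in Set.Ioc 2 y, (y / u) ^ (σ + 2 * δ) := by
            rw [MeasureTheory.integral_add (hI0.1.const_mul _) (hI2.1.const_mul _),
              MeasureTheory.integral_const_mul, MeasureTheory.integral_const_mul]
        _ ≤ _ := by
            gcongr
            · exact hI0.2
            · exact hI2.2
    have h2 := (abs_le.1 hmain).2
    have hb1 : 2 * |g| ≤ 2 * g * F * (y ^ (1 - σ) / Real.log y ^ 2) := by
      rw [abs_of_pos hg0, mul_assoc]
      refine le_mul_of_one_le_right (by positivity) ?_
      rw [← mul_div_assoc, le_div_iff₀ (by positivity), one_mul]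
      exact hl y (by linarith)
    have hb2 : |y ^ (-σ) / Real.log y| * |Chebyshev.theta y - y| ≤ A * (y ^ (1 - σ) / Real.log y ^ 2) := by
      rw [abs_of_pos (by positivity)]
      calc _ ≤ y ^ (-σ) / Real.log y * (A * (y / Real.log y ^ 1)) := by gcongr; exact hθ y hy
        _ = _ := by rw [ey]; field_simp
    have hb3 : G * A * D * y ^ (-σ) / Real.log y ^ 2 * ∫ u in Set.Ioc 2 y, (y / u) ^ (σ + δ) ≤
        G * A * D * (1 / (1 - (σ + δ))) * (y ^ (1 - σ) / Real.log y ^ 2) := by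
      calc _ ≤ G * A * D * y ^ (-σ) / Real.log y ^ 2 * (y / (1 - (σ + δ))) := by
            gcongr; exact hI1.2
        _ = _ := by rw [ey]; ring
    have e5 : y ^ (-σ) / Real.log y * (y / (1 - σ)) = y ^ (1 - σ) / ((1 - σ) * Real.log y) := by
      rw [ey]; field_simp
    have e6 : D₁ / δ * y ^ (-σ) / Real.log y ^ 2 * (y / (1 - (σ + 2 * δ))) =
        D₁ / δ * (1 / (1 - (σ + 2 * δ))) * (y ^ (1 - σ) / Real.log y ^ 2) := by
      rw [ey]; ring
    rw [e5, e6] at hint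
    rw [add_mul, add_mul, add_mul]
    linarith
  · intro u hu
    have hu0 : u ≠ 0 := by linarith [hu.1]
    have hlu : 0 < Real.log u := Real.log_pos (by linarith [hu.1])
    apply ContinuousAt.continuousWithinAt
    have c1 : ContinuousAt Real.log u := Real.continuousAt_log hu0
    have c2 : ContinuousAt (fun u : ℝ => u ^ (-σ - 1)) u := Real.continuousAt_rpow_const _ _ (Or.inl hu0)
    exact ((continuousAt_const.mul c2).div c1 hlu.ne').sub (c2.div (c1.pow 2) (by positivity))
  · intro u hu
    have hu0 : 0 < u := by linarith [hu.1]
    have hlu2 : Real.log 2 ≤ Real.log u := Real.log_le_log (by norm_num) hu.1.le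
    have hlu : 0 < Real.log u := by linarith
    have h2 := hr u y hu.1.le hu.2
    have hyu : 0 < y / u := by positivity
    have eu : u ^ (-σ) = u ^ (-σ - 1) * u := by
      rw [← Real.rpow_add_one hu0.ne']; ring_nf
    have hd : |-σ * u ^ (-σ - 1) / Real.log u - u ^ (-σ - 1) / Real.log u ^ 2| ≤
        G * (u ^ (-σ - 1) / Real.log u) := by
      have hp : 0 < u ^ (-σ - 1) / Real.log u := by positivity
      have e7 : -σ * u ^ (-σ - 1) / Real.log u - u ^ (-σ - 1) / Real.log u ^ 2 =
          -((σ + 1 / Real.log u) * (u ^ (-σ - 1) / Real.log u)) := by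
        field_simp; ring
      rw [e7, abs_neg, abs_of_pos (by positivity), hG]
      gcongr
    calc _ ≤ G * (u ^ (-σ - 1) / Real.log u) * (A * (u / Real.log u ^ 1)) := by
          gcongr; exact hθ u hu.1.le
      _ = G * A * u ^ (-σ) * (1 / Real.log u ^ 2) := by rw [eu]; field_simp
      _ ≤ G * A * u ^ (-σ) * (D * (y / u) ^ δ / Real.log y ^ 2) := by
          refine mul_le_mul_of_nonneg_left ?_ (by positivity)
          rw [div_le_div_iff₀ (by positivity) (by positivity)]
          linarith
      _ = _ := by
          rw [epow u hu0, Real.rpow_add hyu]; ring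

/-! ### The function `log I₀` and its moments -/

/-- `∫₀¹ cos(2πθ) exp(t cos(2πθ)) dθ`, the derivative of `I₀`. -/
noncomputable def besselIOne (t : ℝ) : ℝ :=
  ∫ θ in (0 : ℝ)..1, Real.cos (2 * Real.pi * θ) * Real.exp (t * Real.cos (2 * Real.pi * θ))

lemma integral_cos_two_pi : ∫ θ in (0 : ℝ)..1, Real.cos (2 * Real.pi * θ) = 0 := by
  have := intervalIntegral.integral_comp_mul_left (a := 0) (b := 1) (fun x => Real.cos x)
    (c := 2 * Real.pi) (by positivity)
  rw [this]
  simp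

lemma integral_affine_cos (a b : ℝ) :
    ∫ θ in (0 : ℝ)..1, (a + b * Real.cos (2 * Real.pi * θ)) = a := by
  rw [intervalIntegral.integral_add (by simp) (Continuous.intervalIntegrable (by fun_prop) _ _),
    intervalIntegral.integral_const_mul, integral_cos_two_pi]
  simp

lemma one_le_besselIZero (t : ℝ) : 1 ≤ besselIZero t := by
  rw [← integral_affine_cos 1 t, besselIZero]
  refine intervalIntegral.integral_mono_on zero_le_one (Continuous.intervalIntegrable (by fun_prop) _ _)
    (Continuous.intervalIntegrable (by fun_prop) _ _) fun θ _ => ?_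
  linarith [Real.add_one_le_exp (t * Real.cos (2 * Real.pi * θ))]

lemma one_lt_besselIZero {t : ℝ} (ht : 0 < t) : 1 < besselIZero t := by
  rw [← integral_affine_cos 1 t, besselIZero]
  refine intervalIntegral.integral_lt_integral_of_continuousOn_of_le_of_exists_lt zero_lt_one
    (Continuous.continuousOn (by fun_prop)) (Continuous.continuousOn (by fun_prop)) (fun θ _ => ?_)
    ⟨0, by simp, ?_⟩
  · linarith [Real.add_one_le_exp (t * Real.cos (2 * Real.pi * θ))]
  · simp only [mul_zero, Real.cos_zero, mul_one]
    linarith [Real.add_one_lt_exp ht.ne']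

lemma besselIZero_le_exp {t : ℝ} (ht : 0 ≤ t) : besselIZero t ≤ Real.exp t := by
  have : ∫ _ in (0 : ℝ)..1, Real.exp t = Real.exp t := by simp
  rw [← this, besselIZero]
  refine intervalIntegral.integral_mono_on zero_le_one (Continuous.intervalIntegrable (by fun_prop) _ _)
    (by simp) fun θ _ => ?_
  exact Real.exp_le_exp.2 (mul_le_of_le_one_right ht (Real.cos_le_one _))

lemma besselIZero_le_one_add_sq {t : ℝ} (ht : 0 ≤ t) (ht1 : t ≤ 1) : besselIZero t ≤ 1 + t ^ 2 := by
  rw [← integral_affine_cos (1 + t ^ 2) t, besselIZero]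
  refine intervalIntegral.integral_mono_on zero_le_one (Continuous.intervalIntegrable (by fun_prop) _ _)
    (Continuous.intervalIntegrable (by fun_prop) _ _) fun θ _ => ?_
  set z := t * Real.cos (2 * Real.pi * θ)
  have hz : |z| ≤ t := by
    rw [abs_mul, abs_of_nonneg ht]
    exact mul_le_of_le_one_right ht (Real.abs_cos_le_one _)
  have h := Real.abs_exp_sub_one_sub_id_le (hz.trans ht1)
  have h2 : z ^ 2 ≤ t ^ 2 := by
    rw [← sq_abs z]
    exact pow_le_pow_left₀ (abs_nonneg _) hz 2
  linarith [(abs_le.1 h).2]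

lemma besselIOne_nonneg {t : ℝ} (ht : 0 ≤ t) : 0 ≤ besselIOne t := by
  rw [← integral_cos_two_pi, besselIOne]
  refine intervalIntegral.integral_mono_on zero_le_one (Continuous.intervalIntegrable (by fun_prop) _ _)
    (Continuous.intervalIntegrable (by fun_prop) _ _) fun θ _ => ?_
  set c := Real.cos (2 * Real.pi * θ)
  rcases le_total 0 c with hc | hc
  · exact le_mul_of_one_le_right hc (Real.one_le_exp (by positivity))
  · have : Real.exp (t * c) ≤ 1 := Real.exp_le_one_iff.2 (mul_nonpos_of_nonneg_of_nonpos ht hc)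
    nlinarith

lemma besselIOne_le_besselIZero (t : ℝ) : besselIOne t ≤ besselIZero t := by
  rw [besselIZero, besselIOne]
  refine intervalIntegral.integral_mono_on zero_le_one (Continuous.intervalIntegrable (by fun_prop) _ _)
    (Continuous.intervalIntegrable (by fun_prop) _ _) fun θ _ => ?_
  exact mul_le_of_le_one_left (Real.exp_pos _).le (Real.cos_le_one _)

/-- The mean of `cos` is zero, so `exp(t cos)` may be replaced by `exp(t cos) - 1`. -/
lemma besselIOne_le_mul_besselIZero {t : ℝ} (ht : 0 ≤ t) : besselIOne t ≤ 2 * t * besselIZero t := by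
  have h1 : besselIOne t ≤ ∫ θ in (0 : ℝ)..1, (Real.cos (2 * Real.pi * θ) +
      t * (Real.exp (t * Real.cos (2 * Real.pi * θ)) + 1)) := by
    rw [besselIOne]
    refine intervalIntegral.integral_mono_on zero_le_one (Continuous.intervalIntegrable (by fun_prop) _ _)
      (Continuous.intervalIntegrable (by fun_prop) _ _) fun θ _ => ?_
    have hc1 := Real.cos_le_one (2 * Real.pi * θ)
    have hc2 := Real.neg_one_le_cos (2 * Real.pi * θ)
    set c := Real.cos (2 * Real.pi * θ)
    have he := Real.exp_pos (t * c)
    have hcc : c ^ 2 ≤ 1 := by nlinarith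
    rcases le_total 0 c with hc | hc
    · have h := Real.add_one_le_exp (-(t * c))
      rw [Real.exp_neg] at h
      -- `e^z - 1 ≤ z e^z`
      have h2 : Real.exp (t * c) - 1 ≤ t * c * Real.exp (t * c) := by
        have := mul_le_mul_of_nonneg_right h he.le
        rw [inv_mul_cancel₀ he.ne'] at this
        linarith
      have h3 := mul_le_mul_of_nonneg_left h2 hc
      have h4 : c ^ 2 * (t * Real.exp (t * c)) ≤ 1 * (t * Real.exp (t * c)) := by gcongr
      nlinarith
    · have h := Real.add_one_le_exp (t * c)
      have h3 : c * (Real.exp (t * c) - 1) ≤ c * (t * c) :=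
        mul_le_mul_of_nonpos_left (by linarith) hc
      have h4 : c ^ 2 * t ≤ 1 * t := by gcongr
      have : 0 ≤ t * Real.exp (t * c) := by positivity
      nlinarith
  rw [intervalIntegral.integral_add (Continuous.intervalIntegrable (by fun_prop) _ _)
    (Continuous.intervalIntegrable (by fun_prop) _ _), integral_cos_two_pi,
    intervalIntegral.integral_const_mul, intervalIntegral.integral_add
    (Continuous.intervalIntegrable (by fun_prop) _ _) (by simp), ← besselIZero] at h1
  simp only [intervalIntegral.integral_const, sub_zero, smul_eq_mul, mul_one, zero_add] at h1
  nlinarith [one_le_besselIZero t]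

lemma hasDerivAt_besselIZero (t : ℝ) : HasDerivAt besselIZero (besselIOne t) t := by
  have h := intervalIntegral.hasDerivAt_integral_of_dominated_loc_of_deriv_le (μ := MeasureTheory.volume)
    (a := 0) (b := 1) (s := Metric.ball t 1) (x₀ := t)
    (F := fun t θ => Real.exp (t * Real.cos (2 * Real.pi * θ)))
    (F' := fun t θ => Real.cos (2 * Real.pi * θ) * Real.exp (t * Real.cos (2 * Real.pi * θ)))
    (bound := fun _ => Real.exp (|t| + 1)) (Metric.ball_mem_nhds t one_pos)
    (Filter.Eventually.of_forall fun x => Continuous.aestronglyMeasurable (by fun_prop))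
    (Continuous.intervalIntegrable (by fun_prop) _ _)
    (Continuous.aestronglyMeasurable (by fun_prop))
    (Filter.Eventually.of_forall fun θ _ x hx => ?_) (by simp)
    (Filter.Eventually.of_forall fun θ _ x hx => ?_)
  · exact h.2
  · rw [norm_mul, Real.norm_eq_abs, Real.norm_eq_abs, Real.abs_exp]
    have h1 : |x| ≤ |t| + 1 := by
      rw [Metric.mem_ball, Real.dist_eq] at hx
      linarith [abs_sub_abs_le_abs_sub x t]
    have h2 : x * Real.cos (2 * Real.pi * θ) ≤ |t| + 1 := by
      refine (le_abs_self _).trans ?_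
      rw [abs_mul]
      exact (mul_le_of_le_one_right (abs_nonneg _) (Real.abs_cos_le_one _)).trans h1
    exact (mul_le_of_le_one_left (Real.exp_pos _).le (Real.abs_cos_le_one _)).trans
      (Real.exp_le_exp.2 h2)
  · have := ((hasDerivAt_id x).mul_const (Real.cos (2 * Real.pi * θ))).exp
    simp only [id, one_mul] at this
    rw [mul_comm (Real.cos _)]
    exact this

lemma continuous_besselIZero : Continuous besselIZero :=
  continuous_iff_continuousAt.2 fun t => (hasDerivAt_besselIZero t).continuousAt

lemma continuous_besselIOne : Continuous besselIOne := by
  unfold besselIOne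
  exact intervalIntegral.continuous_parametric_intervalIntegral_of_continuous' (by fun_prop) 0 1

/-- The function `log I₀`. -/
noncomputable def logBessel (t : ℝ) : ℝ := Real.log (besselIZero t)

/-- The derivative `I₁ / I₀` of `log I₀`. -/
noncomputable def logBesselDeriv (t : ℝ) : ℝ := besselIOne t / besselIZero t

lemma besselIZero_pos (t : ℝ) : 0 < besselIZero t := one_pos.trans_le (one_le_besselIZero t)

lemma continuous_logBessel : Continuous logBessel :=
  continuous_besselIZero.log fun t => (besselIZero_pos t).ne'

lemma continuous_logBesselDeriv : Continuous logBesselDeriv :=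
  continuous_besselIOne.div continuous_besselIZero fun t => (besselIZero_pos t).ne'

lemma hasDerivAt_logBessel (t : ℝ) : HasDerivAt logBessel (logBesselDeriv t) t :=
  (hasDerivAt_besselIZero t).log (besselIZero_pos t).ne'

lemma logBessel_nonneg (t : ℝ) : 0 ≤ logBessel t := Real.log_nonneg (one_le_besselIZero t)

lemma logBessel_pos {t : ℝ} (ht : 0 < t) : 0 < logBessel t := Real.log_pos (one_lt_besselIZero ht)

lemma logBessel_le_self {t : ℝ} (ht : 0 ≤ t) : logBessel t ≤ t := by
  rw [logBessel, Real.log_le_iff_le_exp (besselIZero_pos t)]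
  exact besselIZero_le_exp ht

lemma logBessel_le_sq {t : ℝ} (ht : 0 ≤ t) : logBessel t ≤ t ^ 2 := by
  rcases le_total t 1 with h | h
  · have := Real.log_le_sub_one_of_pos (besselIZero_pos t)
    rw [logBessel]
    linarith [besselIZero_le_one_add_sq ht h]
  · exact (logBessel_le_self ht).trans (by nlinarith)

lemma logBesselDeriv_nonneg {t : ℝ} (ht : 0 ≤ t) : 0 ≤ logBesselDeriv t :=
  div_nonneg (besselIOne_nonneg ht) (besselIZero_pos t).le

lemma logBesselDeriv_le_one (t : ℝ) : logBesselDeriv t ≤ 1 :=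
  div_le_one_of_le₀ (besselIOne_le_besselIZero t) (besselIZero_pos t).le

lemma logBesselDeriv_le {t : ℝ} (ht : 0 ≤ t) : logBesselDeriv t ≤ 2 * t := by
  rw [logBesselDeriv, div_le_iff₀ (besselIZero_pos t)]
  exact besselIOne_le_mul_besselIZero ht

/-- The weight `|log t|^m t^{-1/σ-1} log I₀(t)`. -/
noncomputable def absMomentIntegrand (σ : ℝ) (m : ℕ) (t : ℝ) : ℝ :=
  |Real.log t| ^ m * t ^ (-(1 / σ) - 1) * logBessel t

lemma continuousOn_absMomentIntegrand (σ : ℝ) (m : ℕ) :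
    ContinuousOn (absMomentIntegrand σ m) (Set.Ioi 0) := by
  intro t ht
  have ht0 : t ≠ 0 := ne_of_gt ht
  apply ContinuousAt.continuousWithinAt
  exact (((Real.continuousAt_log ht0).abs.pow m).mul
    (Real.continuousAt_rpow_const _ _ (Or.inl ht0))).mul continuous_logBessel.continuousAt

/-- As `1 < 1/σ < 2`, the bound `log I₀(t) ≤ t²` gives convergence at `0`, and `log I₀(t) ≤ t`
gives it at `∞`. -/
lemma integrableOn_absMomentIntegrand {σ : ℝ} (hσ : 1 / 2 < σ) (hσ' : σ < 1) (m : ℕ) :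
    MeasureTheory.IntegrableOn (absMomentIntegrand σ m) (Set.Ioi 0) := by
  have hσ0 : 0 < σ := by linarith
  have h1σ : 1 < 1 / σ := by rwa [lt_div_iff₀ hσ0, one_mul]
  have h2σ : 1 / σ < 2 := by rw [div_lt_iff₀ hσ0]; linarith
  have hmeas : ∀ s ⊆ Set.Ioi (0 : ℝ), MeasurableSet s →
      MeasureTheory.AEStronglyMeasurable (absMomentIntegrand σ m) (MeasureTheory.volume.restrict s) :=
    fun s hs hsm => ((continuousOn_absMomentIntegrand σ m).mono hs).aestronglyMeasurable hsm
  rw [← Set.Ioc_union_Ioi_eq_Ioi (zero_le_one' ℝ)]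
  refine MeasureTheory.IntegrableOn.union ?_ ?_
  · set δ := (2 - 1 / σ) / 2 with hδ
    have hδ0 : 0 < δ := by rw [hδ]; linarith
    obtain ⟨C, hC, h⟩ := exists_log_pow_le m hδ0
    have hi : MeasureTheory.IntegrableOn (fun t : ℝ => C * t ^ (1 - 1 / σ - δ)) (Set.Ioc 0 1) := by
      refine MeasureTheory.Integrable.const_mul ?_ C
      have := intervalIntegral.intervalIntegrable_rpow' (a := 0) (b := 1) (r := 1 - 1 / σ - δ)
        (by rw [hδ]; linarith)
      rwa [intervalIntegrable_iff_integrableOn_Ioc_of_le zero_le_one] at this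
    refine MeasureTheory.Integrable.mono' hi (hmeas _ (fun t ht => ht.1) measurableSet_Ioc)
      ((MeasureTheory.ae_restrict_iff' measurableSet_Ioc).2 (Filter.Eventually.of_forall fun t ht => ?_))
    have ht0 : 0 < t := ht.1
    have hL := logBessel_nonneg t
    have h1 := h (1 / t) (by rw [le_div_iff₀ ht0, one_mul]; exact ht.2)
    have h2 : |Real.log t| = Real.log (1 / t) := by
      rw [one_div, Real.log_inv, abs_of_nonpos (Real.log_nonpos ht0.le ht.2)]
    rw [absMomentIntegrand, Real.norm_eq_abs, abs_of_nonneg (by positivity), h2]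
    have e1 : (1 / t) ^ δ = t ^ (-δ) := by
      rw [one_div, Real.inv_rpow ht0.le, Real.rpow_neg ht0.le]
    have e2 : t ^ (1 - 1 / σ - δ) = t ^ (-δ) * t ^ (-(1 / σ) - 1) * t ^ 2 := by
      rw [← Real.rpow_natCast t 2, ← Real.rpow_add ht0, ← Real.rpow_add ht0]
      congr 1; push_cast; ring
    rw [e2, ← mul_assoc, ← mul_assoc]
    rw [e1] at h1
    gcongr
    exact logBessel_le_sq ht0.le
  · set δ := (1 / σ - 1) / 2 with hδ
    have hδ0 : 0 < δ := by rw [hδ]; linarith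
    obtain ⟨C, hC, h⟩ := exists_log_pow_le m hδ0
    have hi : MeasureTheory.IntegrableOn (fun t : ℝ => C * t ^ (-(1 / σ) + δ)) (Set.Ioi 1) :=
      (integrableOn_Ioi_rpow_of_lt (by rw [hδ]; linarith) one_pos).const_mul C
    refine MeasureTheory.Integrable.mono' hi
      (hmeas _ (fun t (ht : 1 < t) => lt_trans one_pos ht) measurableSet_Ioi)
      ((MeasureTheory.ae_restrict_iff' measurableSet_Ioi).2 (Filter.Eventually.of_forall fun t ht => ?_))
    have ht1 : 1 < t := ht
    have ht0 : 0 < t := by linarith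
    have hL := logBessel_nonneg t
    have h1 := h t ht1.le
    have h2 : |Real.log t| = Real.log t := abs_of_pos (Real.log_pos ht1)
    rw [absMomentIntegrand, Real.norm_eq_abs, abs_of_nonneg (by positivity), h2]
    have e2 : t ^ (-(1 / σ) + δ) = t ^ δ * t ^ (-(1 / σ) - 1) * t := by
      rw [← Real.rpow_add ht0, ← Real.rpow_add_one ht0.ne']
      congr 1; ring
    rw [e2, ← mul_assoc, ← mul_assoc]
    gcongr
    exact logBessel_le_self ht0.le

lemma momentCoeffIntegrand_eq {σ : ℝ} {n : ℕ} {t : ℝ} (ht : 0 < t) :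
    momentCoeffIntegrand σ n t = Real.log t ^ n * t ^ (-(1 / σ) - 1) * logBessel t := by
  rw [momentCoeffIntegrand, logBessel, show -(1 / σ) - 1 = -(1 / σ + 1) by ring, Real.rpow_neg ht.le]
  rfl

lemma abs_momentCoeffIntegrand {σ : ℝ} {n : ℕ} {t : ℝ} (ht : 0 < t) :
    |momentCoeffIntegrand σ n t| = absMomentIntegrand σ n t := by
  have h : 0 ≤ t ^ (-(1 / σ) - 1) := by positivity
  rw [momentCoeffIntegrand_eq ht, absMomentIntegrand, abs_mul, abs_mul, abs_pow,
    abs_of_nonneg h, abs_of_nonneg (logBessel_nonneg t)]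

lemma integrableOn_momentCoeffIntegrand {σ : ℝ} (hσ : 1 / 2 < σ) (hσ' : σ < 1) (n : ℕ) :
    MeasureTheory.IntegrableOn (momentCoeffIntegrand σ n) (Set.Ioi 0) := by
  refine MeasureTheory.Integrable.mono' (integrableOn_absMomentIntegrand hσ hσ' n) ?_
    ((MeasureTheory.ae_restrict_iff' measurableSet_Ioi).2 (Filter.Eventually.of_forall fun t ht =>
      (abs_momentCoeffIntegrand ht).le))
  refine ContinuousOn.aestronglyMeasurable (fun t ht => ?_) measurableSet_Ioi
  have ht0 : t ≠ 0 := ne_of_gt ht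
  have h1 : ContinuousWithinAt
      (fun t => Real.log t ^ n * t ^ (-(1 / σ) - 1) * logBessel t) (Set.Ioi 0) t :=
    ((((Real.continuousAt_log ht0).pow n).mul
      (Real.continuousAt_rpow_const _ _ (Or.inl ht0))).mul
      continuous_logBessel.continuousAt).continuousWithinAt
  exact h1.congr (fun u hu => momentCoeffIntegrand_eq hu) (momentCoeffIntegrand_eq ht)

lemma momentCoeff_zero_pos {σ : ℝ} (hσ : 1 / 2 < σ) (hσ' : σ < 1) : 0 < momentCoeff σ 0 := by
  have hpos : ∀ t ∈ Set.Ioi (0 : ℝ), 0 < momentCoeffIntegrand σ 0 t := by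
    intro t ht
    rw [momentCoeffIntegrand_eq ht, pow_zero, one_mul]
    exact mul_pos (Real.rpow_pos_of_pos ht _) (logBessel_pos ht)
  rw [momentCoeff, MeasureTheory.setIntegral_pos_iff_support_of_nonneg_ae
    ((MeasureTheory.ae_restrict_iff' measurableSet_Ioi).2
      (Filter.Eventually.of_forall fun t ht => (hpos t ht).le))
    (integrableOn_momentCoeffIntegrand hσ hσ' 0)]
  have : Function.support (momentCoeffIntegrand σ 0) ∩ Set.Ioi 0 = Set.Ioi 0 :=
    Set.inter_eq_right.2 fun t ht => (hpos t ht).ne'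
  rw [this]
  simp

/-! ### The prime number theorem for `∑ log I₀(k p^{-σ})` -/

/-- The majorant `(x/u)^a` for `u ≤ x` and `(x/u)^b` for `u > x`. With `a < 1 < b` its integral is
`O(x)`. -/
noncomputable def splitPow (x a b u : ℝ) : ℝ := if u ≤ x then (x / u) ^ a else (x / u) ^ b

lemma setIntegral_Ioi_div_rpow {x y b : ℝ} (hx : 0 < x) (hy : 0 < y) (hb : 1 < b) :
    MeasureTheory.IntegrableOn (fun u : ℝ => (x / u) ^ b) (Set.Ioi y) ∧
    ∫ u in Set.Ioi y, (x / u) ^ b = x * (x / y) ^ (b - 1) / (b - 1) := by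
  have e : ∀ t ∈ Set.Ioi y, (x / t) ^ b = x ^ b * t ^ (-b) := by
    intro t ht
    have ht0 : 0 < t := hy.trans ht
    rw [Real.div_rpow hx.le ht0.le, Real.rpow_neg ht0.le]; rfl
  constructor
  · exact MeasureTheory.IntegrableOn.congr_fun
      ((integrableOn_Ioi_rpow_of_lt (a := -b) (by linarith) hy).const_mul (x ^ b))
      (fun t ht => (e t ht).symm) measurableSet_Ioi
  · rw [MeasureTheory.setIntegral_congr_fun measurableSet_Ioi e, MeasureTheory.integral_const_mul,
      integral_Ioi_rpow_of_lt (by linarith) hy, Real.div_rpow hx.le hy.le,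
      show -b + 1 = -(b - 1) by ring, Real.rpow_neg hy.le]
    have e2 : x ^ b = x ^ (b - 1) * x := by rw [← Real.rpow_add_one hx.ne']; ring_nf
    have hb1 : b - 1 ≠ 0 := by linarith
    rw [e2]
    field_simp

lemma splitPow_nonneg {x u : ℝ} (hx : 0 ≤ x) (hu : 0 ≤ u) (a b : ℝ) : 0 ≤ splitPow x a b u := by
  rw [splitPow]; split_ifs <;> positivity

lemma setIntegral_splitPow_le {x a b : ℝ} (hx : 2 ≤ x) (ha : a < 1) (hb : 1 < b) :
    MeasureTheory.IntegrableOn (splitPow x a b) (Set.Ioi 2) ∧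
    ∫ u in Set.Ioi 2, splitPow x a b u ≤ x * (1 / (1 - a) + 1 / (b - 1)) := by
  have hx0 : 0 < x := by linarith
  have h1 := setIntegral_div_rpow_le hx ha
  have h2 := setIntegral_Ioi_div_rpow (y := x) hx0 hx0 hb
  have e1 : ∀ u ∈ Set.Ioc 2 x, splitPow x a b u = (x / u) ^ a := fun u hu => if_pos hu.2
  have e2 : ∀ u ∈ Set.Ioi x, splitPow x a b u = (x / u) ^ b := fun u hu => if_neg (not_le.2 hu)
  have i1 : MeasureTheory.IntegrableOn (splitPow x a b) (Set.Ioc 2 x) :=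
    h1.1.congr_fun (fun u hu => (e1 u hu).symm) measurableSet_Ioc
  have i2 : MeasureTheory.IntegrableOn (splitPow x a b) (Set.Ioi x) :=
    h2.1.congr_fun (fun u hu => (e2 u hu).symm) measurableSet_Ioi
  rw [← Set.Ioc_union_Ioi_eq_Ioi hx]
  refine ⟨i1.union i2, ?_⟩
  rw [MeasureTheory.setIntegral_union Set.Ioc_disjoint_Ioi_same measurableSet_Ioi i1 i2,
    MeasureTheory.setIntegral_congr_fun measurableSet_Ioc e1,
    MeasureTheory.setIntegral_congr_fun measurableSet_Ioi e2, h2.2, div_self hx0.ne', Real.one_rpow]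
  calc _ ≤ x / (1 - a) + x * 1 / (b - 1) := add_le_add h1.2 le_rfl
    _ = _ := by ring

/-- The transition in `log I₀(k u^{-σ})` is at `u = k^{1/σ}`. -/
lemma mul_rpow_neg_eq {σ k u : ℝ} (hσ : 0 < σ) (hk : 0 < k) (hu : 0 < u) :
    k * u ^ (-σ) = (k ^ (1 / σ) / u) ^ σ := by
  rw [Real.div_rpow (by positivity) hu.le, ← Real.rpow_mul hk.le, one_div_mul_cancel hσ.ne',
    Real.rpow_one, Real.rpow_neg hu.le]
  rfl

/-- `min(t, t²)` at `t = (x/u)^σ`, in the form of the majorant `splitPow`. -/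
lemma min_le_splitPow {σ x u t : ℝ} (hx : 0 < x) (hu : 0 < u) (ht : t = (x / u) ^ σ) {z : ℝ}
    (h1 : z ≤ t) (h2 : z ≤ t ^ 2) : z ≤ splitPow x σ (2 * σ) u := by
  rw [splitPow]
  split_ifs
  · rwa [← ht]
  · rw [mul_comm, Real.rpow_mul (by positivity), ← ht]
    simpa using h2

/-- A power of `1 / log u` may be replaced by the same power of `1 / log x`, at the cost of raising
the exponent in the range `u ≤ x` by `δ`. -/
lemma splitPow_div_log_pow_le {x u D δ a b : ℝ} {M : ℕ} (hx : 2 ≤ x) (hu : 2 ≤ u) (hD1 : 1 ≤ D)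
    (hD : u ≤ x → Real.log x ^ M ≤ D * (x / u) ^ δ * Real.log u ^ M) :
    splitPow x a b u / Real.log u ^ M ≤ D / Real.log x ^ M * splitPow x (a + δ) b u := by
  have hlx : 0 < Real.log x := Real.log_pos (by linarith)
  have hlu : 0 < Real.log u := Real.log_pos (by linarith)
  have hxu : 0 < x / u := by apply div_pos <;> linarith
  rw [splitPow, splitPow]
  split_ifs with h
  · have h1 : 1 / Real.log u ^ M ≤ D * (x / u) ^ δ / Real.log x ^ M := by
      rw [div_le_div_iff₀ (by positivity) (by positivity)]
      linarith [hD h]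
    calc (x / u) ^ a / Real.log u ^ M = (x / u) ^ a * (1 / Real.log u ^ M) := by ring
      _ ≤ (x / u) ^ a * (D * (x / u) ^ δ / Real.log x ^ M) := by gcongr
      _ = _ := by rw [Real.rpow_add hxu]; ring
  · have h2 : x ≤ u := (not_le.1 h).le
    have h3 : Real.log x ≤ Real.log u := Real.log_le_log (by linarith) h2
    calc (x / u) ^ b / Real.log u ^ M ≤ (x / u) ^ b / Real.log x ^ M := by gcongr
      _ = 1 / Real.log x ^ M * (x / u) ^ b := by ring
      _ ≤ _ := by gcongr

lemma hasDerivAt_logBessel_div_log (σ k : ℝ) {u : ℝ} (hu : 2 ≤ u) :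
    HasDerivAt (fun u => logBessel (k * u ^ (-σ)) / Real.log u)
      (logBesselDeriv (k * u ^ (-σ)) * (k * (-σ * u ^ (-σ - 1))) / Real.log u -
        logBessel (k * u ^ (-σ)) / (u * Real.log u ^ 2)) u := by
  have hu0 : 0 < u := by linarith
  have hl : 0 < Real.log u := Real.log_pos (by linarith)
  have h0 := (Real.hasDerivAt_rpow_const (p := -σ) (Or.inl hu0.ne')).const_mul k
  have h := ((hasDerivAt_logBessel (k * u ^ (-σ))).comp u h0).fun_div
    (Real.hasDerivAt_log hu0.ne') hl.ne'
  have e : logBesselDeriv (k * u ^ (-σ)) * (k * (-σ * u ^ (-σ - 1))) / Real.log u -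
        logBessel (k * u ^ (-σ)) / (u * Real.log u ^ 2) =
      (logBesselDeriv (k * u ^ (-σ)) * (k * (-σ * u ^ (-σ - 1))) * Real.log u -
        logBessel (k * u ^ (-σ)) * u⁻¹) / Real.log u ^ 2 := by
    field_simp
  rw [e]
  exact h

/-- The prime number theorem applied to `∑_p log I₀(k p^{-σ})`. -/
lemma exists_abs_sum_logBessel_sub_integral_le {σ : ℝ} (hσ : 1 / 2 < σ) (hσ' : σ < 1) (M : ℕ) :
    ∃ C : ℝ, 0 < C ∧ ∀ k y : ℝ, 2 ≤ k → k ^ (1 / σ) ≤ y →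
      |∑ p ∈ primesUpTo y, logBessel (k * (p : ℝ) ^ (-σ)) -
        ∫ u in Set.Ioc 2 y, logBessel (k * u ^ (-σ)) / Real.log u| ≤
      C * (k ^ (1 / σ) / Real.log (k ^ (1 / σ)) ^ M) := by
  have hσ0 : 0 < σ := by linarith
  have h1σ : 1 < 1 / σ := by rwa [lt_div_iff₀ hσ0, one_mul]
  set δ := (1 - σ) / 2 with hδ
  have hδ0 : 0 < δ := by rw [hδ]; linarith
  obtain ⟨A, hA, hθ⟩ := exists_abs_theta_sub_le M
  obtain ⟨D₀, hD₀, hr₀⟩ := exists_log_pow_le_mul M hδ0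
  set D := max D₀ 1 with hDdef
  have hD1 : 1 ≤ D := le_max_right _ _
  obtain ⟨F, hF, hl⟩ := exists_log_pow_le M (δ := 1 - σ) (by linarith)
  have hl2 : 0 < Real.log 2 := Real.log_pos (by norm_num)
  set G : ℝ := 2 / Real.log 2 + 1 / Real.log 2 ^ 2 with hG
  have hG0 : 0 < G := by positivity
  set W : ℝ := 1 / (1 - (σ + δ)) + 1 / (2 * σ - 1) with hW
  have hW0 : 0 < W := by
    have : 0 < 1 - (σ + δ) := by rw [hδ]; linarith
    have : 0 < 2 * σ - 1 := by linarith
    positivity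
  refine ⟨2 / Real.log 2 * F + A / Real.log 2 + G * A * D * W, by positivity, fun k y hk hxy => ?_⟩
  set x := k ^ (1 / σ) with hx
  have hk0 : 0 < k := by linarith
  have hkx : k ≤ x := by
    calc k = k ^ (1 : ℝ) := (Real.rpow_one k).symm
      _ ≤ k ^ (1 / σ) := Real.rpow_le_rpow_of_exponent_le (by linarith) h1σ.le
  have hx2 : 2 ≤ x := by linarith
  have hx0 : 0 < x := by linarith
  have hy2 : 2 ≤ y := by linarith
  have hy0 : 0 < y := by linarith
  have hkσ : k = x ^ σ := by rw [hx, ← Real.rpow_mul hk0.le, one_div_mul_cancel hσ0.ne', Real.rpow_one]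
  have hlx : 0 < Real.log x := Real.log_pos (by linarith)
  have hly : 0 < Real.log y := Real.log_pos (by linarith)
  have hlxy : Real.log x ≤ Real.log y := Real.log_le_log hx0 hxy
  have hI := setIntegral_splitPow_le (a := σ + δ) (b := 2 * σ) hx2 (by rw [hδ]; linarith) (by linarith)
  have hsub : Set.Ioc 2 y ⊆ Set.Ioi 2 := fun u hu => hu.1
  have ht0 : ∀ u : ℝ, 0 < u → 0 < k * u ^ (-σ) := fun u hu => by positivity
  have hLs : ∀ u : ℝ, 0 < u → logBessel (k * u ^ (-σ)) ≤ splitPow x σ (2 * σ) u := fun u hu =>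
    min_le_splitPow hx0 hu (mul_rpow_neg_eq hσ0 hk0 hu) (logBessel_le_self (ht0 u hu).le)
      (logBessel_le_sq (ht0 u hu).le)
  have hLs' : ∀ u : ℝ, 0 < u → (k * u ^ (-σ)) * logBesselDeriv (k * u ^ (-σ)) ≤
      2 * splitPow x σ (2 * σ) u := fun u hu => by
    have h1 := logBesselDeriv_le_one (k * u ^ (-σ))
    have h2 := logBesselDeriv_le (ht0 u hu).le
    have h3 := ht0 u hu
    have h4 : (k * u ^ (-σ)) * logBesselDeriv (k * u ^ (-σ)) / 2 ≤ splitPow x σ (2 * σ) u :=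
      min_le_splitPow hx0 hu (mul_rpow_neg_eq hσ0 hk0 hu)
        (by nlinarith) (by nlinarith)
    linarith
  have hmain := abs_sum_primesUpTo_sub_le (f := fun u => logBessel (k * u ^ (-σ)) / Real.log u)
    (f' := fun u => logBesselDeriv (k * u ^ (-σ)) * (k * (-σ * u ^ (-σ - 1))) / Real.log u -
        logBessel (k * u ^ (-σ)) / (u * Real.log u ^ 2))
    (B := fun u => G * A * (D / Real.log x ^ M) * splitPow x (σ + δ) (2 * σ) u) hy2
    (fun u hu => hasDerivAt_logBessel_div_log σ k hu.1) ?_ ((hI.1.mono_set hsub).const_mul _) ?_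
  · have hsum : ∑ p ∈ primesUpTo y, (logBessel (k * (p : ℝ) ^ (-σ)) / Real.log p) * Real.log p =
        ∑ p ∈ primesUpTo y, logBessel (k * (p : ℝ) ^ (-σ)) := by
      refine Finset.sum_congr rfl fun p hp => ?_
      have : 0 < Real.log p := Real.log_pos (by exact_mod_cast (mem_primesUpTo.1 hp).2.one_lt)
      field_simp
    rw [hsum, MeasureTheory.integral_const_mul] at hmain
    refine hmain.trans ?_
    have b1 : 2 * |logBessel (k * 2 ^ (-σ)) / Real.log 2| ≤
        2 / Real.log 2 * F * (x / Real.log x ^ M) := by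
      rw [abs_of_nonneg (div_nonneg (logBessel_nonneg _) hl2.le)]
      have h1 : logBessel (k * 2 ^ (-σ)) ≤ k := (logBessel_le_self (by positivity)).trans
        (mul_le_of_le_one_right hk0.le
          (Real.rpow_le_one_of_one_le_of_nonpos (by norm_num) (by linarith)))
      have h2 : k ≤ F * (x / Real.log x ^ M) := by
        rw [← mul_div_assoc, le_div_iff₀ (by positivity)]
        calc k * Real.log x ^ M ≤ x ^ σ * (F * x ^ (1 - σ)) := by
              rw [← hkσ]; gcongr; exact hl x (by linarith)
          _ = F * (x ^ σ * x ^ (1 - σ)) := by ring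
          _ = F * x := by rw [← Real.rpow_add hx0]; simp
      calc 2 * (logBessel (k * 2 ^ (-σ)) / Real.log 2) ≤
            2 * (F * (x / Real.log x ^ M) / Real.log 2) := by gcongr; linarith
        _ = _ := by ring
    have b2 : |logBessel (k * y ^ (-σ)) / Real.log y| * |Chebyshev.theta y - y| ≤
        A / Real.log 2 * (x / Real.log x ^ M) := by
      rw [abs_of_nonneg (div_nonneg (logBessel_nonneg _) hly.le)]
      have h1 : logBessel (k * y ^ (-σ)) * y ≤ x := by
        have h2 : logBessel (k * y ^ (-σ)) ≤ (x / y) ^ (1 : ℝ) := by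
          calc logBessel (k * y ^ (-σ)) ≤ (k * y ^ (-σ)) ^ 2 := logBessel_le_sq (ht0 y hy0).le
            _ = (x / y) ^ (2 * σ) := by
              rw [mul_rpow_neg_eq hσ0 hk0 hy0, mul_comm 2, Real.rpow_mul (by positivity)]; simp [hx]
            _ ≤ (x / y) ^ (1 : ℝ) := by
              apply Real.rpow_le_rpow_of_exponent_ge (by positivity)
              · rwa [div_le_one hy0]
              · linarith
        rw [Real.rpow_one, le_div_iff₀ hy0] at h2
        exact h2
      calc _ ≤ logBessel (k * y ^ (-σ)) / Real.log y * (A * (y / Real.log y ^ M)) := by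
            gcongr
            · exact div_nonneg (logBessel_nonneg _) hly.le
            · exact hθ y hy2
        _ = A * (logBessel (k * y ^ (-σ)) * y) / (Real.log y * Real.log y ^ M) := by
            field_simp
        _ ≤ A * x / (Real.log 2 * Real.log x ^ M) := by
            have : Real.log 2 ≤ Real.log y := Real.log_le_log (by norm_num) hy2
            gcongr
        _ = _ := by field_simp
    have b3 : G * A * (D / Real.log x ^ M) * ∫ u in Set.Ioc 2 y, splitPow x (σ + δ) (2 * σ) u ≤
        G * A * D * W * (x / Real.log x ^ M) := by
      have h1 : ∫ u in Set.Ioc 2 y, splitPow x (σ + δ) (2 * σ) u ≤ x * W := by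
        refine le_trans ?_ hI.2
        refine MeasureTheory.setIntegral_mono_set hI.1 ?_ hsub.eventuallyLE
        exact (MeasureTheory.ae_restrict_iff' measurableSet_Ioi).2
          (Filter.Eventually.of_forall fun u hu =>
            splitPow_nonneg hx0.le (le_trans (by norm_num) (le_of_lt hu)) _ _)
      calc _ ≤ G * A * (D / Real.log x ^ M) * (x * W) := by gcongr
        _ = _ := by ring
    calc _ ≤ _ := add_le_add (add_le_add b1 b2) b3
      _ = _ := by ring
  · intro u hu
    have hu0 : u ≠ 0 := by linarith [hu.1]
    have hlu : 0 < Real.log u := Real.log_pos (by linarith [hu.1])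
    apply ContinuousAt.continuousWithinAt
    have c1 : ContinuousAt Real.log u := Real.continuousAt_log hu0
    have c2 : ContinuousAt (fun u : ℝ => u ^ (-σ - 1)) u := Real.continuousAt_rpow_const _ _ (Or.inl hu0)
    have c3 : ContinuousAt (fun u : ℝ => k * u ^ (-σ)) u :=
      continuousAt_const.mul (Real.continuousAt_rpow_const _ _ (Or.inl hu0))
    have c4 : ContinuousAt (fun u : ℝ => logBessel (k * u ^ (-σ))) u :=
      continuous_logBessel.continuousAt.comp c3
    have c5 : ContinuousAt (fun u : ℝ => logBesselDeriv (k * u ^ (-σ))) u :=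
      continuous_logBesselDeriv.continuousAt.comp c3
    exact ((c5.mul (continuousAt_const.mul (continuousAt_const.mul c2))).div c1 hlu.ne').sub
      (c4.div (continuousAt_id.mul (c1.pow 2)) (mul_ne_zero hu0 (by positivity)))
  · intro u hu
    have hu0 : 0 < u := by linarith [hu.1]
    have hlu2 : Real.log 2 ≤ Real.log u := Real.log_le_log (by norm_num) hu.1.le
    have hlu : 0 < Real.log u := by linarith
    have hs0 : 0 ≤ splitPow x σ (2 * σ) u := splitPow_nonneg hx0.le hu0.le _ _
    have hd : |logBesselDeriv (k * u ^ (-σ)) * (k * (-σ * u ^ (-σ - 1))) / Real.log u -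
        logBessel (k * u ^ (-σ)) / (u * Real.log u ^ 2)| ≤ G * (splitPow x σ (2 * σ) u / u) := by
      have eu : u ^ (-σ) = u ^ (-σ - 1) * u := by
        rw [← Real.rpow_add_one hu0.ne']; ring_nf
      have e7 : logBesselDeriv (k * u ^ (-σ)) * (k * (-σ * u ^ (-σ - 1))) / Real.log u -
          logBessel (k * u ^ (-σ)) / (u * Real.log u ^ 2) =
          -(σ * ((k * u ^ (-σ)) * logBesselDeriv (k * u ^ (-σ))) / Real.log u +
            logBessel (k * u ^ (-σ)) / Real.log u ^ 2) / u := by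
        rw [show u ^ (-σ - 1) = u ^ (-σ) / u by rw [eu]; field_simp]
        field_simp
        ring
      have hn1 : 0 ≤ (k * u ^ (-σ)) * logBesselDeriv (k * u ^ (-σ)) :=
        mul_nonneg (ht0 u hu0).le (logBesselDeriv_nonneg (ht0 u hu0).le)
      have hn2 := logBessel_nonneg (k * u ^ (-σ))
      rw [e7, abs_div, abs_neg, abs_of_pos hu0, abs_of_nonneg (by positivity), mul_div_assoc']
      gcongr
      calc _ ≤ 1 * (2 * splitPow x σ (2 * σ) u) / Real.log 2 + splitPow x σ (2 * σ) u / Real.log 2 ^ 2 := by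
            have := hLs' u hu0
            refine add_le_add (div_le_div₀ (by positivity) ?_ hl2 hlu2)
              (div_le_div₀ hs0 (hLs u hu0) (by positivity) ?_)
            · exact mul_le_mul hσ'.le this hn1 zero_le_one
            · gcongr
        _ = _ := by rw [hG]; ring
    calc _ ≤ G * (splitPow x σ (2 * σ) u / u) * (A * (u / Real.log u ^ M)) := by
          gcongr; exact hθ u hu.1.le
      _ = G * A * (splitPow x σ (2 * σ) u / Real.log u ^ M) := by field_simp
      _ ≤ G * A * (D / Real.log x ^ M * splitPow x (σ + δ) (2 * σ) u) := by
          refine mul_le_mul_of_nonneg_left ?_ (by positivity)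
          refine splitPow_div_log_pow_le hx2 hu.1.le hD1 fun hux => ?_
          refine (hr₀ u x hu.1.le hux).trans ?_
          gcongr
          exact le_max_left _ _
      _ = _ := by ring

/-! ### Expansion of the main term in powers of `1 / log k` -/

/-- `1 / (ℓ - v)` for `v < ℓ - b`, and `0` otherwise. -/
noncomputable def truncInv (b ℓ v : ℝ) : ℝ := if v < ℓ - b then 1 / (ℓ - v) else 0

lemma truncInv_nonneg {b ℓ v : ℝ} (hb : 0 < b) : 0 ≤ truncInv b ℓ v := by
  rw [truncInv]
  split_ifs with h
  · exact div_nonneg zero_le_one (by linarith)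
  · exact le_rfl

lemma truncInv_le {b ℓ v : ℝ} (hb : 0 < b) : truncInv b ℓ v ≤ 1 / b := by
  rw [truncInv]
  split_ifs with h
  · exact one_div_le_one_div_of_le hb (by linarith)
  · positivity

/-- The geometric expansion of `1 / (ℓ - v)`, with an error that is uniform in `v`. For `v ≤ ℓ / 2`
this is the remainder of the geometric series; for `v > ℓ / 2` both sides are small
because `2v / ℓ > 1`. -/
lemma abs_truncInv_sub_sum_le {b : ℝ} (hb : 0 < b) (N : ℕ) {ℓ : ℝ} (hℓ : 2 * b < ℓ) (v : ℝ) :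
    |truncInv b ℓ v - ∑ n ∈ Finset.range (N + 1), v ^ n / ℓ ^ (n + 1)| ≤
      (2 + 2 ^ (N + 2) / b + (N + 1) * 2 ^ (N + 1)) *
        ((|v| ^ (N + 1) + |v| ^ (N + 2)) / ℓ ^ (N + 2)) := by
  have hℓ0 : 0 < ℓ := by linarith
  rcases le_or_gt v (ℓ / 2) with hv | hv
  · have h1 : 0 < ℓ - v := by linarith
    have hsum : ∀ M : ℕ, 1 / (ℓ - v) - ∑ n ∈ Finset.range M, v ^ n / ℓ ^ (n + 1) =
        v ^ M / (ℓ ^ M * (ℓ - v)) := by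
      intro M
      induction M with
      | zero => simp
      | succ M ih =>
        rw [Finset.sum_range_succ, ← sub_sub, ih]
        field_simp
        ring
    rw [truncInv, if_pos (by linarith), hsum, abs_div, abs_pow,
      abs_of_pos (show 0 < ℓ ^ (N + 1) * (ℓ - v) by positivity)]
    calc |v| ^ (N + 1) / (ℓ ^ (N + 1) * (ℓ - v)) ≤ |v| ^ (N + 1) / (ℓ ^ (N + 1) * (ℓ / 2)) := by
          gcongr; linarith
      _ = 2 * (|v| ^ (N + 1) / ℓ ^ (N + 2)) := by rw [pow_succ ℓ (N + 1)]; field_simp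
      _ ≤ _ := by
          refine mul_le_mul ?_ ?_ (by positivity) (by positivity)
          · have : 0 ≤ (2 : ℝ) ^ (N + 2) / b + (N + 1) * 2 ^ (N + 1) := by positivity
            linarith
          · gcongr
            linarith [pow_nonneg (abs_nonneg v) (N + 2)]
  · have hv0 : 0 < v := by linarith
    have hr : 1 ≤ 2 * (v / ℓ) := by rw [← mul_div_assoc, le_div_iff₀ hℓ0]; linarith
    have hr0 : 0 < v / ℓ := by positivity
    have h1 : |truncInv b ℓ v| ≤ 2 ^ (N + 2) / b * (v ^ (N + 2) / ℓ ^ (N + 2)) := by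
      rw [abs_of_nonneg (truncInv_nonneg hb)]
      calc truncInv b ℓ v ≤ 1 / b * 1 := by rw [mul_one]; exact truncInv_le hb
        _ ≤ 1 / b * (2 * (v / ℓ)) ^ (N + 2) := by gcongr; exact one_le_pow₀ hr
        _ = _ := by rw [mul_pow, div_pow]; ring
    have h2 : |∑ n ∈ Finset.range (N + 1), v ^ n / ℓ ^ (n + 1)| ≤
        (N + 1) * 2 ^ (N + 1) * (v ^ (N + 1) / ℓ ^ (N + 2)) := by
      rw [abs_of_nonneg (Finset.sum_nonneg fun n _ => by positivity)]
      calc ∑ n ∈ Finset.range (N + 1), v ^ n / ℓ ^ (n + 1) ≤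
            ∑ n ∈ Finset.range (N + 1), (2 * (v / ℓ)) ^ (N + 1) / ℓ := by
            refine Finset.sum_le_sum fun n hn => ?_
            have hn' : n ≤ N + 1 := by have := Finset.mem_range.1 hn; omega
            calc v ^ n / ℓ ^ (n + 1) = (v / ℓ) ^ n / ℓ := by rw [div_pow, pow_succ]; field_simp
              _ ≤ (2 * (v / ℓ)) ^ n / ℓ := by gcongr; linarith
              _ ≤ _ := by gcongr
        _ = _ := by
            rw [Finset.sum_const, Finset.card_range, nsmul_eq_mul, mul_pow, div_pow]
            push_cast
            rw [pow_succ ℓ (N + 1)]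
            field_simp
    calc _ ≤ |truncInv b ℓ v| + |∑ n ∈ Finset.range (N + 1), v ^ n / ℓ ^ (n + 1)| := abs_sub _ _
      _ ≤ 2 ^ (N + 2) / b * (v ^ (N + 2) / ℓ ^ (N + 2)) +
          (N + 1) * 2 ^ (N + 1) * (v ^ (N + 1) / ℓ ^ (N + 2)) := add_le_add h1 h2
      _ ≤ 2 ^ (N + 2) / b * ((v ^ (N + 1) + v ^ (N + 2)) / ℓ ^ (N + 2)) +
          (N + 1) * 2 ^ (N + 1) * ((v ^ (N + 1) + v ^ (N + 2)) / ℓ ^ (N + 2)) := by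
          refine add_le_add (mul_le_mul_of_nonneg_left ?_ (by positivity))
            (mul_le_mul_of_nonneg_left ?_ (by positivity)) <;> gcongr
          · linarith [pow_pos hv0 (N + 1)]
          · linarith [pow_pos hv0 (N + 2)]
      _ ≤ _ := by
          rw [abs_of_pos hv0, ← add_mul]
          gcongr
          linarith

/-- The substitution `t = k u^{-σ}`, under which `log u = (log k - log t) / σ` and the condition
`u > 2` becomes `log t < log k - σ log 2`. -/
lemma setIntegral_logBessel_div_log_eq {σ k : ℝ} (hσ : 0 < σ) (hk : 0 < k) :
    ∫ u in Set.Ioi 2, logBessel (k * u ^ (-σ)) / Real.log u =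
      k ^ (1 / σ) * ∫ t in Set.Ioi 0, t ^ (-(1 / σ) - 1) * logBessel t *
        truncInv (σ * Real.log 2) (Real.log k) (Real.log t) := by
  set R : ℝ → ℝ := fun t => t ^ (-(1 / σ) - 1) * logBessel t *
        truncInv (σ * Real.log 2) (Real.log k) (Real.log t) with hR
  have h1 := MeasureTheory.integral_comp_mul_left_Ioi R 0 hk
  have h2 := MeasureTheory.integral_comp_rpow_Ioi (fun w => R (k * w)) (p := -σ) (by linarith)
  rw [h1, mul_zero, smul_eq_mul] at h2
  have h3 : ∫ t in Set.Ioi 0, R t =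
      k * ∫ u in Set.Ioi 0, (|(-σ)| * u ^ (-σ - 1)) • R (k * u ^ (-σ)) := by
    rw [h2, ← mul_assoc, mul_inv_cancel₀ hk.ne', one_mul]
  have h4 : ∀ u ∈ Set.Ioi (0 : ℝ), (|(-σ)| * u ^ (-σ - 1)) • R (k * u ^ (-σ)) =
      k⁻¹ * (k ^ (1 / σ))⁻¹ * (Set.Ioi (2 : ℝ)).indicator
        (fun u => logBessel (k * u ^ (-σ)) / Real.log u) u := by
    intro u hu
    have hu0 : (0 : ℝ) < u := hu
    have el : Real.log (k * u ^ (-σ)) = Real.log k - σ * Real.log u := by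
      rw [Real.log_mul hk.ne' (by positivity), Real.log_rpow hu0]; ring
    have ep : (k * u ^ (-σ)) ^ (-(1 / σ) - 1) = k⁻¹ * (k ^ (1 / σ))⁻¹ * u ^ (1 + σ) := by
      rw [Real.mul_rpow hk.le (by positivity), ← Real.rpow_mul hu0.le,
        show -σ * (-(1 / σ) - 1) = 1 + σ by field_simp; ring,
        show -(1 / σ) - 1 = -(1 + 1 / σ) by ring, Real.rpow_neg hk.le, Real.rpow_add hk, Real.rpow_one,
        mul_inv]
    have eu : u ^ (-σ - 1) * u ^ (1 + σ) = 1 := by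
      rw [← Real.rpow_add hu0, show -σ - 1 + (1 + σ) = 0 by ring, Real.rpow_zero]
    simp only [hR, smul_eq_mul, abs_neg, abs_of_pos hσ]
    rw [ep, el, truncInv]
    by_cases h : 2 < u
    · have hlu : 0 < Real.log u := Real.log_pos (by linarith)
      have hll : Real.log 2 < Real.log u := Real.log_lt_log (by norm_num) h
      rw [if_pos (by nlinarith), Set.indicator_of_mem (by exact h), sub_sub_cancel]
      calc _ = (u ^ (-σ - 1) * u ^ (1 + σ)) * (k⁻¹ * (k ^ (1 / σ))⁻¹ *
            (logBessel (k * u ^ (-σ)) * (σ / (σ * Real.log u)))) := by ring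
        _ = _ := by rw [eu, one_mul, show σ / (σ * Real.log u) = (Real.log u)⁻¹ by field_simp]; rfl
    · have hll : Real.log u ≤ Real.log 2 := Real.log_le_log hu0 (not_lt.1 h)
      rw [if_neg (by nlinarith), Set.indicator_of_notMem (by exact h)]
      ring
  rw [h3, MeasureTheory.setIntegral_congr_fun measurableSet_Ioi h4, MeasureTheory.integral_const_mul,
    MeasureTheory.setIntegral_indicator measurableSet_Ioi,
    show Set.Ioi (0 : ℝ) ∩ Set.Ioi 2 = Set.Ioi 2 from
      Set.inter_eq_right.2 (Set.Ioi_subset_Ioi (by norm_num))]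
  have : 0 < k ^ (1 / σ) := by positivity
  field_simp

/-- The geometric series in `log t / log k` produces the coefficients `C_n`. -/
lemma exists_abs_setIntegral_truncInv_sub_sum_le {σ : ℝ} (hσ : 1 / 2 < σ) (hσ' : σ < 1) (N : ℕ) :
    ∃ C : ℝ, 0 < C ∧ ∀ k : ℝ, 4 ≤ k →
      |(∫ t in Set.Ioi 0, t ^ (-(1 / σ) - 1) * logBessel t *
          truncInv (σ * Real.log 2) (Real.log k) (Real.log t)) -
        1 / Real.log k * ∑ n ∈ Finset.range (N + 1), momentCoeff σ n / Real.log k ^ n| ≤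
      C / Real.log k ^ (N + 2) := by
  have hσ0 : 0 < σ := by linarith
  have hl2 : 0 < Real.log 2 := Real.log_pos (by norm_num)
  set b := σ * Real.log 2 with hb
  have hb0 : 0 < b := by positivity
  set E : ℝ := 2 + 2 ^ (N + 2) / b + (N + 1) * 2 ^ (N + 1) with hE
  have hE0 : 0 < E := by positivity
  set J : ℝ := ∫ t in Set.Ioi 0, (absMomentIntegrand σ (N + 1) t + absMomentIntegrand σ (N + 2) t)
    with hJ
  have i1 := integrableOn_absMomentIntegrand hσ hσ' (N + 1)
  have i2 := integrableOn_absMomentIntegrand hσ hσ' (N + 2)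
  refine ⟨E * |J| + 1, by positivity, fun k hk => ?_⟩
  set ℓ := Real.log k with hℓ
  have hℓ2 : 2 * b < ℓ := by
    have : Real.log 4 ≤ ℓ := Real.log_le_log (by norm_num) hk
    have e4 : Real.log 4 = 2 * Real.log 2 := by
      rw [show (4 : ℝ) = 2 ^ 2 by norm_num, Real.log_pow]; norm_num
    rw [e4] at this
    nlinarith
  have hℓ0 : 0 < ℓ := by linarith
  set R : ℝ → ℝ := fun t => t ^ (-(1 / σ) - 1) * logBessel t * truncInv b ℓ (Real.log t) with hR
  set S : ℝ → ℝ := fun t => ∑ n ∈ Finset.range (N + 1), momentCoeffIntegrand σ n t / ℓ ^ (n + 1)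
    with hS
  have iS : MeasureTheory.IntegrableOn S (Set.Ioi 0) :=
    MeasureTheory.integrable_finsetSum _ fun n _ =>
      (integrableOn_momentCoeffIntegrand hσ hσ' n).div_const _
  have eS : ∫ t in Set.Ioi 0, S t =
      1 / ℓ * ∑ n ∈ Finset.range (N + 1), momentCoeff σ n / ℓ ^ n := by
    rw [MeasureTheory.integral_finsetSum _ fun n _ =>
      (integrableOn_momentCoeffIntegrand hσ hσ' n).div_const _, Finset.mul_sum]
    refine Finset.sum_congr rfl fun n _ => ?_
    rw [MeasureTheory.integral_div, momentCoeff, pow_succ]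
    field_simp
  have hpt : ∀ t ∈ Set.Ioi (0 : ℝ), |R t - S t| ≤
      E / ℓ ^ (N + 2) * (absMomentIntegrand σ (N + 1) t + absMomentIntegrand σ (N + 2) t) := by
    intro t ht
    have ht0 : (0 : ℝ) < t := ht
    have hn := logBessel_nonneg t
    have e : R t - S t = t ^ (-(1 / σ) - 1) * logBessel t * (truncInv b ℓ (Real.log t) -
        ∑ n ∈ Finset.range (N + 1), Real.log t ^ n / ℓ ^ (n + 1)) := by
      rw [mul_sub, Finset.mul_sum]
      congr 1
      refine Finset.sum_congr rfl fun n _ => ?_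
      rw [momentCoeffIntegrand_eq ht0]
      ring
    rw [e, abs_mul, abs_of_nonneg (by positivity)]
    refine (mul_le_mul_of_nonneg_left (abs_truncInv_sub_sum_le hb0 N hℓ2 (Real.log t))
      (by positivity)).trans (le_of_eq ?_)
    rw [absMomentIntegrand, absMomentIntegrand]
    ring
  have iD : MeasureTheory.IntegrableOn (fun t => R t - S t) (Set.Ioi 0) := by
    refine MeasureTheory.Integrable.mono' ((i1.add i2).const_mul (E / ℓ ^ (N + 2))) ?_
      ((MeasureTheory.ae_restrict_iff' measurableSet_Ioi).2 (Filter.Eventually.of_forall hpt))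
    refine MeasureTheory.AEStronglyMeasurable.sub ?_ iS.aestronglyMeasurable
    refine Measurable.aestronglyMeasurable ?_
    refine ((measurable_id.pow_const _).mul continuous_logBessel.measurable).mul ?_
    exact (Measurable.ite measurableSet_Iio (measurable_const.div (measurable_const.sub measurable_id))
      measurable_const).comp Real.measurable_log
  have iR : MeasureTheory.IntegrableOn R (Set.Ioi 0) := by
    have := iD.add iS
    refine this.congr_fun (fun t _ => ?_) measurableSet_Ioi
    simp
  rw [← eS, ← MeasureTheory.integral_sub iR iS]
  calc |∫ t in Set.Ioi 0, (R t - S t)| ≤ ∫ t in Set.Ioi 0, E / ℓ ^ (N + 2) *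
        (absMomentIntegrand σ (N + 1) t + absMomentIntegrand σ (N + 2) t) :=
        norm_setIntegral_le_setIntegral (f := fun t => R t - S t) measurableSet_Ioi
          ((i1.add i2).const_mul (E / ℓ ^ (N + 2))) hpt
    _ = E / ℓ ^ (N + 2) * J := by rw [MeasureTheory.integral_const_mul]
    _ ≤ E / ℓ ^ (N + 2) * |J| := by gcongr; exact le_abs_self _
    _ = E * |J| / ℓ ^ (N + 2) := by ring
    _ ≤ _ := by gcongr; linarith

/-- The asymptotic expansion of `∑_{p ≤ y} log I₀(k p^{-σ})`. -/
lemma exists_abs_sum_logBessel_sub_le {σ : ℝ} (hσ : 1 / 2 < σ) (hσ' : σ < 1) (N : ℕ) :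
    ∃ C : ℝ, 0 < C ∧ ∀ k y : ℝ, 4 ≤ k → k ^ (1 / σ) ≤ y →
      |∑ p ∈ primesUpTo y, logBessel (k * (p : ℝ) ^ (-σ)) - k ^ (1 / σ) / Real.log k *
        ∑ n ∈ Finset.range (N + 1), momentCoeff σ n / Real.log k ^ n| ≤
      C * (k ^ (1 / σ) / Real.log k *
        (1 / Real.log k ^ (N + 1) + (k ^ (1 / σ) / y) ^ (2 * σ - 1))) := by
  have hσ0 : 0 < σ := by linarith
  have h1σ : 1 < 1 / σ := by rwa [lt_div_iff₀ hσ0, one_mul]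
  have hl2 : 0 < Real.log 2 := Real.log_pos (by norm_num)
  obtain ⟨A, hA, h1⟩ := exists_abs_sum_logBessel_sub_integral_le hσ hσ' (N + 2)
  obtain ⟨B, hB, h2⟩ := exists_abs_setIntegral_truncInv_sub_sum_le hσ hσ' N
  have hs : 0 < 2 * σ - 1 := by linarith
  refine ⟨A + B + 1 / (2 * σ - 1), by positivity, fun k y hk hxy => ?_⟩
  have h1 := h1 k y (by linarith) hxy
  have h2 := h2 k hk
  have hk0 : 0 < k := by linarith
  have hlk : 0 < Real.log k := Real.log_pos (by linarith)
  have hlx : Real.log (k ^ (1 / σ)) = Real.log k / σ := by rw [Real.log_rpow hk0]; ring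
  have hkx : k ≤ k ^ (1 / σ) := by
    calc k = k ^ (1 : ℝ) := (Real.rpow_one k).symm
      _ ≤ k ^ (1 / σ) := Real.rpow_le_rpow_of_exponent_le (by linarith) h1σ.le
  have h3 := setIntegral_logBessel_div_log_eq hσ0 hk0
  rw [hlx] at h1
  set x := k ^ (1 / σ) with hx
  set ℓ := Real.log k with hℓ
  have hx0 : 0 < x := by linarith
  have hy0 : 0 < y := by linarith
  have hlkx : ℓ ≤ ℓ / σ := by rw [le_div_iff₀ hσ0]; nlinarith
  have hpt : ∀ u ∈ Set.Ioi (2 : ℝ), |logBessel (k * u ^ (-σ)) / Real.log u| ≤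
      1 / Real.log 2 * splitPow x σ (2 * σ) u := by
    intro u hu
    have hu2 : (2 : ℝ) < u := hu
    have hu0 : 0 < u := by linarith
    have hlu : Real.log 2 ≤ Real.log u := Real.log_le_log (by norm_num) hu2.le
    have ht : 0 ≤ k * u ^ (-σ) := by positivity
    rw [abs_of_nonneg (div_nonneg (logBessel_nonneg _) (by linarith)), one_div_mul_eq_div]
    exact div_le_div₀ (splitPow_nonneg hx0.le hu0.le _ _) (min_le_splitPow hx0 hu0
      (mul_rpow_neg_eq hσ0 hk0 hu0) (logBessel_le_self ht) (logBessel_le_sq ht)) hl2 hlu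
  have iI : MeasureTheory.IntegrableOn (fun u : ℝ => logBessel (k * u ^ (-σ)) / Real.log u)
      (Set.Ioi 2) := by
    refine MeasureTheory.Integrable.mono'
      ((setIntegral_splitPow_le (a := σ) (b := 2 * σ) (by linarith) hσ' (by linarith)).1.const_mul
        (1 / Real.log 2)) ?_
      ((MeasureTheory.ae_restrict_iff' measurableSet_Ioi).2 (Filter.Eventually.of_forall hpt))
    refine Measurable.aestronglyMeasurable ?_
    exact (continuous_logBessel.measurable.comp
      (measurable_const.mul (measurable_id.pow_const _))).div Real.measurable_log
  have hsplit := MeasureTheory.setIntegral_union (Set.Ioc_disjoint_Ioi_same (a := 2) (b := y))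
    measurableSet_Ioi (iI.mono_set Set.Ioc_subset_Ioi_self)
    (iI.mono_set (Set.Ioi_subset_Ioi (by linarith)))
  rw [Set.Ioc_union_Ioi_eq_Ioi (by linarith), h3] at hsplit
  have htail : |∫ u in Set.Ioi y, logBessel (k * u ^ (-σ)) / Real.log u| ≤
      1 / (2 * σ - 1) * (x / ℓ * (x / y) ^ (2 * σ - 1)) := by
    have h4 := setIntegral_Ioi_div_rpow (b := 2 * σ) hx0 hy0 (by linarith)
    calc |∫ u in Set.Ioi y, logBessel (k * u ^ (-σ)) / Real.log u| ≤
          ∫ u in Set.Ioi y, 1 / ℓ * (x / u) ^ (2 * σ) := by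
          refine norm_setIntegral_le_setIntegral
            (f := fun u => logBessel (k * u ^ (-σ)) / Real.log u) measurableSet_Ioi
            (h4.1.const_mul (1 / ℓ)) ?_
          intro u hu
          have hu2 : y < u := hu
          have hu0 : 0 < u := by linarith
          have hlu : ℓ ≤ Real.log u := Real.log_le_log hk0 (by linarith)
          have ht : 0 ≤ k * u ^ (-σ) := by positivity
          rw [Real.norm_eq_abs, abs_of_nonneg (div_nonneg (logBessel_nonneg _) (by linarith)),
            one_div_mul_eq_div]
          refine div_le_div₀ (by positivity) ((logBessel_le_sq ht).trans (le_of_eq ?_)) hlk hlu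
          rw [mul_rpow_neg_eq hσ0 hk0 hu0, mul_comm 2, Real.rpow_mul (by positivity)]; simp [hx]
      _ = _ := by rw [MeasureTheory.integral_const_mul, h4.2]; field_simp
  have hb1 : A * (x / (ℓ / σ) ^ (N + 2)) ≤ A * (x / ℓ * (1 / ℓ ^ (N + 1))) := by
    refine mul_le_mul_of_nonneg_left ?_ hA.le
    calc x / (ℓ / σ) ^ (N + 2) ≤ x / ℓ ^ (N + 2) := by gcongr
      _ = _ := by rw [pow_succ ℓ (N + 1)]; field_simp
  set Z := ∫ t in Set.Ioi 0, t ^ (-(1 / σ) - 1) * logBessel t *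
        truncInv (σ * Real.log 2) ℓ (Real.log t) with hZ
  set P := ∑ p ∈ primesUpTo y, logBessel (k * (p : ℝ) ^ (-σ)) with hP
  set Q := ∑ n ∈ Finset.range (N + 1), momentCoeff σ n / ℓ ^ n with hQ
  set U := ∫ u in Set.Ioc 2 y, logBessel (k * u ^ (-σ)) / Real.log u with hU
  set V := ∫ u in Set.Ioi y, logBessel (k * u ^ (-σ)) / Real.log u with hV
  have e : P - x / ℓ * Q = (P - U) - V + x * (Z - 1 / ℓ * Q) := by
    rw [mul_sub, hsplit]; ring
  have hb2 : |x * (Z - 1 / ℓ * Q)| ≤ B * (x / ℓ * (1 / ℓ ^ (N + 1))) := by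
    rw [abs_mul, abs_of_pos hx0]
    calc _ ≤ x * (B / ℓ ^ (N + 2)) := by gcongr
      _ = _ := by rw [pow_succ ℓ (N + 1)]; field_simp
  rw [e]
  have hw1 : 0 ≤ x / ℓ * (1 / ℓ ^ (N + 1)) := by positivity
  have hw2 : 0 ≤ x / ℓ * (x / y) ^ (2 * σ - 1) := by positivity
  calc _ ≤ |P - U| + |V| + |x * (Z - 1 / ℓ * Q)| :=
        (abs_add_le _ _).trans (add_le_add (abs_sub _ _) le_rfl)
    _ ≤ A * (x / ℓ * (1 / ℓ ^ (N + 1))) + 1 / (2 * σ - 1) * (x / ℓ * (x / y) ^ (2 * σ - 1)) +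
        B * (x / ℓ * (1 / ℓ ^ (N + 1))) := add_le_add (add_le_add (h1.trans hb1) htail) hb2
    _ ≤ _ := by
      have : 0 < 1 / (2 * σ - 1) := by positivity
      rw [mul_add (x / ℓ)]
      nlinarith [mul_nonneg this.le hw1, mul_nonneg (add_pos hA hB).le hw2]

/-! ### Mean values of almost periodic sums -/

lemma summable_sq_of_nonneg {ι : Type*} {b : ι → ℝ} (hb0 : ∀ i, 0 ≤ b i) (hb : Summable b) :
    Summable fun i => b i ^ 2 := by
  have := (hb.mul_of_nonneg hb hb0 hb0).comp_injective (i := fun i : ι => (i, i))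
    (fun i j h => (Prod.ext_iff.1 h).1)
  exact this.congr fun i => by simp [pow_two]

/-- The second mean of `∑ bᵢ e(lᵢ t)` over `[u, v]`, when the frequencies `lᵢ` are orthogonal up to
the errors `ωᵢ ωⱼ`. -/
lemma abs_integral_norm_sq_tsum_sub_le {ι : Type*} [Countable ι] [DecidableEq ι] {b ω : ι → ℝ}
    (hb0 : ∀ i, 0 ≤ b i) (hb : Summable b) (l : ι → ℝ) {u v T : ℝ} (huv : u ≤ v)
    (hω0 : ∀ i, 0 ≤ ω i) (hbω : Summable fun i => b i * ω i)
    (hE : ∀ i j, ‖(∫ t in u..v, Complex.exp (Complex.I * ((l i - l j : ℝ) : ℂ) * t)) -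
      ((if i = j then T else 0 : ℝ) : ℂ)‖ ≤ ω i * ω j) :
    |(∫ t in u..v, ‖∑' i, (b i : ℂ) * Complex.exp (Complex.I * (l i : ℂ) * t)‖ ^ 2) -
      T * ∑' i, b i ^ 2| ≤ (∑' i, b i * ω i) ^ 2 := by
  set e : ι → ℝ → ℂ := fun i t => (b i : ℂ) * Complex.exp (Complex.I * (l i : ℂ) * t) with he
  have hen : ∀ i t, ‖e i t‖ = b i := by
    intro i t
    rw [he]
    simp only [norm_mul, Complex.norm_real, Real.norm_eq_abs, abs_of_nonneg (hb0 i)]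
    rw [show Complex.I * (l i : ℂ) * t = ((l i * t : ℝ) : ℂ) * Complex.I by push_cast; ring,
      Complex.norm_exp_ofReal_mul_I, mul_one]
  set g : ι × ι → ℝ → ℂ := fun z t => e z.1 t * (starRingEnd ℂ) (e z.2 t) with hg
  have hg' : ∀ z t, g z t = ((b z.1 * b z.2 : ℝ) : ℂ) *
      Complex.exp (Complex.I * ((l z.1 - l z.2 : ℝ) : ℂ) * t) := by
    intro z t
    simp only [hg, he, map_mul, Complex.conj_ofReal, ← Complex.exp_conj, Complex.conj_I]
    rw [show Complex.I * ((l z.1 - l z.2 : ℝ) : ℂ) * t =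
      Complex.I * (l z.1 : ℂ) * t + -Complex.I * (l z.2 : ℂ) * t by push_cast; ring, Complex.exp_add]
    push_cast
    ring
  have hgn : ∀ z t, ‖g z t‖ = b z.1 * b z.2 := by
    intro z t
    simp only [hg, norm_mul, RCLike.norm_conj, hen]
  have hbb : Summable fun z : ι × ι => b z.1 * b z.2 := hb.mul_of_nonneg hb hb0 hb0
  have hF : ∀ t : ℝ, ((‖∑' i, e i t‖ ^ 2 : ℝ) : ℂ) = ∑' z, g z t := by
    intro t
    have hs : Summable fun i => ‖e i t‖ := by simpa only [hen] using hb
    have hs' : Summable fun i => ‖(starRingEnd ℂ) (e i t)‖ := by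
      simpa only [RCLike.norm_conj, hen] using hb
    rw [hg, ← tsum_mul_tsum_of_summable_norm hs hs', ← Complex.conj_tsum, Complex.mul_conj,
      Complex.normSq_eq_norm_sq]
  have hgc : ∀ z, Continuous (g z) := by
    intro z
    have : g z = fun t : ℝ => ((b z.1 * b z.2 : ℝ) : ℂ) *
      Complex.exp (Complex.I * ((l z.1 - l z.2 : ℝ) : ℂ) * t) := funext (hg' z)
    rw [this]
    fun_prop
  have hsum1 : HasSum (fun z => ∫ t in u..v, g z t) (((∫ t in u..v, ‖∑' i, e i t‖ ^ 2 : ℝ)) : ℂ) := by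
    rw [← intervalIntegral.integral_ofReal]
    simp only [hF]
    simp only [intervalIntegral.integral_of_le huv]
    refine MeasureTheory.hasSum_integral_of_summable_integral_norm
      (fun z => ((hgc z).integrableOn_Icc).mono_set Set.Ioc_subset_Icc_self) ?_
    simp only [hgn, MeasureTheory.integral_const, smul_eq_mul]
    exact hbb.mul_left _
  have hsq : Summable fun i => b i ^ 2 := summable_sq_of_nonneg hb0 hb
  have hsum2 : HasSum (fun z : ι × ι => ((b z.1 * b z.2 : ℝ) : ℂ) *
      ((if z.1 = z.2 then T else 0 : ℝ) : ℂ)) ((T * ∑' i, b i ^ 2 : ℝ) : ℂ) := by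
    have hinj : Function.Injective fun i : ι => (i, i) := fun i j h => (Prod.ext_iff.1 h).1
    rw [← hinj.hasSum_iff]
    · have := Complex.hasSum_ofReal.2 (hsq.hasSum.mul_left T)
      refine this.congr_fun fun i => ?_
      simp only [Function.comp_apply, if_true]
      push_cast
      ring
    · rintro ⟨i, j⟩ h
      have : i ≠ j := fun hij => h ⟨i, by simp [hij]⟩
      simp [this]
  have hsum3 := hsum1.sub hsum2
  have hsum4 : HasSum (fun z : ι × ι => (b z.1 * ω z.1) * (b z.2 * ω z.2))
      ((∑' i, b i * ω i) ^ 2) := by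
    have h0 : ∀ i, 0 ≤ b i * ω i := fun i => mul_nonneg (hb0 i) (hω0 i)
    rw [pow_two]
    exact hbω.hasSum.mul hbω.hasSum (hbω.mul_of_nonneg hbω h0 h0)
  have hle := hsum3.norm_le_of_bounded hsum4 (fun z => ?_)
  · rwa [← Complex.ofReal_sub, Complex.norm_real, Real.norm_eq_abs] at hle
  · simp only [hg']
    rw [intervalIntegral.integral_const_mul, ← mul_sub, norm_mul, Complex.norm_real, Real.norm_eq_abs,
      abs_of_nonneg (mul_nonneg (hb0 _) (hb0 _))]
    calc _ ≤ b z.1 * b z.2 * (ω z.1 * ω z.2) :=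
          mul_le_mul_of_nonneg_left (hE z.1 z.2) (mul_nonneg (hb0 _) (hb0 _))
      _ = _ := by ring

/-- Interpolation between the trivial bound `T` and the bound `2 / |x|`. -/
lemma norm_integral_exp_le {T x δ : ℝ} (hT : 0 < T) (hx : x ≠ 0) (hδ : 0 ≤ δ) (hδ1 : δ ≤ 1) :
    ‖∫ t in T..(2 * T), Complex.exp (Complex.I * (x : ℂ) * t)‖ ≤
      2 * T ^ (1 - δ) * |x| ^ (-δ) := by
  have hn : ∀ t : ℝ, ‖Complex.exp (Complex.I * (x : ℂ) * t)‖ = 1 := by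
    intro t
    rw [show Complex.I * (x : ℂ) * t = ((x * t : ℝ) : ℂ) * Complex.I by push_cast; ring,
      Complex.norm_exp_ofReal_mul_I]
  set J := ‖∫ t in T..(2 * T), Complex.exp (Complex.I * (x : ℂ) * t)‖ with hJ
  have hx0 : 0 < |x| := abs_pos.2 hx
  have h1 : J ≤ T := by
    have := intervalIntegral.norm_integral_le_of_norm_le_const (a := T) (b := 2 * T)
      (f := fun t : ℝ => Complex.exp (Complex.I * (x : ℂ) * t)) (C := 1) (fun t _ => (hn t).le)
    rwa [show 2 * T - T = T by ring, abs_of_pos hT, one_mul] at this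
  have h2 : J ≤ 2 / |x| := by
    have hc : Complex.I * (x : ℂ) ≠ 0 := mul_ne_zero Complex.I_ne_zero (by exact_mod_cast hx)
    rw [hJ, integral_exp_mul_complex hc, norm_div, norm_mul, Complex.norm_I, one_mul,
      Complex.norm_real, Real.norm_eq_abs]
    gcongr
    calc _ ≤ _ := norm_sub_le _ _
      _ = 2 := by
        rw [hn, hn]; norm_num
  have hJ0 : 0 ≤ J := norm_nonneg _
  calc J = J ^ (1 - δ) * J ^ δ := by
        rcases hJ0.eq_or_lt with h | h
        · rw [← h]
          rcases hδ.eq_or_lt with h' | h'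
          · simp [← h']
          · rw [Real.zero_rpow h'.ne', mul_zero]
        · rw [← Real.rpow_add h]; simp
    _ ≤ T ^ (1 - δ) * (2 / |x|) ^ δ := by
        gcongr
    _ = 2 ^ δ * T ^ (1 - δ) * |x| ^ (-δ) := by
        rw [Real.div_rpow (by norm_num) hx0.le, Real.rpow_neg hx0.le]; ring
    _ ≤ _ := by
        gcongr
        calc (2 : ℝ) ^ δ ≤ 2 ^ (1 : ℝ) := Real.rpow_le_rpow_of_exponent_le (by norm_num) hδ1
          _ = 2 := Real.rpow_one 2

lemma inv_mul_le_abs_log_sub_log {m n : ℕ} (hm : m ≠ 0) (hn : n ≠ 0) (h : m ≠ n) :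
    ((m : ℝ) * n)⁻¹ ≤ |Real.log m - Real.log n| := by
  wlog hmn : m < n generalizing m n
  · rw [mul_comm, abs_sub_comm]
    exact this hn hm h.symm (lt_of_le_of_ne (not_lt.1 hmn) h.symm)
  have hm1 : (1 : ℝ) ≤ m := by exact_mod_cast Nat.one_le_iff_ne_zero.2 hm
  have hmn1 : (m : ℝ) + 1 ≤ n := by exact_mod_cast hmn
  have hn0 : (0 : ℝ) < n := by linarith
  have hm0 : (0 : ℝ) < m := by linarith
  have h1 := Real.one_sub_inv_le_log_of_pos (x := (n : ℝ) / m) (by positivity)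
  rw [Real.log_div hn0.ne' hm0.ne', inv_div] at h1
  rw [abs_sub_comm]
  refine le_trans ?_ (h1.trans (le_abs_self _))
  have : (1 : ℝ) - m / n = (n - m) / n := by field_simp
  rw [this, mul_inv, ← div_eq_mul_inv]
  gcongr
  calc (m : ℝ)⁻¹ ≤ 1 := inv_le_one_of_one_le₀ hm1
    _ ≤ _ := by linarith

/-! ### Euler products and local moments -/

/-- The multiplicative function whose value at each prime power `p ^ j` is `c j`. -/
noncomputable def mulCoeff {R : Type*} [CommMonoid R] (c : ℕ → R) (n : ℕ) : R :=
  n.factorization.prod fun _ j => c j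

lemma mulCoeff_one {R : Type*} [CommMonoid R] (c : ℕ → R) : mulCoeff c 1 = 1 := by simp [mulCoeff]

lemma mulCoeff_mul {R : Type*} [CommMonoid R] (c : ℕ → R) {m n : ℕ} (h : m.Coprime n) :
    mulCoeff c (m * n) = mulCoeff c m * mulCoeff c n := by
  rw [mulCoeff, Nat.factorization_mul_of_coprime h, Finsupp.prod_add_index_of_disjoint]
  · rfl
  · simpa using h.disjoint_primeFactors

lemma mulCoeff_prime_pow {R : Type*} [CommMonoid R] {c : ℕ → R} (h0 : c 0 = 1) {p : ℕ}
    (hp : p.Prime) (j : ℕ) : mulCoeff c (p ^ j) = c j := by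
  rw [mulCoeff, hp.factorization_pow, Finsupp.prod_single_index h0]

lemma mulCoeff_nonneg {c : ℕ → ℝ} (hc : ∀ j, 0 ≤ c j) (n : ℕ) : 0 ≤ mulCoeff c n := by
  rw [mulCoeff, Finsupp.prod]
  exact Finset.prod_nonneg fun p _ => hc (n.factorization p)

lemma mulCoeff_sq (c : ℕ → ℝ) (n : ℕ) : mulCoeff (fun j => c j ^ 2) n = mulCoeff c n ^ 2 := by
  rw [mulCoeff, mulCoeff, Finsupp.prod, Finsupp.prod, Finset.prod_pow]

lemma mulCoeff_ofReal (c : ℕ → ℝ) (n : ℕ) :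
    mulCoeff (fun j => (c j : ℂ)) n = ((mulCoeff c n : ℝ) : ℂ) := by
  rw [mulCoeff, mulCoeff, Finsupp.prod, Finsupp.prod, Complex.ofReal_prod]

/-- The Euler product over the primes of a finite set, for a completely multiplicative `g`
twisted by `mulCoeff c`. -/
lemma hasSum_mulCoeff_mul {R : Type*} [NormedField R] [CompleteSpace R] {c : ℕ → R} (h0 : c 0 = 1)
    {g : ℕ → R} (g1 : g 1 = 1) (gmul : ∀ m n, g (m * n) = g m * g n)
    (hs : ∀ p : ℕ, p.Prime → Summable fun j => ‖c j * g p ^ j‖) (S : Finset ℕ) :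
    HasSum (fun m : Nat.factoredNumbers S => mulCoeff c m * g m)
      (∏ p ∈ S with p.Prime, ∑' j, c j * g p ^ j) := by
  have gpow : ∀ m j, g (m ^ j) = g m ^ j := by
    intro m j
    induction j with
    | zero => simpa using g1
    | succ j ih => rw [pow_succ, gmul, ih, pow_succ]
  have hp : ∀ p : ℕ, p.Prime → ∀ j : ℕ, mulCoeff c (p ^ j) * g (p ^ j) = c j * g p ^ j := by
    intro p hp j
    rw [mulCoeff_prime_pow h0 hp, gpow]
  have := (EulerProduct.summable_and_hasSum_factoredNumbers_prod_filter_prime_tsum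
    (f := fun n : ℕ => mulCoeff c n * g n) (by simp [mulCoeff_one, g1])
    (fun {m n} hmn => by
      simp only [mulCoeff_mul c hmn, gmul]
      ring)
    (fun {p} h => by simpa only [hp p h] using hs p h) S).2
  have e : ∏ p ∈ S with p.Prime, ∑' j, mulCoeff c (p ^ j) * g (p ^ j) =
      ∏ p ∈ S with p.Prime, ∑' j, c j * g p ^ j :=
    Finset.prod_congr rfl fun p h => tsum_congr fun j => hp p (Finset.mem_filter.1 h).2 j
  rwa [e] at this

/-- The coefficients of the power series of `(1 - z)^{-a}`. They are nonnegative for `a ≥ 0`. -/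
noncomputable def negBinomCoeff (a : ℝ) (j : ℕ) : ℝ := Ring.choose (a + j - 1) j

lemma negBinomCoeff_zero (a : ℝ) : negBinomCoeff a 0 = 1 := by simp [negBinomCoeff]

lemma negBinomCoeff_nonneg {a : ℝ} (ha : 0 ≤ a) (j : ℕ) : 0 ≤ negBinomCoeff a j := by
  rw [negBinomCoeff, ← Ring.multichoose_eq]
  have h := Ring.factorial_nsmul_multichoose_eq_ascPochhammer a j
  rw [Polynomial.ascPochhammer_smeval_eq_eval, nsmul_eq_mul] at h
  have h1 : 0 ≤ (ascPochhammer ℝ j).eval a := by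
    rcases ha.eq_or_lt with h | h
    · rw [← h, ascPochhammer_eval_zero]; split_ifs <;> norm_num
    · exact (ascPochhammer_pos j a h).le
  rw [← h] at h1
  exact nonneg_of_mul_nonneg_right h1 (by positivity)

lemma hasSum_negBinomCoeff (a : ℝ) {z : ℂ} (hz : ‖z‖ < 1) :
    HasSum (fun j => (negBinomCoeff a j : ℂ) * z ^ j) (1 / (1 - z) ^ (a : ℂ)) := by
  have h := (Complex.one_div_one_sub_cpow_hasFPowerSeriesOnBall_zero a).hasSum (y := z) (by
    simpa [enorm_eq_nnnorm, ← NNReal.coe_lt_coe] using hz)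
  simp only [zero_add, FormalMultilinearSeries.ofScalars_apply_eq, smul_eq_mul] at h
  have e : ∀ j : ℕ, (negBinomCoeff a j : ℂ) = Ring.choose ((a : ℂ) + j - 1) j := by
    intro j
    rw [negBinomCoeff]
    have := Ring.map_choose (Complex.ofRealHom) (a + j - 1) j
    simpa using this
  simp only [e]
  exact h

lemma hasSum_negBinomCoeff_real (a : ℝ) {r : ℝ} (h0 : 0 ≤ r) (h1 : r < 1) :
    HasSum (fun j => negBinomCoeff a j * r ^ j) ((1 - r) ^ (-a)) := by
  have h := hasSum_negBinomCoeff a (z := r) (by rwa [Complex.norm_real, Real.norm_eq_abs, abs_of_nonneg h0])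
  rw [← Complex.hasSum_ofReal]
  convert h using 1
  · funext j; push_cast; ring
  · rw [Real.rpow_neg (by linarith), one_div, Complex.ofReal_inv, Complex.ofReal_cpow (by linarith)]
    push_cast
    rfl

/-- The mean of `‖1 - r e(θ)‖^{-k}` over the circle. -/
noncomputable def localMoment (k r : ℝ) : ℝ :=
  ∫ θ in (0 : ℝ)..1, ‖1 - (r : ℂ) * Complex.exp (2 * Real.pi * θ * Complex.I)‖ ^ (-k)

lemma norm_one_div_cpow_sq (k : ℝ) (z : ℂ) :
    ‖1 / z ^ ((k / 2 : ℝ) : ℂ)‖ ^ 2 = ‖z‖ ^ (-k) := by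
  rw [norm_div, norm_one, Complex.norm_cpow_real, one_div, ← Real.rpow_neg (norm_nonneg _),
    ← Real.rpow_natCast, ← Real.rpow_mul (norm_nonneg _)]
  congr 1
  push_cast
  ring

/-- Parseval's identity for `(1 - r e(θ))^{-k/2}`. -/
lemma localMoment_eq_tsum {k r : ℝ} (hk : 0 ≤ k) (h0 : 0 ≤ r) (h1 : r < 1) :
    localMoment k r = ∑' j, negBinomCoeff (k / 2) j ^ 2 * (r ^ 2) ^ j := by
  have hc := negBinomCoeff_nonneg (a := k / 2) (by linarith)
  have hs := hasSum_negBinomCoeff_real (k / 2) h0 h1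
  have key := abs_integral_norm_sq_tsum_sub_le (b := fun j => negBinomCoeff (k / 2) j * r ^ j)
    (ω := fun _ => 0) (fun j => mul_nonneg (hc j) (by positivity)) hs.summable
    (fun j => 2 * Real.pi * j) (u := 0) (v := 1) (T := 1) zero_le_one (fun _ => le_rfl)
    (by simp) ?_
  · simp only [mul_zero, tsum_zero, one_mul] at key
    rw [zero_pow two_ne_zero] at key
    have := abs_eq_zero.1 (le_antisymm key (abs_nonneg _))
    rw [sub_eq_zero] at this
    calc localMoment k r = _ := by
          rw [localMoment]
          refine intervalIntegral.integral_congr fun θ _ => ?_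
          have hz : ‖(r : ℂ) * Complex.exp (2 * Real.pi * θ * Complex.I)‖ < 1 := by
            rw [norm_mul, show (2 * Real.pi * θ * Complex.I : ℂ) =
              ((2 * Real.pi * θ : ℝ) : ℂ) * Complex.I by push_cast; ring,
              Complex.norm_exp_ofReal_mul_I, mul_one, Complex.norm_real, Real.norm_eq_abs,
              abs_of_nonneg h0]
            exact h1
          rw [← norm_one_div_cpow_sq, ← (hasSum_negBinomCoeff (k / 2) hz).tsum_eq]
          congr 2
          refine tsum_congr fun j => ?_
          rw [mul_pow, ← Complex.exp_nat_mul]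
          rw [show (j : ℂ) * (2 * Real.pi * θ * Complex.I) =
            Complex.I * ((2 * Real.pi * j : ℝ) : ℂ) * θ by push_cast; ring]
          push_cast
          ring
      _ = _ := this
      _ = _ := tsum_congr fun j => by ring
  · intro i j
    rw [mul_zero]
    by_cases hij : i = j
    · simp [hij]
    · have hx : ((2 * Real.pi * i - 2 * Real.pi * j : ℝ) : ℂ) ≠ 0 := by
        have : (i : ℝ) ≠ j := by exact_mod_cast hij
        rw [Ne, Complex.ofReal_eq_zero, ← mul_sub]
        exact mul_ne_zero (by positivity) (sub_ne_zero.2 this)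
      have he : Complex.exp (Complex.I * ((2 * Real.pi * i - 2 * Real.pi * j : ℝ) : ℂ)) = 1 := by
        rw [Complex.exp_eq_one_iff]
        exact ⟨i - j, by push_cast; ring⟩
      rw [if_neg hij, integral_exp_mul_complex (mul_ne_zero Complex.I_ne_zero hx)]
      simp only [Complex.ofReal_one, Complex.ofReal_zero, mul_one, mul_zero, Complex.exp_zero]
      simp only [he, sub_self, zero_div, norm_zero, le_refl]

/-! ### The moment as a product of local moments -/

lemma rpow_neg_natCast_lt_one {τ : ℝ} (hτ : 0 < τ) {p : ℕ} (hp : 1 < p) : (p : ℝ) ^ (-τ) < 1 :=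
  Real.rpow_lt_one_of_one_lt_of_neg (by exact_mod_cast hp) (by linarith)

lemma hasSum_mulCoeff_negBinomCoeff_rpow {a τ : ℝ} (ha : 0 ≤ a) (hτ : 0 < τ) (S : Finset ℕ) :
    HasSum (fun m : Nat.factoredNumbers S =>
        mulCoeff (negBinomCoeff a) m * ((m : ℕ) : ℝ) ^ (-τ))
      (∏ p ∈ S with p.Prime, (1 - (p : ℝ) ^ (-τ)) ^ (-a)) := by
  have hloc : ∀ p : ℕ, p.Prime → HasSum (fun j => negBinomCoeff a j * ((p : ℝ) ^ (-τ)) ^ j)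
      ((1 - (p : ℝ) ^ (-τ)) ^ (-a)) := fun p hp =>
    hasSum_negBinomCoeff_real a (by positivity) (rpow_neg_natCast_lt_one hτ hp.one_lt)
  have h := hasSum_mulCoeff_mul (negBinomCoeff_zero a) (g := fun n : ℕ => (n : ℝ) ^ (-τ)) (by simp)
    (fun m n => by push_cast; exact Real.mul_rpow (by positivity) (by positivity))
    (fun p hp => (hloc p hp).summable.congr fun j => by
      rw [Real.norm_of_nonneg (mul_nonneg (negBinomCoeff_nonneg ha j) (by positivity))]) S
  rwa [Finset.prod_congr rfl fun p hp => (hloc p (Finset.mem_filter.1 hp).2).tsum_eq] at h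

lemma hasSum_mulCoeff_negBinomCoeff_sq {k σ : ℝ} (hk : 0 ≤ k) (hσ : 0 < σ) (S : Finset ℕ) :
    HasSum (fun m : Nat.factoredNumbers S =>
        (mulCoeff (negBinomCoeff (k / 2)) m * ((m : ℕ) : ℝ) ^ (-σ)) ^ 2)
      (∏ p ∈ S with p.Prime, localMoment k ((p : ℝ) ^ (-σ))) := by
  have hc := negBinomCoeff_nonneg (a := k / 2) (by linarith)
  have h := hasSum_mulCoeff_mul (c := fun j => negBinomCoeff (k / 2) j ^ 2)
    (by simp [negBinomCoeff_zero]) (g := fun n : ℕ => ((n : ℝ) ^ (-σ)) ^ 2) (by simp)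
    (fun m n => by
      push_cast
      rw [Real.mul_rpow (by positivity) (by positivity), mul_pow])
    (fun p hp => by
      have h1 := (hasSum_negBinomCoeff_real (k / 2) (r := (p : ℝ) ^ (-σ)) (by positivity)
        (rpow_neg_natCast_lt_one hσ hp.one_lt)).summable
      refine (summable_sq_of_nonneg (fun j => mul_nonneg (hc j) (by positivity)) h1).congr
        fun j => ?_
      rw [Real.norm_of_nonneg (by positivity)]
      ring) S
  rw [Finset.prod_congr rfl fun (p : ℕ) hp => (localMoment_eq_tsum hk (r := (p : ℝ) ^ (-σ))
    (by positivity) (rpow_neg_natCast_lt_one hσ (Finset.mem_filter.1 hp).2.one_lt)).symm] at h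
  convert! h using 2 with m
  rw [mulCoeff_sq, mul_pow]

lemma hasSum_mulCoeff_negBinomCoeff_cpow {a : ℝ} (ha : 0 ≤ a) {s : ℂ} (hs : 0 < s.re)
    (S : Finset ℕ) :
    HasSum (fun m : Nat.factoredNumbers S =>
        ((mulCoeff (negBinomCoeff a) m : ℝ) : ℂ) * ((m : ℕ) : ℂ) ^ (-s))
      (∏ p ∈ S with p.Prime, 1 / (1 - (p : ℂ) ^ (-s)) ^ (a : ℂ)) := by
  have hn : ∀ p : ℕ, p.Prime → ‖(p : ℂ) ^ (-s)‖ < 1 := fun p hp => by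
    rw [Complex.norm_natCast_cpow_of_pos hp.pos, Complex.neg_re]
    exact rpow_neg_natCast_lt_one hs hp.one_lt
  have hloc : ∀ p : ℕ, p.Prime → HasSum (fun j => (negBinomCoeff a j : ℂ) * ((p : ℂ) ^ (-s)) ^ j)
      (1 / (1 - (p : ℂ) ^ (-s)) ^ (a : ℂ)) := fun p hp => hasSum_negBinomCoeff a (hn p hp)
  have h := hasSum_mulCoeff_mul (c := fun j => (negBinomCoeff a j : ℂ))
    (by simp [negBinomCoeff_zero]) (g := fun n : ℕ => (n : ℂ) ^ (-s)) (by simp)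
    (fun m n => by push_cast; exact Complex.natCast_mul_natCast_cpow m n _)
    (fun p hp => (hasSum_negBinomCoeff_real a (norm_nonneg _) (hn p hp)).summable.congr fun j => by
      rw [norm_mul, norm_pow, Complex.norm_real, Real.norm_of_nonneg (negBinomCoeff_nonneg ha j)]) S
  rw [Finset.prod_congr rfl fun p hp => (hloc p (Finset.mem_filter.1 hp).2).tsum_eq] at h
  simpa only [mulCoeff_ofReal] using h

lemma norm_shortEulerProduct_rpow (s : ℂ) (y k : ℝ) :
    ‖shortEulerProduct s y‖ ^ k = ∏ p ∈ primesUpTo y, ‖1 - (p : ℂ) ^ (-s)‖ ^ (-k) := by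
  rw [shortEulerProduct, norm_prod, ← Real.finsetProd_rpow _ _ (fun _ _ => norm_nonneg _)]
  refine Finset.prod_congr rfl fun p _ => ?_
  rw [norm_inv, Real.inv_rpow (norm_nonneg _), ← Real.rpow_neg (norm_nonneg _), one_div,
    Complex.cpow_neg]

/-- The moment is close to the product of the local moments: with the Dirichlet series of
`ζ(s; y)^{k/2}` over the integers all of whose primes are `≤ y`, the diagonal terms give this product,
and the frequencies `log m`, `log n` of the other terms are at distance at least `1 / (m n)`. -/
lemma abs_shortEulerMoment_sub_prod_le {σ δ T k : ℝ} (y : ℝ) (hδ : 0 < δ) (hδ1 : δ ≤ 1)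
    (hδσ : δ < σ) (hT : 0 < T) (hk : 0 ≤ k) :
    |shortEulerMoment σ T y k - ∏ p ∈ primesUpTo y, localMoment k ((p : ℝ) ^ (-σ))| ≤
      2 * T ^ (-δ) * ∏ p ∈ primesUpTo y, (1 - (p : ℝ) ^ (-(σ - δ))) ^ (-k) := by
  set S := Finset.Icc 1 ⌊y⌋₊ with hS
  have hσ : 0 < σ := hδ.trans hδσ
  have hk2 : 0 ≤ k / 2 := by linarith
  have hc := mulCoeff_nonneg (negBinomCoeff_nonneg hk2)
  set b : Nat.factoredNumbers S → ℝ := fun m =>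
    mulCoeff (negBinomCoeff (k / 2)) m * ((m : ℕ) : ℝ) ^ (-σ) with hb
  set ω : Nat.factoredNumbers S → ℝ := fun m =>
    Real.sqrt (2 * T ^ (1 - δ)) * ((m : ℕ) : ℝ) ^ δ with hω
  set W := ∏ p ∈ primesUpTo y, (1 - (p : ℝ) ^ (-(σ - δ))) ^ (-(k / 2)) with hW
  have hm0 : ∀ m : Nat.factoredNumbers S, (m : ℕ) ≠ 0 := fun m => m.2.1
  have hmpos : ∀ m : Nat.factoredNumbers S, (0 : ℝ) < (m : ℕ) := fun m => by
    exact_mod_cast Nat.pos_of_ne_zero (hm0 m)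
  have hsb := hasSum_mulCoeff_negBinomCoeff_rpow hk2 hσ S
  have hsω : HasSum (fun m => b m * ω m) (Real.sqrt (2 * T ^ (1 - δ)) * W) := by
    have := (hasSum_mulCoeff_negBinomCoeff_rpow hk2 (sub_pos.2 hδσ) S).mul_left
      (Real.sqrt (2 * T ^ (1 - δ)))
    convert! this using 2 with m
    simp only [hb, hω]
    rw [neg_sub, show δ - σ = -σ + δ by ring, Real.rpow_add (hmpos m)]
    ring
  have hsq := hasSum_mulCoeff_negBinomCoeff_sq hk hσ S
  have key := abs_integral_norm_sq_tsum_sub_le (b := b) (ω := ω)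
    (fun m => mul_nonneg (hc m) (by positivity)) hsb.summable
    (fun m => -Real.log (m : ℕ)) (u := T) (v := 2 * T) (T := T) (by linarith)
    (fun m => by positivity) hsω.summable ?_
  · rw [hsω.tsum_eq, hsq.tsum_eq, mul_pow, Real.sq_sqrt (by positivity)] at key
    have hint : ∫ t in T..(2 * T), ‖∑' m, (b m : ℂ) *
        Complex.exp (Complex.I * ((-Real.log (m : ℕ) : ℝ) : ℂ) * t)‖ ^ 2 =
        ∫ t in T..(2 * T), ‖shortEulerProduct ((σ : ℂ) + Complex.I * (t : ℂ)) y‖ ^ k := by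
      refine intervalIntegral.integral_congr fun t _ => ?_
      set s : ℂ := (σ : ℂ) + Complex.I * (t : ℂ) with hs
      have hre : 0 < s.re := by simpa [hs] using hσ
      have h := hasSum_mulCoeff_negBinomCoeff_cpow hk2 hre S
      have e : ∀ m : Nat.factoredNumbers S, (b m : ℂ) *
          Complex.exp (Complex.I * ((-Real.log (m : ℕ) : ℝ) : ℂ) * t) =
          ((mulCoeff (negBinomCoeff (k / 2)) m : ℝ) : ℂ) * ((m : ℕ) : ℂ) ^ (-s) := by
        intro m
        have hmc : ((m : ℕ) : ℂ) ≠ 0 := by exact_mod_cast hm0 m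
        rw [hb, hs, neg_add, Complex.cpow_add _ _ hmc, Complex.ofReal_mul,
          Complex.ofReal_cpow (hmpos m).le, mul_assoc]
        congr 2
        · push_cast; rfl
        · rw [Complex.cpow_def_of_ne_zero hmc, ← Complex.natCast_log]
          congr 1
          push_cast
          ring
      simp only [e]
      rw [h.tsum_eq, norm_prod, ← Finset.prod_pow, norm_shortEulerProduct_rpow]
      exact Finset.prod_congr rfl fun p _ => norm_one_div_cpow_sq _ _
    have hWW : W ^ 2 = ∏ p ∈ primesUpTo y, (1 - (p : ℝ) ^ (-(σ - δ))) ^ (-k) := by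
      rw [hW, ← Finset.prod_pow]
      refine Finset.prod_congr rfl fun p hp => ?_
      have : 0 ≤ 1 - (p : ℝ) ^ (-(σ - δ)) :=
        (sub_pos.2 (rpow_neg_natCast_lt_one (sub_pos.2 hδσ) (mem_primesUpTo.1 hp).2.one_lt)).le
      rw [← Real.rpow_natCast, ← Real.rpow_mul this]
      congr 1
      push_cast
      ring
    rw [hint, hWW] at key
    rw [shortEulerMoment]
    set I := ∫ t in T..(2 * T), ‖shortEulerProduct ((σ : ℂ) + Complex.I * (t : ℂ)) y‖ ^ k
    set Q := ∏ p ∈ primesUpTo y, (1 - (p : ℝ) ^ (-(σ - δ))) ^ (-k)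
    have key' : |I - T * ∏ p ∈ primesUpTo y, localMoment k ((p : ℝ) ^ (-σ))| ≤
      2 * T ^ (1 - δ) * Q := key
    set D := ∏ p ∈ primesUpTo y, localMoment k ((p : ℝ) ^ (-σ))
    have e1 : 1 / T * I - D = 1 / T * (I - T * D) := by field_simp
    rw [e1, abs_mul, abs_of_pos (by positivity)]
    calc 1 / T * |I - T * D| ≤ 1 / T * (2 * T ^ (1 - δ) * Q) := by gcongr
      _ = _ := by
        rw [show (1 : ℝ) - δ = -δ + 1 by ring, Real.rpow_add_one hT.ne']
        field_simp
  · intro m n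
    by_cases hmn : m = n
    · rw [if_pos hmn, hmn, sub_self]
      have : (∫ t in T..(2 * T), Complex.exp (Complex.I * ((0 : ℝ) : ℂ) * t)) = (T : ℂ) := by
        simp
        ring
      rw [this, sub_self, norm_zero]
      positivity
    · have hmn' : (m : ℕ) ≠ n := fun h => hmn (Subtype.ext h)
      rw [if_neg hmn, Complex.ofReal_zero, sub_zero]
      have hlow := inv_mul_le_abs_log_sub_log (hm0 m) (hm0 n) hmn'
      have hmp := hmpos m
      have hnp := hmpos n
      have hpos : 0 < |Real.log (m : ℕ) - Real.log (n : ℕ)| := lt_of_lt_of_le (by positivity) hlow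
      have hx : -Real.log (m : ℕ) - -Real.log (n : ℕ) ≠ 0 := by
        intro h
        rw [show Real.log (m : ℕ) - Real.log (n : ℕ) = 0 by linarith, abs_zero] at hpos
        exact lt_irrefl _ hpos
      refine (norm_integral_exp_le hT hx hδ.le hδ1).trans ?_
      rw [show -Real.log (m : ℕ) - -Real.log (n : ℕ) = -(Real.log (m : ℕ) - Real.log (n : ℕ)) by ring,
        abs_neg]
      calc _ ≤ 2 * T ^ (1 - δ) * (((m : ℕ) : ℝ) * (n : ℕ))⁻¹ ^ (-δ) := by
            refine mul_le_mul_of_nonneg_left ?_ (by positivity)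
            exact Real.rpow_le_rpow_of_nonpos (by positivity) hlow (by linarith)
        _ = _ := by
            rw [hω, Real.inv_rpow (by positivity), Real.rpow_neg (by positivity), inv_inv,
              Real.mul_rpow hmp.le hnp.le]
            have := Real.mul_self_sqrt (show 0 ≤ 2 * T ^ (1 - δ) by positivity)
            calc _ = (Real.sqrt (2 * T ^ (1 - δ)) * Real.sqrt (2 * T ^ (1 - δ))) *
                  (((m : ℕ) : ℝ) ^ δ * ((n : ℕ) : ℝ) ^ δ) := by rw [this]
              _ = _ := by ring

/-! ### The logarithm of the moment -/

lemma abs_log_norm_one_sub_add_re_le {z : ℂ} (hz : ‖z‖ ≤ 3 / 4) :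
    |Real.log ‖1 - z‖ + z.re| ≤ 2 * ‖z‖ ^ 2 := by
  have h := Complex.norm_log_one_add_sub_self_le (z := -z) (by rw [norm_neg]; linarith)
  rw [norm_neg, sub_neg_eq_add, ← sub_eq_add_neg] at h
  have h1 := (Complex.abs_re_le_norm _).trans h
  rw [Complex.add_re, Complex.log_re] at h1
  refine h1.trans ?_
  have h2 : (1 - ‖z‖)⁻¹ ≤ 4 := by
    rw [inv_le_comm₀ (by linarith) (by norm_num)]
    linarith
  nlinarith [sq_nonneg ‖z‖]

lemma one_sub_ne_zero_of_norm_le {z : ℂ} (hz : ‖z‖ ≤ 3 / 4) : 1 - z ≠ 0 := by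
  intro h
  rw [← sub_eq_zero.1 h, norm_one] at hz
  norm_num at hz

lemma norm_one_sub_rpow_bounds {z : ℂ} (hz : ‖z‖ ≤ 3 / 4) {k : ℝ} (hk : 0 ≤ k) :
    Real.exp (k * z.re - 2 * k * ‖z‖ ^ 2) ≤ ‖1 - z‖ ^ (-k) ∧
      ‖1 - z‖ ^ (-k) ≤ Real.exp (k * z.re + 2 * k * ‖z‖ ^ 2) := by
  have h := abs_le.1 (abs_log_norm_one_sub_add_re_le hz)
  rw [Real.rpow_def_of_pos (norm_pos_iff.2 (one_sub_ne_zero_of_norm_le hz))]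
  constructor <;> apply Real.exp_le_exp.2 <;> nlinarith

lemma norm_ofReal_mul_exp {r : ℝ} (h0 : 0 ≤ r) (θ : ℝ) :
    ‖(r : ℂ) * Complex.exp (2 * Real.pi * θ * Complex.I)‖ = r := by
  rw [norm_mul, show (2 * Real.pi * θ * Complex.I : ℂ) = ((2 * Real.pi * θ : ℝ) : ℂ) * Complex.I by
    push_cast; ring, Complex.norm_exp_ofReal_mul_I, mul_one, Complex.norm_real,
    Real.norm_of_nonneg h0]

lemma re_ofReal_mul_exp (r θ : ℝ) :
    ((r : ℂ) * Complex.exp (2 * Real.pi * θ * Complex.I)).re = r * Real.cos (2 * Real.pi * θ) := by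
  rw [show (2 * Real.pi * θ * Complex.I : ℂ) = ((2 * Real.pi * θ : ℝ) : ℂ) * Complex.I by
    push_cast; ring, Complex.re_ofReal_mul, Complex.exp_ofReal_mul_I_re]

/-- `‖1 - z‖^{-k}` is `exp(k Re z)` up to `exp(O(k‖z‖²))`, and the mean of `exp(k r cos(2πθ))` is
`I₀(k r)`. -/
lemma abs_log_localMoment_sub_le {k r : ℝ} (hk : 0 ≤ k) (h0 : 0 ≤ r) (h1 : r ≤ 3 / 4) :
    0 < localMoment k r ∧ |Real.log (localMoment k r) - logBessel (k * r)| ≤ 2 * k * r ^ 2 := by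
  have hc : Continuous fun θ : ℝ =>
      ‖1 - (r : ℂ) * Complex.exp (2 * Real.pi * θ * Complex.I)‖ ^ (-k) := by
    refine Continuous.rpow_const (by fun_prop) fun θ => Or.inl ?_
    exact (norm_pos_iff.2 (one_sub_ne_zero_of_norm_le (by rwa [norm_ofReal_mul_exp h0]))).ne'
  have hb := fun θ : ℝ => norm_one_sub_rpow_bounds
    (z := (r : ℂ) * Complex.exp (2 * Real.pi * θ * Complex.I))
    (by rwa [norm_ofReal_mul_exp h0]) hk
  have he : Continuous fun θ : ℝ => Real.exp (k * r * Real.cos (2 * Real.pi * θ)) := by fun_prop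
  have hI := one_le_besselIZero (k * r)
  have hlow : Real.exp (-(2 * k * r ^ 2)) * besselIZero (k * r) ≤ localMoment k r := by
    rw [besselIZero, localMoment, ← intervalIntegral.integral_const_mul]
    refine intervalIntegral.integral_mono_on zero_le_one
      ((he.const_mul _).intervalIntegrable _ _) (hc.intervalIntegrable _ _) fun θ _ => ?_
    refine le_trans (le_of_eq ?_) (hb θ).1
    rw [norm_ofReal_mul_exp h0, re_ofReal_mul_exp, ← Real.exp_add]
    ring_nf
  have hup : localMoment k r ≤ Real.exp (2 * k * r ^ 2) * besselIZero (k * r) := by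
    rw [besselIZero, localMoment, ← intervalIntegral.integral_const_mul]
    refine intervalIntegral.integral_mono_on zero_le_one (hc.intervalIntegrable _ _)
      ((he.const_mul _).intervalIntegrable _ _) fun θ _ => ?_
    refine (hb θ).2.trans (le_of_eq ?_)
    rw [norm_ofReal_mul_exp h0, re_ofReal_mul_exp, ← Real.exp_add]
    ring_nf
  have hI0 : 0 < besselIZero (k * r) := by linarith
  have hpos : 0 < localMoment k r := lt_of_lt_of_le (by positivity) hlow
  refine ⟨hpos, ?_⟩
  have l1 := Real.log_le_log (by positivity) hlow
  have l2 := Real.log_le_log hpos hup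
  rw [Real.log_mul (Real.exp_pos _).ne' hI0.ne', Real.log_exp] at l1 l2
  rw [logBessel, abs_le]
  constructor <;> linarith

lemma one_le_localMoment {k r : ℝ} (hk : 0 ≤ k) (h0 : 0 ≤ r) (h1 : r < 1) :
    1 ≤ localMoment k r := by
  have hc := negBinomCoeff_nonneg (a := k / 2) (by linarith)
  have hs := summable_sq_of_nonneg (fun j => mul_nonneg (hc j) (by positivity))
    (hasSum_negBinomCoeff_real (k / 2) h0 h1).summable
  have hs' : Summable fun j => negBinomCoeff (k / 2) j ^ 2 * (r ^ 2) ^ j :=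
    hs.congr fun j => by ring
  rw [localMoment_eq_tsum hk h0 h1]
  have := hs'.le_tsum 0 (fun j _ => by positivity)
  simpa [negBinomCoeff_zero] using this

lemma rpow_neg_prime_le {τ : ℝ} (hτ : 1 / 2 ≤ τ) {p : ℕ} (hp : p.Prime) :
    (p : ℝ) ^ (-τ) ≤ 3 / 4 := by
  have h2 : (2 : ℝ) ≤ p := by exact_mod_cast hp.two_le
  calc (p : ℝ) ^ (-τ) ≤ (p : ℝ) ^ (-(1 / 2 : ℝ)) :=
        Real.rpow_le_rpow_of_exponent_le (by linarith) (by linarith)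
    _ ≤ 2 ^ (-(1 / 2 : ℝ)) := Real.rpow_le_rpow_of_nonpos (by norm_num) h2 (by norm_num)
    _ ≤ 3 / 4 := by
      refine (pow_le_pow_iff_left₀ (by positivity) (by norm_num) two_ne_zero).1 ?_
      rw [← Real.rpow_natCast, ← Real.rpow_mul (by norm_num)]
      norm_num

lemma sum_primesUpTo_rpow_neg_sq_le {τ : ℝ} (hτ : 1 / 2 < τ) (y : ℝ) :
    ∑ p ∈ primesUpTo y, ((p : ℝ) ^ (-τ)) ^ 2 ≤ ∑' n : ℕ, (n : ℝ) ^ (-(2 * τ)) := by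
  have hs : Summable fun n : ℕ => (n : ℝ) ^ (-(2 * τ)) := Real.summable_nat_rpow.2 (by linarith)
  calc _ = ∑ p ∈ primesUpTo y, (p : ℝ) ^ (-(2 * τ)) := Finset.sum_congr rfl fun p _ => by
        rw [← Real.rpow_natCast, ← Real.rpow_mul (by positivity)]
        congr 1
        push_cast
        ring
    _ ≤ _ := hs.sum_le_tsum _ fun n _ => by positivity

lemma prod_one_sub_rpow_le {τ : ℝ} (hτ : 1 / 2 < τ) {k : ℝ} (hk : 0 ≤ k) (y : ℝ) :
    ∏ p ∈ primesUpTo y, (1 - (p : ℝ) ^ (-τ)) ^ (-k) ≤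
      Real.exp (k * ∑ p ∈ primesUpTo y, (p : ℝ) ^ (-τ) + 2 * k * ∑' n : ℕ, (n : ℝ) ^ (-(2 * τ))) := by
  calc _ ≤ ∏ p ∈ primesUpTo y,
        Real.exp (k * (p : ℝ) ^ (-τ) + 2 * k * ((p : ℝ) ^ (-τ)) ^ 2) := by
        refine Finset.prod_le_prod (fun p hp => ?_) fun p hp => ?_
        · have := rpow_neg_prime_le hτ.le (mem_primesUpTo.1 hp).2
          have : 0 ≤ 1 - (p : ℝ) ^ (-τ) := by linarith
          positivity
        · have h1 := rpow_neg_prime_le hτ.le (mem_primesUpTo.1 hp).2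
          have h2 : 0 ≤ (p : ℝ) ^ (-τ) := by positivity
          have hn : ‖(((p : ℝ) ^ (-τ) : ℝ) : ℂ)‖ = (p : ℝ) ^ (-τ) := by
            rw [Complex.norm_real, Real.norm_of_nonneg h2]
          have h := (norm_one_sub_rpow_bounds (z := (((p : ℝ) ^ (-τ) : ℝ) : ℂ)) (by rwa [hn]) hk).2
          rwa [hn, Complex.ofReal_re, ← Complex.ofReal_one, ← Complex.ofReal_sub, Complex.norm_real,
            Real.norm_of_nonneg (by linarith)] at h
    _ = Real.exp (k * ∑ p ∈ primesUpTo y, (p : ℝ) ^ (-τ) +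
          2 * k * ∑ p ∈ primesUpTo y, ((p : ℝ) ^ (-τ)) ^ 2) := by
        rw [← Real.exp_sum, Finset.sum_add_distrib, ← Finset.mul_sum, ← Finset.mul_sum]
    _ ≤ _ := by
        have := sum_primesUpTo_rpow_neg_sq_le hτ y
        gcongr

lemma abs_log_prod_localMoment_sub_le {σ : ℝ} (hσ : 1 / 2 < σ) {k : ℝ} (hk : 0 ≤ k) (y : ℝ) :
    |Real.log (∏ p ∈ primesUpTo y, localMoment k ((p : ℝ) ^ (-σ))) -
      ∑ p ∈ primesUpTo y, logBessel (k * (p : ℝ) ^ (-σ))| ≤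
      2 * k * ∑' n : ℕ, (n : ℝ) ^ (-(2 * σ)) := by
  have h := fun p (hp : p ∈ primesUpTo y) => abs_log_localMoment_sub_le hk
    (r := (p : ℝ) ^ (-σ)) (by positivity) (rpow_neg_prime_le hσ.le (mem_primesUpTo.1 hp).2)
  rw [Real.log_prod fun p hp => (h p hp).1.ne', ← Finset.sum_sub_distrib]
  calc _ ≤ ∑ p ∈ primesUpTo y, 2 * k * ((p : ℝ) ^ (-σ)) ^ 2 :=
        (Finset.abs_sum_le_sum_abs _ _).trans (Finset.sum_le_sum fun p hp => (h p hp).2)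
    _ ≤ _ := by
        rw [← Finset.mul_sum]
        exact mul_le_mul_of_nonneg_left (sum_primesUpTo_rpow_neg_sq_le hσ y) (by linarith)

/-- The pointwise bound for `|ζ(σ + it; y)|`, which holds for all `T` and `y`. -/
lemma abs_log_shortEulerMoment_le {σ : ℝ} (hσ : 1 / 2 < σ) {k T : ℝ} (hk : 0 ≤ k) (hT : 0 < T)
    (y : ℝ) : 0 < shortEulerMoment σ T y k ∧
      |Real.log (shortEulerMoment σ T y k)| ≤ 4 * k * ∑ p ∈ primesUpTo y, (p : ℝ) ^ (-σ) := by
  set E := 4 * k * ∑ p ∈ primesUpTo y, (p : ℝ) ^ (-σ) with hE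
  set F : ℝ → ℝ := fun t => ‖shortEulerProduct ((σ : ℂ) + Complex.I * (t : ℂ)) y‖ ^ k with hF
  have hn : ∀ p ∈ primesUpTo y, ∀ t : ℝ,
      ‖(p : ℂ) ^ (-((σ : ℂ) + Complex.I * (t : ℂ)))‖ = (p : ℝ) ^ (-σ) := fun p hp t => by
    rw [Complex.norm_natCast_cpow_of_pos (mem_primesUpTo.1 hp).2.pos]
    simp
  have hn' : ∀ p ∈ primesUpTo y, ∀ t : ℝ,
      ‖(p : ℂ) ^ (-((σ : ℂ) + Complex.I * (t : ℂ)))‖ ≤ 3 / 4 := fun p hp t => by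
    rw [hn p hp]; exact rpow_neg_prime_le hσ.le (mem_primesUpTo.1 hp).2
  have hFe : F = fun t : ℝ => ∏ p ∈ primesUpTo y,
      ‖1 - (p : ℂ) ^ (-((σ : ℂ) + Complex.I * (t : ℂ)))‖ ^ (-k) :=
    funext fun t => norm_shortEulerProduct_rpow _ _ _
  have hFc : Continuous F := by
    rw [hFe]
    refine continuous_finsetProd _ fun p hp => Continuous.rpow_const ?_ fun t => Or.inl ?_
    · have hp0 : (p : ℂ) ≠ 0 := by exact_mod_cast (mem_primesUpTo.1 hp).2.ne_zero
      refine (continuous_const.sub (Continuous.const_cpow ?_ (Or.inl hp0))).norm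
      fun_prop
    · exact (norm_pos_iff.2 (one_sub_ne_zero_of_norm_le (hn' p hp t))).ne'
  have hloc : ∀ p ∈ primesUpTo y, ∀ t : ℝ,
      Real.exp (-(4 * k * (p : ℝ) ^ (-σ))) ≤
        ‖1 - (p : ℂ) ^ (-((σ : ℂ) + Complex.I * (t : ℂ)))‖ ^ (-k) ∧
      ‖1 - (p : ℂ) ^ (-((σ : ℂ) + Complex.I * (t : ℂ)))‖ ^ (-k) ≤
        Real.exp (4 * k * (p : ℝ) ^ (-σ)) := by
    intro p hp t
    have h := norm_one_sub_rpow_bounds (hn' p hp t) hk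
    have hre := abs_le.1 (Complex.abs_re_le_norm ((p : ℂ) ^ (-((σ : ℂ) + Complex.I * (t : ℂ)))))
    rw [hn p hp] at h hre
    have h34 := rpow_neg_prime_le hσ.le (mem_primesUpTo.1 hp).2
    set r := (p : ℝ) ^ (-σ) with hr
    have hr0 : 0 ≤ r := by positivity
    have hr2 : k * r ^ 2 ≤ k * r := mul_le_mul_of_nonneg_left (by nlinarith) hk
    have hkr : 0 ≤ k * r := mul_nonneg hk hr0
    have h3 := mul_le_mul_of_nonneg_left hre.1 hk
    have h4 := mul_le_mul_of_nonneg_left hre.2 hk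
    exact ⟨(Real.exp_le_exp.2 (by linarith)).trans h.1, h.2.trans (Real.exp_le_exp.2 (by linarith))⟩
  have hlow : ∀ t, Real.exp (-E) ≤ F t := by
    intro t
    rw [hFe, hE, Finset.mul_sum, ← Finset.sum_neg_distrib, Real.exp_sum]
    exact Finset.prod_le_prod (fun p _ => (Real.exp_pos _).le) fun p hp => (hloc p hp t).1
  have hup : ∀ t, F t ≤ Real.exp E := by
    intro t
    rw [hFe, hE, Finset.mul_sum, Real.exp_sum]
    exact Finset.prod_le_prod (fun p _ => by positivity) fun p hp => (hloc p hp t).2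
  have hI : T * Real.exp (-E) ≤ ∫ t in T..(2 * T), F t ∧
      ∫ t in T..(2 * T), F t ≤ T * Real.exp E := by
    have hc : ∀ c : ℝ, IntervalIntegrable (fun _ : ℝ => c) MeasureTheory.volume T (2 * T) :=
      fun c => continuous_const.intervalIntegrable _ _
    have h1 := intervalIntegral.integral_mono_on (a := T) (b := 2 * T) (by linarith)
      (hc _) (hFc.intervalIntegrable _ _) fun t _ => hlow t
    have h2 := intervalIntegral.integral_mono_on (a := T) (b := 2 * T) (by linarith)
      (hFc.intervalIntegrable _ _) (hc _) fun t _ => hup t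
    rw [intervalIntegral.integral_const, smul_eq_mul, show 2 * T - T = T by ring] at h1 h2
    exact ⟨h1, h2⟩
  have hm1 : Real.exp (-E) ≤ shortEulerMoment σ T y k := by
    rw [shortEulerMoment, one_div_mul_eq_div, le_div_iff₀ hT, mul_comm (Real.exp _)]
    exact hI.1
  have hm2 : shortEulerMoment σ T y k ≤ Real.exp E := by
    rw [shortEulerMoment, one_div_mul_eq_div, div_le_iff₀ hT, mul_comm (Real.exp _)]
    exact hI.2
  have hpos := (Real.exp_pos (-E)).trans_le hm1
  refine ⟨hpos, abs_le.2 ⟨(Real.le_log_iff_exp_le hpos).2 hm1, (Real.log_le_iff_le_exp hpos).2 hm2⟩⟩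

/-- In the range of the parameters, the off-diagonal terms are negligible as soon as `y` is large.
Put `W = y^{1-σ} / ((1-σ) log y)`, which tends to infinity. With the shift `δ = 1 / log y` the weights
`p^δ` are at most `e`, so that the product in the off-diagonal bound is at most `exp(4kW + O(k))`,
while the condition on the parameters says that `T^{-δ} ≤ exp(-8kW)`. -/
lemma exists_abs_log_shortEulerMoment_sub_le {σ : ℝ} (hσ : 1 / 2 < σ) (hσ' : σ < 1) :
    ∃ y₀ B : ℝ, 2 ≤ y₀ ∧ 0 < B ∧ ∀ T y k : ℝ, 3 ≤ T → y₀ ≤ y → 1 < k →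
      k * y ^ (1 - σ) ≤ 1 / 8 * (1 - σ) * Real.log T →
      |Real.log (shortEulerMoment σ T y k) - ∑ p ∈ primesUpTo y, logBessel (k * (p : ℝ) ^ (-σ))| ≤
        B * k := by
  obtain ⟨C, hC, hsum⟩ := exists_sum_primesUpTo_rpow_le (by linarith) hσ'
  have h1σ : 0 < 1 - σ := by linarith
  -- the shift `δ` is kept below `η`, so that `2(σ - δ) ≥ 1 + 2η` and the squares are summable
  set η := (σ - 1 / 2) / 2 with hη
  have hη0 : 0 < η := by rw [hη]; linarith
  set Z := ∑' n : ℕ, (n : ℝ) ^ (-(2 * (1 / 2 + η))) with hZ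
  have hZ0 : 0 ≤ Z := tsum_nonneg fun n => by positivity
  set Z' := ∑' n : ℕ, (n : ℝ) ^ (-(2 * σ)) with hZ'
  have hZ0' : 0 ≤ Z' := tsum_nonneg fun n => by positivity
  have ev1 : ∀ᶠ y : ℝ in Filter.atTop, max (max 1 (1 / η)) (3 * (1 - σ) * C) ≤ Real.log y :=
    Real.tendsto_log_atTop.eventually_ge_atTop _
  have ev2 := (isLittleO_log_rpow_atTop h1σ).bound
    (show 0 < 1 / ((1 - σ) * (Z + 1)) by positivity)
  obtain ⟨y₀, hy₀⟩ := Filter.eventually_atTop.1 (ev1.and ev2)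
  refine ⟨max y₀ 2, 2 * Z' + 1, le_max_right _ _, by positivity, fun T y k hT hy hk hkT => ?_⟩
  have hy2 : 2 ≤ y := (le_max_right _ _).trans hy
  obtain ⟨e1, e2⟩ := hy₀ y ((le_max_left _ _).trans hy)
  have hl1 : 1 ≤ Real.log y := (le_max_left _ _).trans ((le_max_left _ _).trans e1)
  have hlη : 1 / η ≤ Real.log y := (le_max_right _ _).trans ((le_max_left _ _).trans e1)
  have hlC : 3 * (1 - σ) * C ≤ Real.log y := (le_max_right _ _).trans e1
  have hy0 : 0 < y := by linarith
  have hl0 : 0 < Real.log y := by linarith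
  have hk0 : 0 ≤ k := by linarith
  have hT0 : 0 < T := by linarith
  rw [Real.norm_of_nonneg hl0.le, Real.norm_of_nonneg (by positivity), one_div_mul_eq_div,
    le_div_iff₀ (by positivity)] at e2
  set W := y ^ (1 - σ) / ((1 - σ) * Real.log y) with hW
  have hWZ : Z + 1 ≤ W := by
    rw [hW, le_div_iff₀ (by positivity)]
    linarith
  set δ := 1 / Real.log y with hδ
  have hδ0 : 0 < δ := by positivity
  have hδ1 : δ ≤ 1 := by rw [hδ, div_le_one hl0]; exact hl1
  have hδη : δ ≤ η := by
    rw [hδ, div_le_iff₀ hl0]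
    rw [div_le_iff₀ hη0] at hlη
    linarith
  have hτ : 1 / 2 + η ≤ σ - δ := by rw [hη] at hδη ⊢; linarith
  have hoff := abs_shortEulerMoment_sub_prod_le y hδ0 hδ1 (by linarith) hT0 hk0 (σ := σ)
  have hprod := prod_one_sub_rpow_le (τ := σ - δ) (by linarith) hk0 y
  have hZle : ∑' n : ℕ, (n : ℝ) ^ (-(2 * (σ - δ))) ≤ Z := by
    refine Summable.tsum_le_tsum (fun n => ?_) (Real.summable_nat_rpow.2 (by linarith))
      (Real.summable_nat_rpow.2 (by linarith))
    rcases Nat.eq_zero_or_pos n with h | h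
    · rw [h, Nat.cast_zero, Real.zero_rpow (by linarith), Real.zero_rpow (by linarith)]
    · exact Real.rpow_le_rpow_of_exponent_le (by exact_mod_cast h) (by linarith)
  have hsumle : ∑ p ∈ primesUpTo y, (p : ℝ) ^ (-(σ - δ)) ≤ 4 * W := by
    have hyδ : y ^ δ = Real.exp 1 := by
      rw [Real.rpow_def_of_pos hy0, hδ, mul_one_div_cancel hl0.ne']
    have he3 : Real.exp 1 ≤ 3 := by linarith [Real.exp_one_lt_d9]
    calc ∑ p ∈ primesUpTo y, (p : ℝ) ^ (-(σ - δ)) ≤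
          ∑ p ∈ primesUpTo y, Real.exp 1 * (p : ℝ) ^ (-σ) := by
          refine Finset.sum_le_sum fun p hp => ?_
          have hp' := mem_primesUpTo.1 hp
          have hp0 : (0 : ℝ) < p := by exact_mod_cast hp'.2.pos
          have hpy : (p : ℝ) ≤ y := (Nat.le_floor_iff hy0.le).1 hp'.1
          rw [show -(σ - δ) = δ + -σ by ring, Real.rpow_add hp0, ← hyδ]
          gcongr
      _ = Real.exp 1 * ∑ p ∈ primesUpTo y, (p : ℝ) ^ (-σ) := by rw [Finset.mul_sum]
      _ ≤ 3 * (W + C * (y ^ (1 - σ) / Real.log y ^ 2)) := by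
          have := hsum y hy2
          gcongr
      _ = 3 * W + W * (3 * (1 - σ) * C / Real.log y) := by rw [hW]; field_simp
      _ ≤ 3 * W + W * 1 := by
          gcongr
          rwa [div_le_one hl0]
      _ = 4 * W := by ring
  have hTδ : T ^ (-δ) ≤ Real.exp (-(8 * k * W)) := by
    rw [Real.rpow_def_of_pos hT0]
    apply Real.exp_le_exp.2
    have : 8 * k * W ≤ Real.log T * δ := by
      rw [hW, hδ, mul_one_div, ← mul_div_assoc, div_le_div_iff₀ (by positivity) hl0]
      have h8 : 8 * k * y ^ (1 - σ) ≤ (1 - σ) * Real.log T := by linarith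
      nlinarith
    linarith
  have hsmall : 2 * T ^ (-δ) * ∏ p ∈ primesUpTo y, (1 - (p : ℝ) ^ (-(σ - δ))) ^ (-k) ≤ 1 / 2 := by
    have h4 : Real.exp (-4) ≤ 1 / 4 := by
      rw [Real.exp_neg, inv_le_comm₀ (Real.exp_pos _) (by norm_num)]
      linarith [Real.add_one_le_exp 4]
    calc _ ≤ 2 * Real.exp (-(8 * k * W)) * Real.exp (k * (4 * W) + 2 * k * Z) := by
          have : Real.exp (k * ∑ p ∈ primesUpTo y, (p : ℝ) ^ (-(σ - δ)) +
              2 * k * ∑' n : ℕ, (n : ℝ) ^ (-(2 * (σ - δ)))) ≤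
              Real.exp (k * (4 * W) + 2 * k * Z) := by gcongr
          refine mul_le_mul (by linarith) (hprod.trans this) ?_ (by positivity)
          refine Finset.prod_nonneg fun p hp => Real.rpow_nonneg ?_ _
          linarith [rpow_neg_prime_le (τ := σ - δ) (by linarith) (mem_primesUpTo.1 hp).2]
      _ = 2 * Real.exp (k * (2 * Z - 4 * W)) := by
          rw [mul_assoc, ← Real.exp_add]
          ring_nf
      _ ≤ 2 * Real.exp (-4) := by
          gcongr
          nlinarith
      _ ≤ _ := by linarith
  set D := ∏ p ∈ primesUpTo y, localMoment k ((p : ℝ) ^ (-σ)) with hD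
  -- the off-diagonal terms are at most half of the diagonal
  have hD1 : 1 ≤ D := by
    calc (1 : ℝ) = ∏ p ∈ primesUpTo y, 1 := Finset.prod_const_one.symm
      _ ≤ D := Finset.prod_le_prod (fun _ _ => zero_le_one) fun p hp =>
        one_le_localMoment hk0 (by positivity)
          (rpow_neg_natCast_lt_one (by linarith) (mem_primesUpTo.1 hp).2.one_lt)
  have hlogD := abs_log_prod_localMoment_sub_le hσ hk0 y
  rw [← hD, ← hZ'] at hlogD
  set m := shortEulerMoment σ T y k with hm
  have hmD := abs_le.1 (hoff.trans hsmall)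
  have hlog : |Real.log m - Real.log D| ≤ 1 := by
    have hD0 : 0 < D := by linarith
    have hm1 : D / 2 ≤ m := by linarith [hmD.1]
    have hm2 : m ≤ 2 * D := by linarith [hmD.2]
    have hm0 : 0 < m := by linarith
    have l1 := Real.log_le_log (by linarith) hm1
    have l2 := Real.log_le_log hm0 hm2
    rw [Real.log_div hD0.ne' (by norm_num)] at l1
    rw [Real.log_mul (by norm_num) hD0.ne'] at l2
    have := Real.log_two_lt_d9
    rw [abs_le]
    constructor <;> linarith
  calc _ ≤ |Real.log m - Real.log D| +
        |Real.log D - ∑ p ∈ primesUpTo y, logBessel (k * (p : ℝ) ^ (-σ))| := abs_sub_le _ _ _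
    _ ≤ 1 + 2 * k * Z' := add_le_add hlog hlogD
    _ ≤ _ := by linarith

/-! ### The expansion -/

lemma primesUpTo_subset {y z : ℝ} (h : y ≤ z) : primesUpTo y ⊆ primesUpTo z := fun p hp => by
  rw [mem_primesUpTo] at hp ⊢
  exact ⟨hp.1.trans (Nat.floor_le_floor h), hp.2⟩

lemma primesUpTo_eq_empty {y : ℝ} (h : y < 2) : primesUpTo y = ∅ := by
  refine Finset.eq_empty_of_forall_notMem fun p hp => ?_
  rw [mem_primesUpTo] at hp
  have h1 : ⌊y⌋₊ < 2 := (Nat.floor_lt' two_ne_zero).2 (by exact_mod_cast h)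
  have := hp.2.two_le
  omega

/-- For bounded `k` the moment is bounded from above and from below, so that the expansion is
trivial: the error term does not tend to zero there. -/
lemma exists_abs_log_shortEulerMoment_le_of_le {σ : ℝ} (hσ : 1 / 2 < σ) (hσ' : σ < 1) (k₀ : ℝ) :
    ∃ B : ℝ, 0 < B ∧ ∀ T y k : ℝ, 3 ≤ T → 1 < k → k ≤ k₀ →
      k * y ^ (1 - σ) ≤ 1 / 8 * (1 - σ) * Real.log T →
      |Real.log (shortEulerMoment σ T y k)| ≤ B := by
  obtain ⟨y₀, B, -, hB, h⟩ := exists_abs_log_shortEulerMoment_sub_le hσ hσ'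
  set Z := ∑' n : ℕ, (n : ℝ) ^ (-(2 * σ)) with hZ
  set S := ∑ p ∈ primesUpTo y₀, (p : ℝ) ^ (-σ) with hS
  have hZ0 : 0 ≤ Z := tsum_nonneg fun n => by positivity
  have hS0 : 0 ≤ S := Finset.sum_nonneg fun n _ => by positivity
  refine ⟨4 * |k₀| * S + (B * |k₀| + |k₀| ^ 2 * Z) + 1, by positivity, fun T y k hT hk hkk hkT => ?_⟩
  have hk0 : 0 < k := by linarith
  have hkk' : k ≤ |k₀| := hkk.trans (le_abs_self _)
  have hn1 : 0 ≤ 4 * |k₀| * S := by positivity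
  have hn2 : 0 ≤ B * |k₀| + |k₀| ^ 2 * Z := by positivity
  rcases le_or_gt y₀ y with hy | hy
  · have h1 := h T y k hT hy hk hkT
    have h2 : ∑ p ∈ primesUpTo y, logBessel (k * (p : ℝ) ^ (-σ)) ≤ k ^ 2 * Z := by
      calc _ ≤ ∑ p ∈ primesUpTo y, k ^ 2 * ((p : ℝ) ^ (-σ)) ^ 2 :=
            Finset.sum_le_sum fun p _ => by
              rw [← mul_pow]
              exact logBessel_le_sq (by positivity)
        _ ≤ _ := by
            rw [← Finset.mul_sum]
            exact mul_le_mul_of_nonneg_left (sum_primesUpTo_rpow_neg_sq_le hσ y) (by positivity)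
    have h3 : 0 ≤ ∑ p ∈ primesUpTo y, logBessel (k * (p : ℝ) ^ (-σ)) :=
      Finset.sum_nonneg fun p _ => logBessel_nonneg _
    have h4 : B * k ≤ B * |k₀| := by gcongr
    have h5 : k ^ 2 * Z ≤ |k₀| ^ 2 * Z := by gcongr
    have h6 := abs_le.1 h1
    rw [abs_le]
    constructor <;> linarith [h6.1, h6.2]
  · have h1 := (abs_log_shortEulerMoment_le hσ hk0.le (show 0 < T by linarith) y).2
    have h2 : ∑ p ∈ primesUpTo y, (p : ℝ) ^ (-σ) ≤ S :=
      Finset.sum_le_sum_of_subset_of_nonneg (primesUpTo_subset hy.le) fun p _ _ => by positivity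
    have h3 : 4 * k * ∑ p ∈ primesUpTo y, (p : ℝ) ^ (-σ) ≤ 4 * |k₀| * S := by
      refine mul_le_mul (by linarith) h2 (Finset.sum_nonneg fun n _ => by positivity) (by positivity)
    linarith

/-- For `y < k^{1/σ}` the second error term dominates the logarithm of the moment: with
`x = k^{1/σ}` the pointwise bound is `k y^{1-σ} / log y = x (x/y)^{σ-1} / log y`, and
`log k / log y ≪ (x/y)^σ`. -/
lemma exists_abs_log_shortEulerMoment_le_of_lt {σ : ℝ} (hσ : 1 / 2 < σ) (hσ' : σ < 1) :
    ∃ C : ℝ, 0 < C ∧ ∀ T y k : ℝ, 3 ≤ T → 0 < y → 4 ≤ k → y < k ^ (1 / σ) →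
      |Real.log (shortEulerMoment σ T y k)| ≤
        C * (k ^ (1 / σ) / Real.log k * (k ^ (1 / σ) / y) ^ (2 * σ - 1)) := by
  have hσ0 : 0 < σ := by linarith
  have h1σ : 0 < 1 - σ := by linarith
  have hl2 : 0 < Real.log 2 := Real.log_pos (by norm_num)
  obtain ⟨C, hC, hsum⟩ := exists_sum_primesUpTo_rpow_le hσ0 hσ'
  obtain ⟨D, hD, hlog⟩ := exists_log_pow_le_mul 1 hσ0
  set F := 1 / (1 - σ) + C / Real.log 2 with hF
  have hF0 : 0 < F := by positivity
  refine ⟨4 * F * D, by positivity, fun T y k hT hy hk hyx => ?_⟩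
  have hk0 : 0 < k := by linarith
  have hm := (abs_log_shortEulerMoment_le hσ hk0.le (show 0 < T by linarith) y).2
  have hkσ : k = (k ^ (1 / σ)) ^ σ := by
    rw [← Real.rpow_mul hk0.le, one_div_mul_cancel hσ0.ne', Real.rpow_one]
  have hlx : Real.log (k ^ (1 / σ)) = Real.log k / σ := by rw [Real.log_rpow hk0]; ring
  have hℓ0 : 0 < Real.log k := Real.log_pos (by linarith)
  have hx0 : 0 < k ^ (1 / σ) := by positivity
  set x := k ^ (1 / σ) with hx
  set ℓ := Real.log k with hℓ
  rcases lt_or_ge y 2 with hy2 | hy2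
  · -- there are no primes below `y`, and the moment is `1`
    rw [primesUpTo_eq_empty hy2, Finset.sum_empty, mul_zero] at hm
    exact hm.trans (by positivity)
  have hly : 0 < Real.log y := Real.log_pos (by linarith)
  have hl2y : Real.log 2 ≤ Real.log y := Real.log_le_log (by norm_num) hy2
  have h1 : ∑ p ∈ primesUpTo y, (p : ℝ) ^ (-σ) ≤ F * (y ^ (1 - σ) / Real.log y) := by
    refine (hsum y hy2).trans ?_
    have e : C * (y ^ (1 - σ) / Real.log y ^ 2) =
        C / Real.log y * (y ^ (1 - σ) / Real.log y) := by field_simp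
    rw [e, hF, add_mul]
    refine add_le_add (le_of_eq (by field_simp)) ?_
    gcongr
  have h2 : ℓ ≤ D * (x / y) ^ σ * Real.log y := by
    have h := hlog y x hy2 hyx.le
    rw [pow_one, pow_one, hlx] at h
    refine le_trans ?_ h
    rw [le_div_iff₀ hσ0]
    nlinarith
  have h3 : k * y ^ (1 - σ) = x * (x / y) ^ (σ - 1) := by
    rw [Real.div_rpow hx0.le hy.le, show (1 : ℝ) - σ = -(σ - 1) by ring, Real.rpow_neg hy.le,
      ← mul_div_assoc, ← Real.rpow_one_add' hx0.le (by linarith), add_sub_cancel, ← hkσ]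
    rfl
  calc _ ≤ 4 * k * (F * (y ^ (1 - σ) / Real.log y)) := hm.trans (by gcongr)
    _ = 4 * F * (k * y ^ (1 - σ) * (1 / Real.log y)) := by ring
    _ ≤ 4 * F * (k * y ^ (1 - σ) * (D * (x / y) ^ σ / ℓ)) := by
        have : 1 / Real.log y ≤ D * (x / y) ^ σ / ℓ := by
          rw [div_le_div_iff₀ hly hℓ0]
          linarith
        gcongr
    _ = 4 * F * D * (x / ℓ * ((x / y) ^ (σ - 1) * (x / y) ^ σ)) := by rw [h3]; ring
    _ = _ := by
        rw [← Real.rpow_add (by positivity)]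
        ring_nf

/-- The expansion of the logarithm of the moment, in the three ranges `k` bounded,
`y < k^{1/σ}`, and `y ≥ k^{1/σ}` with `k` large. -/
lemma exists_abs_log_shortEulerMoment_sub_expansion_le {σ : ℝ} (hσ : 1 / 2 < σ) (hσ' : σ < 1)
    (N : ℕ) :
    ∃ A : ℝ, 0 < A ∧ ∀ T y k : ℝ, 3 ≤ T → 0 < y → 1 < k →
      k * y ^ (1 - σ) ≤ 1 / 8 * (1 - σ) * Real.log T →
      |Real.log (shortEulerMoment σ T y k) - k ^ (1 / σ) / Real.log k *
          ∑ n ∈ Finset.range (N + 1), momentCoeff σ n / Real.log k ^ n| ≤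
        A * (k ^ (1 / σ) / Real.log k *
          (1 / Real.log k ^ (N + 1) + (k ^ (1 / σ) / y) ^ (2 * σ - 1))) := by
  have hσ0 : 0 < σ := by linarith
  have h1σ : 1 < 1 / σ := by rwa [lt_div_iff₀ hσ0, one_mul]
  obtain ⟨y₀, B, hy₀, hB, hlarge⟩ := exists_abs_log_shortEulerMoment_sub_le hσ hσ'
  set k₀ := max 4 y₀ with hk₀
  have hk₀4 : 4 ≤ k₀ := le_max_left _ _
  obtain ⟨B₁, hB₁, hbdd⟩ := exists_abs_log_shortEulerMoment_le_of_le hσ hσ' k₀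
  obtain ⟨C₂, hC₂, hsmall⟩ := exists_abs_log_shortEulerMoment_le_of_lt hσ hσ'
  obtain ⟨C₃, hC₃, hexp⟩ := exists_abs_sum_logBessel_sub_le hσ hσ' N
  obtain ⟨C₄, hC₄, hlog⟩ := exists_log_pow_le (N + 2) (δ := 1 / σ - 1) (by linarith)
  set K := ∑ n ∈ Finset.range (N + 1), |momentCoeff σ n| with hK
  have hK0 : 0 ≤ K := Finset.sum_nonneg fun _ _ => abs_nonneg _
  have he1 : Real.exp 1 ≤ 4 := by linarith [Real.exp_one_lt_d9]
  set ℓ₀ := Real.log k₀ with hℓ₀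
  have hℓ₀1 : 1 ≤ ℓ₀ := (Real.le_log_iff_exp_le (by linarith)).2 (he1.trans hk₀4)
  refine ⟨(B₁ * ℓ₀ ^ (N + 2) + K * ℓ₀ ^ (N + 1)) + (C₂ + K) + (C₃ + B * C₄), by positivity,
    fun T y k hT hy hk hkT => ?_⟩
  have hk0 : 0 < k := by linarith
  have hkx : k ≤ k ^ (1 / σ) := by
    calc k = k ^ (1 : ℝ) := (Real.rpow_one k).symm
      _ ≤ k ^ (1 / σ) := Real.rpow_le_rpow_of_exponent_le hk.le h1σ.le
  have hsmall := hsmall T y k hT hy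
  have hexp := hexp k y
  have hxe : k ^ (1 / σ) = k ^ (1 / σ - 1) * k := by rw [← Real.rpow_add_one hk0.ne']; ring_nf
  have hlog := hlog k hk.le
  set x := k ^ (1 / σ) with hx
  set ℓ := Real.log k with hℓ
  set m := Real.log (shortEulerMoment σ T y k) with hm
  set P := ∑ n ∈ Finset.range (N + 1), momentCoeff σ n / ℓ ^ n with hP
  have hℓ0 : 0 < ℓ := Real.log_pos hk
  have hx1 : 1 < x := by linarith
  have hx0 : 0 < x := by linarith
  set E₁ := x / ℓ * (1 / ℓ ^ (N + 1)) with hE₁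
  set E₂ := x / ℓ * (x / y) ^ (2 * σ - 1) with hE₂
  have hE₁0 : 0 < E₁ := by positivity
  have hE₂0 : 0 < E₂ := by positivity
  rw [mul_add (x / ℓ), ← hE₁, ← hE₂]
  have hPle : |P| ≤ ∑ n ∈ Finset.range (N + 1), |momentCoeff σ n| / ℓ ^ n := by
    refine (Finset.abs_sum_le_sum_abs _ _).trans (le_of_eq (Finset.sum_congr rfl fun n _ => ?_))
    rw [abs_div, abs_of_pos (pow_pos hℓ0 n)]
  have hA₁ : 0 ≤ B₁ * ℓ₀ ^ (N + 2) + K * ℓ₀ ^ (N + 1) := by positivity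
  have hA₂ : 0 ≤ C₂ + K := by positivity
  have hA₃ : 0 ≤ C₃ + B * C₄ := by positivity
  have hEE : 0 ≤ E₁ + E₂ := by positivity
  have tri : |m - x / ℓ * P| ≤ |m| + x / ℓ * |P| := by
    refine (abs_sub _ _).trans (le_of_eq ?_)
    rw [abs_mul, abs_of_pos (div_pos hx0 hℓ0)]
  set A₁ := B₁ * ℓ₀ ^ (N + 2) + K * ℓ₀ ^ (N + 1) with hA₁def
  rcases le_or_gt k k₀ with hkk | hkk
  · have hm1 := hbdd T y k hT hk hkk hkT
    have hℓℓ : ℓ ≤ ℓ₀ := Real.log_le_log hk0 hkk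
    have h1 : B₁ ≤ B₁ * ℓ₀ ^ (N + 2) * E₁ := by
      have : 1 ≤ ℓ₀ ^ (N + 2) * E₁ := by
        rw [hE₁, div_mul_div_comm, mul_one, ← pow_succ', ← mul_div_assoc,
          le_div_iff₀ (by positivity), one_mul]
        calc ℓ ^ (N + 1 + 1) ≤ ℓ₀ ^ (N + 2) := by gcongr
          _ ≤ ℓ₀ ^ (N + 2) * x := le_mul_of_one_le_right (by positivity) hx1.le
      calc B₁ ≤ B₁ * (ℓ₀ ^ (N + 2) * E₁) := le_mul_of_one_le_right hB₁.le this
        _ = _ := by ring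
    have h2 : |P| ≤ K * ℓ₀ ^ (N + 1) * (1 / ℓ ^ (N + 1)) := by
      refine hPle.trans ?_
      rw [hK, Finset.sum_mul, Finset.sum_mul]
      refine Finset.sum_le_sum fun n hn => ?_
      have hn' : n ≤ N + 1 := by have := Finset.mem_range.1 hn; omega
      rw [mul_assoc, div_eq_mul_one_div]
      refine mul_le_mul_of_nonneg_left ?_ (abs_nonneg _)
      rw [mul_one_div, div_le_div_iff₀ (by positivity) (by positivity), one_mul]
      calc ℓ ^ (N + 1) = ℓ ^ (N + 1 - n) * ℓ ^ n := by rw [← pow_add]; congr 1; omega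
        _ ≤ ℓ₀ ^ (N + 1 - n) * ℓ ^ n := by gcongr
        _ ≤ ℓ₀ ^ (N + 1) * ℓ ^ n := by
            gcongr
            omega
    have h3 : x / ℓ * |P| ≤ K * ℓ₀ ^ (N + 1) * E₁ := by
      calc _ ≤ x / ℓ * (K * ℓ₀ ^ (N + 1) * (1 / ℓ ^ (N + 1))) := by gcongr
        _ = _ := by rw [hE₁]; ring
    calc _ ≤ A₁ * E₁ := by rw [hA₁def]; linarith
      _ ≤ _ := mul_le_mul (by linarith) (by linarith) hE₁0.le (by linarith)
  · have hk4 : 4 ≤ k := hk₀4.trans hkk.le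
    have hℓ1 : 1 ≤ ℓ := (Real.le_log_iff_exp_le hk0).2 (he1.trans hk4)
    rcases lt_or_ge y x with hyx | hyx
    · have h1 := hsmall hk4 hyx
      have h2 : |P| ≤ K := hPle.trans (Finset.sum_le_sum fun n _ =>
        div_le_self (abs_nonneg _) (one_le_pow₀ hℓ1))
      have h3 : x / ℓ * |P| ≤ K * E₂ := by
        have : 1 ≤ (x / y) ^ (2 * σ - 1) := Real.one_le_rpow
          (by rw [le_div_iff₀ hy]; linarith) (by linarith)
        calc x / ℓ * |P| ≤ x / ℓ * K := by gcongr
          _ ≤ x / ℓ * K * (x / y) ^ (2 * σ - 1) := le_mul_of_one_le_right (by positivity) this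
          _ = _ := by rw [hE₂]; ring
      calc _ ≤ (C₂ + K) * E₂ := by linarith
        _ ≤ _ := mul_le_mul (by linarith) (by linarith) hE₂0.le (by linarith)
    · -- here `y ≥ k` is large, and the error `O(k)` is smaller than `x / (log k)^{N + 2}`
      have h1 := hlarge T y k hT ((le_max_right 4 y₀).trans (by linarith)) hk hkT
      have h2 := hexp hk4 hyx
      rw [mul_add (x / ℓ), ← hE₁, ← hE₂] at h2
      have h3 : B * k ≤ B * C₄ * E₁ := by
        rw [mul_assoc]
        refine mul_le_mul_of_nonneg_left ?_ hB.le
        rw [hE₁, div_mul_div_comm, mul_one, ← pow_succ', ← mul_div_assoc,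
          le_div_iff₀ (by positivity), hxe]
        nlinarith
      have h4 := abs_sub_le m (∑ p ∈ primesUpTo y, logBessel (k * (p : ℝ) ^ (-σ))) (x / ℓ * P)
      calc _ ≤ B * C₄ * E₁ + C₃ * (E₁ + E₂) := by linarith
        _ ≤ (C₃ + B * C₄) * (E₁ + E₂) := by
          have := mul_pos (mul_pos hB hC₄) hE₂0
          linarith
        _ ≤ _ := mul_le_mul (by linarith) le_rfl hEE (by linarith)

theorem proposition3p1 (σ : ℝ) (hσ : 1 / 2 < σ) (hσ' : σ < 1) (N : ℕ) :
    (∀ n : ℕ, MeasureTheory.IntegrableOn (momentCoeffIntegrand σ n) (Set.Ioi 0)) ∧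
    0 < momentCoeff σ 0 ∧
    ∃ A : ℝ, 0 < A ∧ ∀ T y k : ℝ, 3 ≤ T → 0 < y → 1 < k →
      k * y ^ (1 - σ) ≤ 1 / 8 * (1 - σ) * Real.log T →
      ∃ R : ℝ,
        |R| ≤ A * (1 / Real.log k ^ (N + 1) + (k ^ (1 / σ) / y) ^ (2 * σ - 1)) ∧
        shortEulerMoment σ T y k =
          Real.exp (k ^ (1 / σ) / Real.log k *
            (∑ n ∈ Finset.range (N + 1), momentCoeff σ n / Real.log k ^ n + R)) := by
  refine ⟨integrableOn_momentCoeffIntegrand hσ hσ', momentCoeff_zero_pos hσ hσ', ?_⟩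
  obtain ⟨A, hA, h⟩ := exists_abs_log_shortEulerMoment_sub_expansion_le hσ hσ' N
  refine ⟨A, hA, fun T y k hT hy hk hkT => ?_⟩
  have h := h T y k hT hy hk hkT
  have hpos := (abs_log_shortEulerMoment_le hσ (by linarith : (0 : ℝ) ≤ k)
    (by linarith : 0 < T) y).1
  have hc : 0 < k ^ (1 / σ) / Real.log k :=
    div_pos (Real.rpow_pos_of_pos (by linarith) _) (Real.log_pos hk)
  set c := k ^ (1 / σ) / Real.log k
  set P := ∑ n ∈ Finset.range (N + 1), momentCoeff σ n / Real.log k ^ n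
  set m := Real.log (shortEulerMoment σ T y k) with hm
  refine ⟨m / c - P, ?_, ?_⟩
  · have e : m - c * P = c * (m / c - P) := by field_simp
    rw [e, abs_mul, abs_of_pos hc, mul_left_comm] at h
    exact le_of_mul_le_mul_left h hc
  · rw [show c * (P + (m / c - P)) = m by field_simp; ring, hm, Real.exp_log hpos]
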